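/- Let $n\ge 2$ and let $Q,B$ be constant real $n\times n$ matrices in canonical form: for some $m\ge0$ and integers $p_0\ge p_1\ge\dots\ge p_m\ge1$ with $p_0+\dots+p_m=n$, with respect to the splitting of the coordinates into consecutive groups of sizes $p_0,\dots,p_m$, the matrix $Q$ vanishes outside its upper left $p_0\times p_0$ block, which is symmetric and positive definite, and $B$ has blocks $B_{j}$ of size $p_j\times p_{j-1}$ and rank $p_j$ in the positions $(j,j-1)$, $j=1,\dots,m$, zero blocks below them, and arbitrary remaining blocks. Put $D=p_0+3p_1+\dots+(2m+1)p_m$, and $$Q(t)=\int_0^t e^{sB}Qe^{sB^{*}}\,ds,\qquad V(t)=\det Q(t).$$ Assume Hypothesis (B): there are $\gamma>0$ and a real number $2\le D_\infty<D$ such that $V(t)\ge\gamma\min\{t^{D},t^{D_\infty}\}$ for every $t>0$. Let $r>2$, with $r<\frac{2D}{D-2}$ when $D>2$, let $q$ be given by $\frac2q=D\left(\frac12-\frac1r\right)$, and let $1<q_\infty<\infty$ be such that $\frac{2}{q_\infty}\le D_\infty\left(\frac12-\frac1r\right)$. Then there is a constant $C>0$, depending only on $n,D,D_\infty,\gamma,r,q_\infty$,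 such that the following holds for every $\varphi\in L^2(\mathbb R^n)$ and every measurable $F:\mathbb R^n\times\mathbb R\to\mathbb C$ with $\big\|e^{\frac{\operatorname{tr}B}{2}t}\|F(\cdot,t)\|_{L^{r'}(\mathbb R^n)}\big\|_{L^{q'}_t\cap L^{q_\infty'}_t}<\infty$. The Cauchy problem $$\partial_tu-i\operatorname{tr}(Q\nabla^2u)-\langle Bx,\nabla u\rangle=F,\qquad u(\cdot,0)=\varphi,$$ has a weak solution $u\in C(\mathbb R;L^2(\mathbb R^n))$, i.e. for every Schwartz function $\psi$ on $\mathbb R^n$ and every $t\in\mathbb R$ $$\int u(x,t)\psi(x)\,dx=\int\varphi\,\psi\,dx+\int_0^t\left(\int u(x,s)\big[i\operatorname{tr}(Q\nabla^2\psi)-\langle Bx,\nabla\psi\rangle-(\operatorname{tr}B)\psi\big](x)\,dx+\int F(x,s)\psi(x)\,dx\right)ds,$$ and every such solution satisfies $$\Big\|e^{\frac{\operatorname{tr}B}{2}t}\|u(\cdot,t)\|_{L^r(\mathbb R^n)}\Big\|_{L^q_t+L^{q_\infty}_t}\le C\left\{\|\varphi\|_{L^2(\mathbb R^n)}+\Big\|e^{\frac{\operatorname{tr}B}{2}t}\|F(\cdot,t)\|_{L^{r'}(\mathbb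 R^n)}\Big\|_{L^{q'}_t\cap L^{q_\infty'}_t}\right\}.$$ Here $t$ ranges over $\mathbb R$, a prime denotes the conjugate exponent, $\|g\|_{X+Y}=\inf\{\|g_1\|_X+\|g_2\|_Y:\ g=g_1+g_2\}$ and $\|g\|_{X\cap Y}=\max\{\|g\|_X,\|g\|_Y\}$. -/

import Mathlib

open MeasureTheory
open scoped ENNReal SchwartzMap

noncomputable section

namespace DegenerateSchrodinger

/-! ### The operator: canonical form, homogeneous dimension, volume function -/

/-- The `(j, l)` block, of size `p j × p l`, of an `n × n` matrix whose rows and columns are cut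
into consecutive groups of sizes `p 0, …, p m` with `p 0 + ⋯ + p m = n`. -/
def block {n m : ℕ} {p : Fin (m + 1) → ℕ} (hp : ∑ j, p j = n)
    (M : Matrix (Fin n) (Fin n) ℝ) (j l : Fin (m + 1)) : Matrix (Fin (p j)) (Fin (p l)) ℝ :=
  M.submatrix (fun a => finCongr hp (finSigmaFinEquiv ⟨j, a⟩))
    (fun b => finCongr hp (finSigmaFinEquiv ⟨l, b⟩))

/-- `Q` and `B` are in canonical form with block sizes `p 0 ≥ p 1 ≥ ⋯ ≥ p m ≥ 1`: `Q` vanishes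
outside its `(0, 0)` block, which is symmetric and positive definite; the blocks `(j + 1, j)` of
`B` have full rank `p (j + 1)`; the blocks of `B` strictly below these vanish; the remaining
blocks of `B` are arbitrary. -/
structure IsCanonicalForm {n m : ℕ} (p : Fin (m + 1) → ℕ)
    (Q B : Matrix (Fin n) (Fin n) ℝ) : Prop where
  sum_eq : ∑ j, p j = n
  antitone : Antitone p
  one_le : 1 ≤ p (Fin.last m)
  posDef : (block sum_eq Q 0 0).PosDef
  zero_Q : ∀ j l : Fin (m + 1), ¬(j = 0 ∧ l = 0) → block sum_eq Q j l = 0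
  rank_B : ∀ j : Fin m, (block sum_eq B j.succ j.castSucc).rank = p j.succ
  zero_B : ∀ j l : Fin (m + 1), (l : ℕ) + 1 < (j : ℕ) → block sum_eq B j l = 0

/-- The local homogeneous dimension `p 0 + 3 * p 1 + ⋯ + (2 * m + 1) * p m`. -/
def homDim {m : ℕ} (p : Fin (m + 1) → ℕ) : ℕ := ∑ j : Fin (m + 1), (2 * (j : ℕ) + 1) * p j

/-- The controllability Gramian `Q(t) = ∫₀ᵗ exp(sB) Q exp(sBᵀ) ds` (entrywise integral). -/
def gramian {n : ℕ} (Q B : Matrix (Fin n) (Fin n) ℝ) (t : ℝ) : Matrix (Fin n) (Fin n) ℝ :=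
  Matrix.of fun i j =>
    ∫ s in (0 : ℝ)..t, (NormedSpace.exp (s • B) * Q * NormedSpace.exp (s • B.transpose)) i j

/-- The volume function `V(t) = det Q(t)`. -/
def volumeFn {n : ℕ} (Q B : Matrix (Fin n) (Fin n) ℝ) (t : ℝ) : ℝ := (gramian Q B t).det

/-- The lower bound `V(t) ≥ γ min{t^D, t^{D∞}}` for all `t > 0`. -/
def VolumeLowerBound {n : ℕ} (Q B : Matrix (Fin n) (Fin n) ℝ) (γ : ℝ) (D : ℕ) (Dinf : ℝ) : Prop :=
  ∀ t : ℝ, 0 < t → γ * min (t ^ D) (t ^ Dinf) ≤ volumeFn Q B t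

/-! ### Weak solutions of the Cauchy problem -/

/-- The formal transpose of the spatial operator `u ↦ i tr(Q ∇²u) + ⟨Bx, ∇u⟩`, that is
`ψ ↦ i tr(Q ∇²ψ) - div(ψ Bx) = i tr(Q ∇²ψ) - ⟨Bx, ∇ψ⟩ - (tr B) ψ`. -/
def transposeOp {n : ℕ} (Q B : Matrix (Fin n) (Fin n) ℝ)
    (ψ : EuclideanSpace ℝ (Fin n) → ℂ) (x : EuclideanSpace ℝ (Fin n)) : ℂ :=
  Complex.I * (∑ i, ∑ j, (Q i j : ℂ) *
      iteratedFDeriv ℝ 2 ψ x ![EuclideanSpace.single i 1, EuclideanSpace.single j 1])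
    - fderiv ℝ ψ x (B.toEuclideanLin x) - (B.trace : ℂ) * ψ x

/-- `u ∈ C(ℝ; L²(ℝⁿ))` is a weak solution of
`∂ₜu - i tr(Q ∇²u) - ⟨Bx, ∇u⟩ = F`, `u(·, 0) = φ`:
the equation is tested against Schwartz functions of `x` and integrated in time. -/
structure IsSolution {n : ℕ} (Q B : Matrix (Fin n) (Fin n) ℝ)
    (φ : Lp ℂ 2 (volume : Measure (EuclideanSpace ℝ (Fin n))))
    (F : ℝ → EuclideanSpace ℝ (Fin n) → ℂ)
    (u : ℝ → Lp ℂ 2 (volume : Measure (EuclideanSpace ℝ (Fin n)))) : Prop where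
  continuous : Continuous u
  initial : u 0 = φ
  weak_eq : ∀ (ψ : 𝓢(EuclideanSpace ℝ (Fin n), ℂ)) (t : ℝ),
    ∫ x, u t x * ψ x = (∫ x, φ x * ψ x) +
      ∫ s in (0 : ℝ)..t, ((∫ x, u s x * transposeOp Q B ψ x) + ∫ x, F s x * ψ x)

/-! ### Norms in time and space -/

/-- The function `t ↦ e^{t tr B / 2} ‖G(·, t)‖_{L^ρ(ℝⁿ)}`, with values in `[0, ∞]`. -/
def weightedNorm {n : ℕ} (B : Matrix (Fin n) (Fin n) ℝ) (ρ : ℝ≥0∞)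
    (G : ℝ → EuclideanSpace ℝ (Fin n) → ℂ) (t : ℝ) : ℝ≥0∞ :=
  ENNReal.ofReal (Real.exp (B.trace / 2 * t)) * eLpNorm (G t) ρ volume

/-- The norm of `L^a(ℝ) + L^b(ℝ)` for a nonnegative function `g`, namely the infimum of
`‖g₁‖_{L^a} + ‖g₂‖_{L^b}` over measurable decompositions `g = g₁ + g₂`. As `g ≥ 0`, it makes no
difference whether the pieces are taken nonnegative or of arbitrary sign: if `g = g₁ + g₂`, then
`min g |g₁|` and `g - min g |g₁| ≤ |g₂|` are nonnegative pieces with no larger norms. -/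
def sumNorm (a b : ℝ≥0∞) (g : ℝ → ℝ≥0∞) : ℝ≥0∞ :=
  ⨅ (g₁ : ℝ → ℝ≥0∞) (g₂ : ℝ → ℝ≥0∞) (_ : AEMeasurable g₁ volume) (_ : AEMeasurable g₂ volume)
    (_ : g =ᵐ[volume] g₁ + g₂), eLpNorm g₁ a volume + eLpNorm g₂ b volume

/-- The norm of `L^a(ℝ) ∩ L^b(ℝ)`. -/
def interNorm (a b : ℝ≥0∞) (g : ℝ → ℝ≥0∞) : ℝ≥0∞ :=
  max (eLpNorm g a volume) (eLpNorm g b volume)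

end DegenerateSchrodinger

end

open MeasureTheory Filter Topology
open scoped ENNReal SchwartzMap FourierTransform LineDeriv

/-! ### The Hardy-Littlewood-Sobolev inequality on the line -/

/-- The Riesz kernel `|z| ^ (-l)` on the line. -/
noncomputable def rieszKernel (l z : ℝ) : ℝ≥0∞ := ENNReal.ofReal (|z| ^ (-l))

lemma measurable_rieszKernel (l : ℝ) : Measurable (rieszKernel l) := by
  unfold rieszKernel; fun_prop

lemma rieszKernel_neg (l z : ℝ) : rieszKernel l (-z) = rieszKernel l z := by
  simp [rieszKernel]

lemma lintegral_rieszKernel_le {l R : ℝ} (hl : l < 1) (hR : 0 < R) :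
    ∫⁻ z in {z : ℝ | |z| ≤ R}, rieszKernel l z = ENNReal.ofReal (2 * R ^ (1 - l) / (1 - l)) := by
  have h1 : ∫⁻ z in Set.Ioc 0 R, rieszKernel l z = ENNReal.ofReal (R ^ (1 - l) / (1 - l)) := by
    have : ∫⁻ z in Set.Ioc 0 R, rieszKernel l z = ∫⁻ z in Set.Ioc 0 R, ENNReal.ofReal (z ^ (-l)) := by
      refine setLIntegral_congr_fun measurableSet_Ioc fun z hz => ?_
      simp only [rieszKernel]
      rw [abs_of_pos hz.1]
    rw [this, ← ofReal_integral_eq_lintegral_ofReal]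
    · rw [← intervalIntegral.integral_of_le hR.le, integral_rpow (Or.inl (by linarith)),
        Real.zero_rpow (by linarith)]
      congr 1
      rw [show -l + 1 = 1 - l by ring, sub_zero]
    · rw [← IntegrableOn, ← intervalIntegrable_iff_integrableOn_Ioc_of_le hR.le]
      exact intervalIntegral.intervalIntegrable_rpow' (by linarith)
    · refine (ae_restrict_iff' measurableSet_Ioc).2 (.of_forall fun z hz => ?_)
      exact Real.rpow_nonneg hz.1.le _
  have h2 : ∫⁻ z in Set.Ico (-R) 0, rieszKernel l z = ∫⁻ z in Set.Ioc 0 R, rieszKernel l z := by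
    rw [← lintegral_indicator measurableSet_Ico, ← lintegral_indicator measurableSet_Ioc,
      ← lintegral_neg_eq_self]
    refine lintegral_congr fun z => ?_
    simp only [Set.indicator, Set.mem_Ico, Set.mem_Ioc, rieszKernel_neg]
    congr 1
    simp only [eq_iff_iff]
    constructor <;> rintro ⟨h, h'⟩ <;> constructor <;> linarith
  have hset : {z : ℝ | |z| ≤ R} =ᵐ[volume] (Set.Ico (-R) 0 ∪ Set.Ioc 0 R : Set ℝ) := by
    have h0 : ∀ᵐ z : ℝ, z ≠ 0 := by simp [ae_iff]
    filter_upwards [h0] with z hz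
    simp only [eq_iff_iff]
    change |z| ≤ R ↔ _
    rw [abs_le]
    constructor
    · rintro ⟨h, h'⟩
      rcases lt_or_gt_of_ne hz with h0 | h0
      · exact Or.inl ⟨h, h0⟩
      · exact Or.inr ⟨h0, h'⟩
    · rintro (⟨h, h'⟩ | ⟨h, h'⟩) <;> constructor <;> linarith
  rw [setLIntegral_congr hset, lintegral_union measurableSet_Ioc, h2, h1, ← two_mul]
  · rw [mul_div_assoc, ENNReal.ofReal_mul (by norm_num), ENNReal.ofReal_ofNat]
  · rw [Set.disjoint_left]; intro z h h'; exact absurd h.2 (not_lt.2 h'.1.le)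

lemma lintegral_inv_sq_gt {R : ℝ} (hR : 0 < R) :
    ∫⁻ z in {z : ℝ | R < |z|}, ENNReal.ofReal (|z| ^ (-2 : ℝ)) = ENNReal.ofReal (2 / R) := by
  have h1 : ∫⁻ z in Set.Ioi R, ENNReal.ofReal (|z| ^ (-2 : ℝ)) = ENNReal.ofReal (1 / R) := by
    have : ∫⁻ z in Set.Ioi R, ENNReal.ofReal (|z| ^ (-2 : ℝ)) =
        ∫⁻ z in Set.Ioi R, ENNReal.ofReal (z ^ (-2 : ℝ)) := by
      refine setLIntegral_congr_fun measurableSet_Ioi fun z hz => ?_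
      rw [abs_of_pos (hR.trans hz)]
    rw [this, ← ofReal_integral_eq_lintegral_ofReal]
    · rw [integral_Ioi_rpow_of_lt (by norm_num) hR]
      congr 1
      rw [show (-2 : ℝ) + 1 = -1 by norm_num, Real.rpow_neg_one]; field_simp
    · exact integrableOn_Ioi_rpow_of_lt (by norm_num) hR
    · refine (ae_restrict_iff' measurableSet_Ioi).2 (.of_forall fun z hz => ?_)
      exact Real.rpow_nonneg (hR.trans hz).le _
  have h2 : ∫⁻ z in Set.Iio (-R), ENNReal.ofReal (|z| ^ (-2 : ℝ)) =
      ∫⁻ z in Set.Ioi R, ENNReal.ofReal (|z| ^ (-2 : ℝ)) := by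
    rw [← lintegral_indicator measurableSet_Iio, ← lintegral_indicator measurableSet_Ioi,
      ← lintegral_neg_eq_self]
    refine lintegral_congr fun z => ?_
    simp only [Set.indicator, Set.mem_Iio, Set.mem_Ioi, abs_neg, neg_lt_neg_iff]
  have hset : {z : ℝ | R < |z|} = (Set.Iio (-R) ∪ Set.Ioi R : Set ℝ) := by
    ext z
    simp only [Set.mem_ofPred_eq, Set.mem_union, Set.mem_Iio, Set.mem_Ioi, lt_abs]
    constructor <;> rintro (h | h)
    · exact Or.inr h
    · exact Or.inl (by linarith)
    · exact Or.inr (by linarith)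
    · exact Or.inl h
  rw [hset, lintegral_union measurableSet_Ioi, h2, h1, ← two_mul]
  · rw [div_eq_mul_one_div 2 R, ENNReal.ofReal_mul (by norm_num), ENNReal.ofReal_ofNat]
  · rw [Set.disjoint_left]; intro z h h'
    have a : z < -R := h
    have b : R < z := h'
    linarith

/-- One half of the diagonal Hardy-Littlewood-Sobolev inequality for normalized functions. -/
lemma hls_half {l p : ℝ} (hl0 : 0 < l) (hl1 : l < 1) (hp : p = 2 / (2 - l))
    {f g : ℝ → ℝ≥0∞} (hf : Measurable f) (hg : Measurable g)
    (hf1 : ∫⁻ x, f x ^ p = 1) (hg1 : ∫⁻ x, g x ^ p = 1) :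
    ∫⁻ x, ∫⁻ y, {y | g y ≤ f x}.indicator (fun y => f x * g y * rieszKernel l (x - y)) y ≤
      ENNReal.ofReal (2 / (1 - l) + 2 ^ (l / 2)) := by
  have h2l : 0 < 2 - l := by linarith
  have hp0 : 0 < p := by rw [hp]; positivity
  have hp1 : 1 < p := by rw [hp, lt_div_iff₀ h2l]; linarith
  have hfin : ∀ᵐ x, f x < ∞ := by
    have := ae_lt_top (hf.pow_const p) (by rw [hf1]; simp)
    filter_upwards [this] with x hx
    by_contra h
    simp only [not_lt, top_le_iff] at h
    rw [h, ENNReal.top_rpow_of_pos hp0] at hx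
    simp at hx
  calc _ ≤ ∫⁻ x, ENNReal.ofReal (2 / (1 - l) + 2 ^ (l / 2)) * f x ^ p := by
        refine lintegral_mono_ae ?_
        filter_upwards [hfin] with x hx
        rcases eq_or_ne (f x) 0 with h0 | h0
        · simp [h0]
        set a := (f x).toReal with ha
        have ha0 : 0 < a := ENNReal.toReal_pos h0 hx.ne
        have hfa : f x = ENNReal.ofReal a := (ENNReal.ofReal_toReal hx.ne).symm
        set R := a ^ (-p) with hR
        have hR0 : 0 < R := Real.rpow_pos_of_pos ha0 _
        have hmeas : Measurable fun y => rieszKernel l (x - y) :=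
          (measurable_rieszKernel l).comp (by fun_prop)
        have hA : MeasurableSet {y : ℝ | |x - y| ≤ R} :=
          measurableSet_le (by fun_prop) measurable_const
        have hB : MeasurableSet {y : ℝ | R < |x - y|} :=
          measurableSet_lt measurable_const (by fun_prop)
        have near : ∫⁻ y in {y : ℝ | |x - y| ≤ R}, rieszKernel l (x - y) =
            ENNReal.ofReal (2 * R ^ (1 - l) / (1 - l)) := by
          rw [← lintegral_rieszKernel_le hl1 hR0, ← lintegral_indicator hA,
            ← lintegral_indicator (measurableSet_le (by fun_prop) measurable_const),
            ← lintegral_sub_left_eq_self (Set.indicator {z : ℝ | |z| ≤ R} _) x]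
          rfl
        have far : ∫⁻ y in {y : ℝ | R < |x - y|}, g y * rieszKernel l (x - y) ≤
            ENNReal.ofReal ((2 / R) ^ (l / 2)) := by
          have hpq : p.HolderConjugate (2 / l) := by
            rw [Real.holderConjugate_iff]
            refine ⟨hp1, ?_⟩
            rw [hp]; field_simp; ring
          calc _ ≤ (∫⁻ y in {y : ℝ | R < |x - y|}, g y ^ p) ^ (1 / p) *
                (∫⁻ y in {y : ℝ | R < |x - y|}, rieszKernel l (x - y) ^ (2 / l)) ^ (1 / (2 / l)) :=
                ENNReal.lintegral_mul_le_Lp_mul_Lq _ hpq hg.aemeasurable hmeas.aemeasurable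
            _ ≤ 1 ^ (1 / p) * (ENNReal.ofReal (2 / R)) ^ (1 / (2 / l)) := by
                gcongr
                · rw [← hg1]; exact setLIntegral_le_lintegral _ _
                · rw [← lintegral_inv_sq_gt hR0, ← lintegral_indicator hB,
                    ← lintegral_indicator (measurableSet_lt measurable_const (by fun_prop)),
                    ← lintegral_sub_left_eq_self (Set.indicator {z : ℝ | R < |z|} _) x]
                  refine lintegral_mono fun y => ?_
                  simp only [Set.indicator, Set.mem_ofPred_eq]
                  split_ifs with h
                  · rw [rieszKernel, ENNReal.ofReal_rpow_of_nonneg (by positivity) (by positivity),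
                      ← Real.rpow_mul (abs_nonneg _)]
                    apply le_of_eq; congr 2; field_simp
                  · exact le_rfl
            _ = _ := by
                rw [ENNReal.one_rpow, one_mul, one_div_div,
                  ENNReal.ofReal_rpow_of_nonneg (by positivity) (by positivity)]
        calc _ ≤ ∫⁻ y, ({y : ℝ | |x - y| ≤ R}.indicator (fun y => f x * f x * rieszKernel l (x - y)) y
                + {y : ℝ | R < |x - y|}.indicator
                  (fun y => f x * (g y * rieszKernel l (x - y))) y) := by
              refine lintegral_mono fun y => ?_
              by_cases hy : |x - y| ≤ R
              · have : ¬ (R < |x - y|) := not_lt.2 hy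
                simp only [Set.indicator, Set.mem_ofPred_eq, hy, this, if_true, if_false, add_zero]
                split_ifs with h
                · gcongr
                · exact zero_le
              · have h' : R < |x - y| := not_le.1 hy
                simp only [Set.indicator, Set.mem_ofPred_eq, hy, h', if_true, if_false, zero_add]
                split_ifs with h
                · rw [mul_assoc]
                · exact zero_le
          _ = f x * f x * ENNReal.ofReal (2 * R ^ (1 - l) / (1 - l)) +
                f x * ∫⁻ y in {y : ℝ | R < |x - y|}, g y * rieszKernel l (x - y) := by
              rw [lintegral_add_left ((hmeas.const_mul _).indicator hA), lintegral_indicator hA,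
                lintegral_indicator hB, lintegral_const_mul _ hmeas, near,
                lintegral_const_mul _ (f := fun y => g y * rieszKernel l (x - y)) (hg.mul hmeas)]
          _ ≤ f x * f x * ENNReal.ofReal (2 * R ^ (1 - l) / (1 - l)) +
                f x * ENNReal.ofReal ((2 / R) ^ (l / 2)) := by gcongr
          _ = _ := by
              have hl' : 0 < 1 - l := by linarith
              rw [hfa, ← ENNReal.ofReal_mul ha0.le, ← ENNReal.ofReal_mul (by positivity),
                ← ENNReal.ofReal_mul ha0.le, ← ENNReal.ofReal_add (by positivity) (by positivity),
                ENNReal.ofReal_rpow_of_pos ha0, ← ENNReal.ofReal_mul (by positivity)]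
              congr 1
              have e1 : a * a * R ^ (1 - l) = a ^ p := by
                rw [hR, ← Real.rpow_mul ha0.le, ← pow_two, ← Real.rpow_natCast,
                  ← Real.rpow_add ha0]
                congr 1
                rw [hp]; field_simp; push_cast; ring
              have e2 : a * (2 / R) ^ (l / 2) = 2 ^ (l / 2) * a ^ p := by
                rw [Real.div_rpow (by norm_num) hR0.le, hR, ← Real.rpow_mul ha0.le, div_eq_mul_inv,
                  ← Real.rpow_neg ha0.le]
                rw [mul_left_comm]
                congr 1
                nth_rw 1 [← Real.rpow_one a]
                rw [← Real.rpow_add ha0]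
                congr 1
                rw [hp]; field_simp; ring
              rw [e2, add_mul, ← e1]; ring
    _ = _ := by rw [lintegral_const_mul _ (hf.pow_const p), hf1, mul_one]

lemma hls_normalized {l p : ℝ} (hl0 : 0 < l) (hl1 : l < 1) (hp : p = 2 / (2 - l))
    {f g : ℝ → ℝ≥0∞} (hf : Measurable f) (hg : Measurable g)
    (hf1 : ∫⁻ x, f x ^ p = 1) (hg1 : ∫⁻ x, g x ^ p = 1) :
    ∫⁻ x, ∫⁻ y, f x * g y * rieszKernel l (x - y) ≤
      2 * ENNReal.ofReal (2 / (1 - l) + 2 ^ (l / 2)) := by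
  have hk : Measurable fun z : ℝ × ℝ => rieszKernel l (z.1 - z.2) :=
    (measurable_rieszKernel l).comp (by fun_prop)
  have hm : Measurable fun z : ℝ × ℝ => f z.1 * g z.2 * rieszKernel l (z.1 - z.2) :=
    ((hf.comp measurable_fst).mul (hg.comp measurable_snd)).mul hk
  have hS : MeasurableSet {z : ℝ × ℝ | g z.2 ≤ f z.1} :=
    measurableSet_le (hg.comp measurable_snd) (hf.comp measurable_fst)
  have hS' : MeasurableSet {z : ℝ × ℝ | f z.1 ≤ g z.2} :=
    measurableSet_le (hf.comp measurable_fst) (hg.comp measurable_snd)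
  calc _ ≤ ∫⁻ x, ∫⁻ y, ({y | g y ≤ f x}.indicator (fun y => f x * g y * rieszKernel l (x - y)) y +
        {y | f x ≤ g y}.indicator (fun y => f x * g y * rieszKernel l (x - y)) y) := by
        refine lintegral_mono fun x => lintegral_mono fun y => ?_
        simp only [Set.indicator, Set.mem_ofPred_eq]
        rcases le_total (g y) (f x) with h | h <;> simp [h]
    _ = (∫⁻ x, ∫⁻ y, {y | g y ≤ f x}.indicator (fun y => f x * g y * rieszKernel l (x - y)) y) +
        ∫⁻ x, ∫⁻ y, {y | f x ≤ g y}.indicator (fun y => f x * g y * rieszKernel l (x - y)) y := by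
        rw [← lintegral_add_left]
        · refine lintegral_congr fun x => ?_
          rw [lintegral_add_left]
          exact (hm.indicator hS).comp (measurable_prodMk_left (x := x))
        · exact (hm.indicator hS).lintegral_prod_right'
    _ ≤ ENNReal.ofReal (2 / (1 - l) + 2 ^ (l / 2)) + ENNReal.ofReal (2 / (1 - l) + 2 ^ (l / 2)) := by
        gcongr
        · exact hls_half hl0 hl1 hp hf hg hf1 hg1
        · rw [lintegral_lintegral_swap (f := fun x y => {y | f x ≤ g y}.indicator
            (fun y => f x * g y * rieszKernel l (x - y)) y) (hm.indicator hS').aemeasurable]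
          refine le_trans (le_of_eq ?_) (hls_half hl0 hl1 hp hg hf hg1 hf1)
          refine lintegral_congr fun y => lintegral_congr fun x => ?_
          simp only [Set.indicator, Set.mem_ofPred_eq]
          rw [← rieszKernel_neg l (x - y), neg_sub, mul_comm (f x)]
    _ = _ := by rw [two_mul]

/-- The diagonal **Hardy-Littlewood-Sobolev inequality** on the line. -/
theorem hls {l p : ℝ} (hl0 : 0 < l) (hl1 : l < 1) (hp : p = 2 / (2 - l)) :
    ∃ C : ℝ≥0∞, C ≠ ∞ ∧ ∀ f g : ℝ → ℝ≥0∞, AEMeasurable f → AEMeasurable g →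
      ∫⁻ x, ∫⁻ y, f x * g y * rieszKernel l (x - y) ≤
        C * (eLpNorm f (ENNReal.ofReal p) volume * eLpNorm g (ENNReal.ofReal p) volume) := by
  have h2l : 0 < 2 - l := by linarith
  have hp0 : 0 < p := by rw [hp]; positivity
  have hl' : 0 < 1 - l := by linarith
  set C := 2 * ENNReal.ofReal (2 / (1 - l) + 2 ^ (l / 2)) with hC
  have hC0 : C ≠ 0 := by
    rw [hC]; simp only [ne_eq, mul_eq_zero, OfNat.ofNat_ne_zero, ENNReal.ofReal_eq_zero, not_le,
      false_or]; positivity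
  have hnorm : ∀ f : ℝ → ℝ≥0∞, eLpNorm f (ENNReal.ofReal p) volume = (∫⁻ x, f x ^ p) ^ (1 / p) := by
    intro f
    rw [eLpNorm_eq_lintegral_rpow_enorm_toReal (by simpa using hp0) (by simp),
      ENNReal.toReal_ofReal hp0.le]
    simp
  refine ⟨C, by rw [hC]; finiteness, ?_⟩
  have key : ∀ f g : ℝ → ℝ≥0∞, Measurable f → Measurable g →
      ∫⁻ x, ∫⁻ y, f x * g y * rieszKernel l (x - y) ≤
        C * (eLpNorm f (ENNReal.ofReal p) volume * eLpNorm g (ENNReal.ofReal p) volume) := by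
    intro f g hf hg
    have zero_case : ∀ f : ℝ → ℝ≥0∞, Measurable f → eLpNorm f (ENNReal.ofReal p) volume = 0 →
        f =ᵐ[volume] 0 := fun f hf h =>
      (eLpNorm_eq_zero_iff hf.aestronglyMeasurable (by simpa using hp0)).1 h
    by_cases hf0 : eLpNorm f (ENNReal.ofReal p) volume = 0
    · have : ∫⁻ x, ∫⁻ y, f x * g y * rieszKernel l (x - y) = ∫⁻ _ : ℝ, 0 := by
        refine lintegral_congr_ae ?_
        filter_upwards [zero_case f hf hf0] with x hx
        simp [hx]
      rw [this]; simp
    by_cases hg0 : eLpNorm g (ENNReal.ofReal p) volume = 0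
    · have : ∫⁻ x, ∫⁻ y, f x * g y * rieszKernel l (x - y) = ∫⁻ _ : ℝ, 0 := by
        refine lintegral_congr fun x => ?_
        rw [← lintegral_zero (μ := (volume : Measure ℝ))]
        refine lintegral_congr_ae ?_
        filter_upwards [zero_case g hg hg0] with y hy
        simp [hy]
      rw [this]; simp
    by_cases hft : eLpNorm f (ENNReal.ofReal p) volume = ∞
    · rw [hft, ENNReal.top_mul hg0, ENNReal.mul_top hC0]; exact le_top
    by_cases hgt : eLpNorm g (ENNReal.ofReal p) volume = ∞
    · rw [hgt, ENNReal.mul_top hf0, ENNReal.mul_top hC0]; exact le_top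
    set a := eLpNorm f (ENNReal.ofReal p) volume
    set b := eLpNorm g (ENNReal.ofReal p) volume
    have normal : ∀ (f : ℝ → ℝ≥0∞), Measurable f → ∀ a, a = eLpNorm f (ENNReal.ofReal p) volume →
        a ≠ 0 → a ≠ ∞ → ∫⁻ x, (a⁻¹ * f x) ^ p = 1 := by
      intro f hf a ha h0 ht
      simp_rw [ENNReal.mul_rpow_of_nonneg _ _ hp0.le]
      rw [lintegral_const_mul _ (hf.pow_const p)]
      have : ∫⁻ x, f x ^ p = a ^ p := by
        rw [ha, hnorm, ← ENNReal.rpow_mul, one_div_mul_cancel hp0.ne', ENNReal.rpow_one]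
      rw [this, ← ENNReal.mul_rpow_of_nonneg _ _ hp0.le, ENNReal.inv_mul_cancel h0 ht,
        ENNReal.one_rpow]
    have := hls_normalized hl0 hl1 hp (hf.const_mul a⁻¹) (hg.const_mul b⁻¹)
      (normal f hf a rfl hf0 hft) (normal g hg b rfl hg0 hgt)
    calc _ = ∫⁻ x, ∫⁻ y, (a * b) * (a⁻¹ * f x * (b⁻¹ * g y) * rieszKernel l (x - y)) := by
          refine lintegral_congr fun x => lintegral_congr fun y => ?_
          have : (a * b) * (a⁻¹ * f x * (b⁻¹ * g y) * rieszKernel l (x - y)) =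
            (a * a⁻¹) * (b * b⁻¹) * (f x * g y * rieszKernel l (x - y)) := by ring
          rw [this, ENNReal.mul_inv_cancel hf0 hft, ENNReal.mul_inv_cancel hg0 hgt, one_mul, one_mul]
      _ = (a * b) * ∫⁻ x, ∫⁻ y, (a⁻¹ * f x * (b⁻¹ * g y) * rieszKernel l (x - y)) := by
          rw [← lintegral_const_mul' _ _ (by finiteness)]
          refine lintegral_congr fun x => ?_
          rw [lintegral_const_mul' _ _ (by finiteness)]
      _ ≤ (a * b) * C := by gcongr
      _ = _ := mul_comm _ _
  intro f g hf hg
  have e : ∫⁻ x, ∫⁻ y, f x * g y * rieszKernel l (x - y) =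
      ∫⁻ x, ∫⁻ y, hf.mk f x * hg.mk g y * rieszKernel l (x - y) := by
    refine lintegral_congr_ae ?_
    filter_upwards [hf.ae_eq_mk] with x hx
    refine lintegral_congr_ae ?_
    filter_upwards [hg.ae_eq_mk] with y hy
    rw [hx, hy]
  rw [e, eLpNorm_congr_ae hf.ae_eq_mk, eLpNorm_congr_ae hg.ae_eq_mk]
  exact key _ _ hf.measurable_mk hg.measurable_mk

/-! ### Duality for the norm of a sum of Lebesgue spaces -/

lemma eLpNorm_ofReal_eq {α : Type*} [MeasurableSpace α] {μ : Measure α} {e : ℝ} (he : 0 < e)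
    (f : α → ℝ≥0∞) : eLpNorm f (ENNReal.ofReal e) μ = (∫⁻ x, f x ^ e ∂μ) ^ (1 / e) := by
  rw [eLpNorm_eq_lintegral_rpow_enorm_toReal (by simpa using he) (by simp),
    ENNReal.toReal_ofReal he.le]
  simp

lemma setLIntegral_rpow_le_one_of_pairing {k : ℝ → ℝ≥0∞} (hk : Measurable k) {T : Set ℝ}
    (hT : MeasurableSet T) {e c d : ℝ} (he : 1 < e) (hc : 1 < c) (hd : 1 < d)
    (hkc : ∀ x ∈ T, k x ^ ((e - 1) * c) ≤ k x ^ e) (hkd : ∀ x ∈ T, k x ^ ((e - 1) * d) ≤ k x ^ e)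
    (hfin : ∫⁻ x in T, k x ^ e ≠ ∞)
    (hpair : ∀ g : ℝ → ℝ≥0∞, Measurable g → ∫⁻ x, g x * k x ≤
      DegenerateSchrodinger.interNorm (ENNReal.ofReal c) (ENNReal.ofReal d) g) :
    ∫⁻ x in T, k x ^ e ≤ 1 := by
  set S := ∫⁻ x in T, k x ^ e with hS
  have he0 : 0 < e - 1 := by linarith
  have hg := hpair (T.indicator fun x => k x ^ (e - 1)) ((hk.pow_const _).indicator hT)
  have hl : ∫⁻ x, (T.indicator fun x => k x ^ (e - 1)) x * k x = S := by
    rw [hS, ← lintegral_indicator hT]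
    refine lintegral_congr fun x => ?_
    by_cases hx : x ∈ T
    · simp only [Set.indicator_of_mem hx]
      conv_lhs => rw [← ENNReal.rpow_one (k x), ← ENNReal.rpow_mul]
      rw [one_mul, ← ENNReal.rpow_add_of_nonneg _ _ he0.le zero_le_one]
      simp
    · simp [Set.indicator_of_notMem hx]
  have norm_le : ∀ s : ℝ, 1 < s → (∀ x ∈ T, k x ^ ((e - 1) * s) ≤ k x ^ e) →
      eLpNorm (T.indicator fun x => k x ^ (e - 1)) (ENNReal.ofReal s) volume ≤ S ^ (1 / s) := by
    intro s hs h
    have hs0 : 0 < s := by linarith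
    rw [eLpNorm_ofReal_eq hs0]
    gcongr
    rw [hS, ← lintegral_indicator hT]
    refine lintegral_mono fun x => ?_
    by_cases hx : x ∈ T
    · simp only [Set.indicator_of_mem hx]
      rw [← ENNReal.rpow_mul]; exact h x hx
    · simp [Set.indicator_of_notMem hx, ENNReal.zero_rpow_of_pos hs0]
  by_contra hcon
  have h1 : 1 < S := not_le.1 hcon
  have lt : ∀ s : ℝ, 1 < s → S ^ (1 / s) < S := by
    intro s hs
    conv_rhs => rw [← ENNReal.rpow_one S]
    exact ENNReal.rpow_lt_rpow_of_exponent_lt h1 hfin ((div_lt_one (by linarith)).2 hs)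
  rw [hl, DegenerateSchrodinger.interNorm] at hg
  refine absurd hg (not_le.2 (max_lt ?_ ?_))
  · exact (norm_le c hc hkc).trans_lt (lt c hc)
  · exact (norm_le d hd hkd).trans_lt (lt d hd)

lemma lintegral_le_of_forall_setLIntegral_bounded {k : ℝ → ℝ≥0∞} {T : Set ℝ}
    (hT : MeasurableSet T) (hk : Measurable k) {C : ℝ≥0∞}
    (h : ∀ N : ℕ, ∫⁻ x in T ∩ Set.Icc (-N : ℝ) N ∩ {x | k x ≤ N}, k x ≤ C)
    (htop : volume {x | k x = ∞} = 0) : ∫⁻ x in T, k x ≤ C := by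
  have hm : ∀ N : ℕ, MeasurableSet (T ∩ Set.Icc (-N : ℝ) N ∩ {x | k x ≤ N}) := fun N =>
    (hT.inter measurableSet_Icc).inter (measurableSet_le hk measurable_const)
  have hmono : Monotone fun N : ℕ => T ∩ Set.Icc (-N : ℝ) N ∩ {x | k x ≤ N} := by
    intro N M hNM x hx
    have : (N : ℝ) ≤ M := by exact_mod_cast hNM
    refine ⟨⟨hx.1.1, ?_, ?_⟩, ?_⟩
    · linarith [hx.1.2.1]
    · exact hx.1.2.2.trans this
    · exact (show k x ≤ N from hx.2).trans (by exact_mod_cast hNM)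
  have hU : ∫⁻ x in T, k x ≤ ∫⁻ x in ⋃ N : ℕ, T ∩ Set.Icc (-N : ℝ) N ∩ {x | k x ≤ N}, k x := by
    refine lintegral_mono' (Measure.restrict_mono_ae ?_) le_rfl
    have : ∀ᵐ x, k x ≠ ∞ := by rw [ae_iff]; simpa using htop
    filter_upwards [this] with x hx hxT
    obtain ⟨N, hN⟩ := ENNReal.exists_nat_gt hx
    obtain ⟨M, hM⟩ := exists_nat_ge |x|
    refine Set.mem_iUnion.2 ⟨max N M, ⟨hxT, ?_⟩, ?_⟩
    · exact abs_le.1 (hM.trans (by simp))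
    · change k x ≤ _
      exact hN.le.trans (by exact_mod_cast le_max_left _ _)
  refine hU.trans ?_
  rw [setLIntegral_iUnion_of_directed k hmono.directed_le]
  exact iSup_le h

/-- If a nonnegative function pairs boundedly with all elements of `L^{a'} ∩ L^{b'}`, then it
belongs to `L^a + L^b`. -/
theorem sumNorm_le_of_pairing {a b : ℝ} (ha : 1 < a) (hab : a < b) {h : ℝ → ℝ≥0∞}
    (hh : AEMeasurable h) {A : ℝ≥0∞}
    (hA : ∀ g : ℝ → ℝ≥0∞, Measurable g → ∫⁻ x, g x * h x ≤
      A * DegenerateSchrodinger.interNorm (ENNReal.ofReal a.conjExponent)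
        (ENNReal.ofReal b.conjExponent) g) :
    DegenerateSchrodinger.sumNorm (ENNReal.ofReal a) (ENNReal.ofReal b) h ≤ 2 * A := by
  rcases eq_or_ne A ∞ with rfl | hAt
  · simp
  suffices H : ∀ A' : ℝ≥0∞, A < A' → A' ≠ ∞ →
      DegenerateSchrodinger.sumNorm (ENNReal.ofReal a) (ENNReal.ofReal b) h ≤ 2 * A' by
    refine ENNReal.le_of_forall_pos_le_add fun ε hε _ => ?_
    have := H (A + ε / 2) (ENNReal.lt_add_right hAt (by simpa using hε.ne')) (by finiteness)
    rwa [mul_add, ENNReal.mul_div_cancel (by simp) (by simp)] at this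
  intro A' hA' hA't
  have hA'0 : A' ≠ 0 := (pos_of_gt hA').ne'
  set k : ℝ → ℝ≥0∞ := fun x => A'⁻¹ * hh.mk h x with hk_def
  have hk : Measurable k := hh.measurable_mk.const_mul _
  have hkh : ∀ᵐ x, h x = A' * k x := by
    filter_upwards [hh.ae_eq_mk] with x hx
    rw [hk_def, hx]
    simp only
    rw [← mul_assoc, ENNReal.mul_inv_cancel hA'0 hA't, one_mul]
  have hb : 1 < b := ha.trans hab
  set c := a.conjExponent
  set d := b.conjExponent
  have hac : a.HolderConjugate c := Real.HolderConjugate.conjExponent ha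
  have hbd : b.HolderConjugate d := Real.HolderConjugate.conjExponent hb
  have hc : 1 < c := hac.symm.lt
  have hd : 1 < d := hbd.symm.lt
  have hdc : d ≤ c := by
    have e1 : c = 1 + 1 / (a - 1) := by
      change a / (a - 1) = _
      have : a - 1 ≠ 0 := by linarith
      field_simp; ring
    have e2 : d = 1 + 1 / (b - 1) := by
      change b / (b - 1) = _
      have : b - 1 ≠ 0 := by linarith
      field_simp; ring
    rw [e1, e2]
    have : 0 < a - 1 := by linarith
    gcongr
  have hpair : ∀ g : ℝ → ℝ≥0∞, Measurable g → ∫⁻ x, g x * k x ≤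
      DegenerateSchrodinger.interNorm (ENNReal.ofReal c) (ENNReal.ofReal d) g := by
    intro g hg
    have h1 : A' * ∫⁻ x, g x * k x ≤
        A' * DegenerateSchrodinger.interNorm (ENNReal.ofReal c) (ENNReal.ofReal d) g := by
      rw [← lintegral_const_mul _ (f := fun x => g x * k x) (hg.mul hk)]
      calc _ = ∫⁻ x, g x * h x := by
            refine lintegral_congr_ae ?_
            filter_upwards [hkh] with x hx
            simp only [hx]; ring
        _ ≤ _ := (hA g hg).trans (by gcongr)
    exact (ENNReal.mul_le_mul_iff_right hA'0 hA't).1 h1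
  have htop : volume {x | k x = ∞} = 0 := by
    by_contra hne
    have hmt : MeasurableSet {x | k x = ∞} := hk (measurableSet_singleton _)
    obtain ⟨s, hs, hsm, hs0, hst⟩ : ∃ s ⊆ {x | k x = ∞}, MeasurableSet s ∧ 0 < volume s ∧
        volume s < ∞ := by
      obtain ⟨s, hs, hsub, h1, h2⟩ := Measure.exists_subset_measure_lt_top hmt
        (pos_iff_ne_zero.2 hne)
      exact ⟨s, hsub, hs, h1, h2⟩
    have hp := hpair (s.indicator 1) (measurable_one.indicator hsm)
    have hle : ∞ ≤ ∫⁻ x, s.indicator 1 x * k x := by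
      calc ∞ = ∫⁻ x in s, ∞ := by simp [ENNReal.top_mul hs0.ne']
        _ = ∫⁻ x, s.indicator (fun _ => ∞) x := by rw [lintegral_indicator hsm]
        _ ≤ _ := by
          refine lintegral_mono fun x => ?_
          by_cases hx : x ∈ s
          · have : k x = ∞ := hs hx
            simp [hx, this]
          · simp [hx]
    have : DegenerateSchrodinger.interNorm (ENNReal.ofReal c) (ENNReal.ofReal d)
        (s.indicator 1) < ∞ := by
      have fin : ∀ e : ℝ, 1 < e →
          eLpNorm (s.indicator (1 : ℝ → ℝ≥0∞)) (ENNReal.ofReal e) volume < ∞ := by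
        intro e he
        rw [eLpNorm_ofReal_eq (by linarith)]
        refine ENNReal.rpow_lt_top_of_nonneg (by positivity) (ne_of_lt ?_)
        calc _ = ∫⁻ x, s.indicator 1 x := by
              refine lintegral_congr fun x => ?_
              by_cases hx : x ∈ s
              · simp [hx]
              · simp [hx, ENNReal.zero_rpow_of_pos (show 0 < e by linarith)]
          _ < ∞ := by rw [lintegral_indicator_one hsm]; exact hst
      exact max_lt (fin c hc) (fin d hd)
    exact absurd (hle.trans hp) (not_le.2 this)
  have bound : ∀ e : ℝ, 1 < e → ∀ T : Set ℝ, MeasurableSet T →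
      (∀ x ∈ T, k x ^ ((e - 1) * c) ≤ k x ^ e) → (∀ x ∈ T, k x ^ ((e - 1) * d) ≤ k x ^ e) →
      ∫⁻ x in T, k x ^ e ≤ 1 := by
    intro e he T hT h1 h2
    have he0 : 0 < e := by linarith
    refine lintegral_le_of_forall_setLIntegral_bounded hT (hk.pow_const e) (fun N => ?_) ?_
    · refine setLIntegral_rpow_le_one_of_pairing hk ((hT.inter measurableSet_Icc).inter
        (measurableSet_le (hk.pow_const e) measurable_const)) he hc hd
        (fun x hx => h1 x hx.1.1) (fun x hx => h2 x hx.1.1) ?_ hpair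
      refine ne_of_lt ?_
      calc _ ≤ ∫⁻ x in T ∩ Set.Icc (-N : ℝ) N ∩ {x | k x ^ e ≤ N}, (N : ℝ≥0∞) := by
            refine setLIntegral_mono measurable_const fun x hx => hx.2
        _ = N * volume (T ∩ Set.Icc (-N : ℝ) N ∩ {x | k x ^ e ≤ N}) := by simp
        _ ≤ N * volume (Set.Icc (-N : ℝ) N) := by
            gcongr; exact fun x hx => hx.1.2
        _ < ∞ := by rw [Real.volume_Icc]; finiteness
    · convert htop using 2
      ext x
      simp [ENNReal.rpow_eq_top_iff, he0, he0.not_gt]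
  have e1 : (a - 1) * c = a := hac.sub_one_mul_conj
  have e2 : (b - 1) * d = b := hbd.sub_one_mul_conj
  have hT1 : MeasurableSet {x | 1 < k x} := measurableSet_lt measurable_const hk
  have hT2 : MeasurableSet {x | k x ≤ 1} := measurableSet_le hk measurable_const
  have B1 := bound a ha {x | 1 < k x} hT1 (fun x _ => by rw [e1]) (fun x hx => by
    refine ENNReal.rpow_le_rpow_of_exponent_le (le_of_lt hx) ?_
    conv_rhs => rw [← e1]
    have : 0 ≤ a - 1 := by linarith
    gcongr)
  have B2 := bound b hb {x | k x ≤ 1} hT2 (fun x hx => by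
    refine ENNReal.rpow_le_rpow_of_exponent_ge hx ?_
    conv_lhs => rw [← e2]
    have : 0 ≤ b - 1 := by linarith
    gcongr) (fun x _ => by rw [e2])
  have fin : ∀ e : ℝ, 1 < e → ∀ T : Set ℝ, MeasurableSet T → ∫⁻ x in T, k x ^ e ≤ 1 →
      eLpNorm (T.indicator fun x => A' * k x) (ENNReal.ofReal e) volume ≤ A' := by
    intro e he T hT h1
    have he0 : 0 < e := by linarith
    rw [eLpNorm_ofReal_eq he0]
    have : ∫⁻ x, (T.indicator fun x => A' * k x) x ^ e ≤ A' ^ e := by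
      calc _ = ∫⁻ x, T.indicator (fun x => A' ^ e * k x ^ e) x := by
            refine lintegral_congr fun x => ?_
            by_cases hx : x ∈ T
            · simp [hx, ENNReal.mul_rpow_of_nonneg _ _ he0.le]
            · simp [hx, he0]
        _ = A' ^ e * ∫⁻ x in T, k x ^ e := by
            rw [lintegral_indicator hT, lintegral_const_mul _ (hk.pow_const e)]
        _ ≤ A' ^ e * 1 := by gcongr
        _ = _ := mul_one _
    calc _ ≤ (A' ^ e) ^ (1 / e) := by gcongr
      _ = A' := by rw [← ENNReal.rpow_mul, mul_one_div_cancel he0.ne', ENNReal.rpow_one]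
  have hm : Measurable fun x => A' * k x := hk.const_mul _
  rw [DegenerateSchrodinger.sumNorm]
  refine le_trans (iInf_le _ ({x | 1 < k x}.indicator fun x => A' * k x)) ?_
  refine le_trans (iInf_le _ ({x | k x ≤ 1}.indicator fun x => A' * k x)) ?_
  refine le_trans (iInf_le _ (hm.indicator hT1).aemeasurable) ?_
  refine le_trans (iInf_le _ (hm.indicator hT2).aemeasurable) ?_
  refine le_trans (iInf_le _ ?_) ?_
  · filter_upwards [hkh] with x hx
    rw [hx, Pi.add_apply]
    rcases lt_or_ge 1 (k x) with h1 | h1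
    · rw [Set.indicator_of_mem (show x ∈ {x | 1 < k x} from h1),
        Set.indicator_of_notMem (show x ∉ {x | k x ≤ 1} from not_le.2 h1), add_zero]
    · rw [Set.indicator_of_mem (show x ∈ {x | k x ≤ 1} from h1),
        Set.indicator_of_notMem (show x ∉ {x | 1 < k x} from not_lt.2 h1), zero_add]
  · rw [two_mul]
    exact add_le_add (fin a ha _ hT1 B1) (fin b hb _ hT2 B2)

/-- The sum of two Riesz kernels defines a bounded bilinear form on `L^{a'} ∩ L^{b'}`. -/
theorem exists_rieszKernel_add_pairing_le {a b : ℝ} (ha : 2 < a) (hb : 2 < b) :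
    ∃ C : ℝ≥0∞, C ≠ ∞ ∧ ∀ f g : ℝ → ℝ≥0∞, AEMeasurable f → AEMeasurable g →
      ∫⁻ x, ∫⁻ y, f x * g y * (rieszKernel (2 / a) (x - y) + rieszKernel (2 / b) (x - y)) ≤
        C * (DegenerateSchrodinger.interNorm (ENNReal.ofReal a.conjExponent)
              (ENNReal.ofReal b.conjExponent) f *
            DegenerateSchrodinger.interNorm (ENNReal.ofReal a.conjExponent)
              (ENNReal.ofReal b.conjExponent) g) := by
  have main : ∀ a : ℝ, 2 < a → ∃ C : ℝ≥0∞, C ≠ ∞ ∧ ∀ f g : ℝ → ℝ≥0∞,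
      AEMeasurable f → AEMeasurable g → ∫⁻ x, ∫⁻ y, f x * g y * rieszKernel (2 / a) (x - y) ≤
        C * (eLpNorm f (ENNReal.ofReal a.conjExponent) volume *
          eLpNorm g (ENNReal.ofReal a.conjExponent) volume) := by
    intro a ha
    refine hls (by positivity) ((div_lt_one (by linarith)).2 ha) ?_
    change a / (a - 1) = _
    have : a - 1 ≠ 0 := by linarith
    have h : (2 : ℝ) * a - 2 ≠ 0 := by linarith
    have h0 : a ≠ 0 := by linarith
    have h2 : 2 - 2 / a ≠ 0 := by
      rw [show 2 - 2 / a = (2 * a - 2) / a by field_simp]; positivity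
    rw [div_eq_div_iff this h2]; field_simp
  obtain ⟨C₁, h₁, H₁⟩ := main a ha
  obtain ⟨C₂, h₂, H₂⟩ := main b hb
  refine ⟨C₁ + C₂, by finiteness, fun f g hf hg => ?_⟩
  have hmeas : ∀ l, Measurable fun z : ℝ × ℝ => rieszKernel l (z.1 - z.2) := fun l =>
    (measurable_rieszKernel l).comp (by fun_prop)
  calc _ = ∫⁻ x, ((∫⁻ y, f x * g y * rieszKernel (2 / a) (x - y)) +
          ∫⁻ y, f x * g y * rieszKernel (2 / b) (x - y)) := by
        refine lintegral_congr fun x => ?_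
        rw [← lintegral_add_left']
        · simp only [mul_add]
        · exact (hg.const_mul _).mul
            ((hmeas _).comp measurable_prodMk_left).aemeasurable
    _ = (∫⁻ x, ∫⁻ y, f x * g y * rieszKernel (2 / a) (x - y)) +
          ∫⁻ x, ∫⁻ y, f x * g y * rieszKernel (2 / b) (x - y) := by
        refine lintegral_add_left' ?_ _
        have : AEMeasurable (fun z : ℝ × ℝ => f z.1 * g z.2 * rieszKernel (2 / a) (z.1 - z.2))
            (volume.prod volume) :=
          (hf.comp_fst.mul hg.comp_snd).mul (hmeas _).aemeasurable
        exact this.lintegral_prod_right'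
    _ ≤ _ := by
        rw [add_mul]
        refine add_le_add ((H₁ f g hf hg).trans ?_) ((H₂ f g hf hg).trans ?_)
        · gcongr <;> exact le_max_left _ _
        · gcongr <;> exact le_max_right _ _

/-! ### Schwartz functions and Lebesgue norms -/

section Density

variable {E : Type*} [NormedAddCommGroup E] [InnerProductSpace ℝ E] [FiniteDimensional ℝ E]
  [MeasurableSpace E] [BorelSpace E]

lemma exists_schwartz_eLpNorm_sub_le_of_support {f : E → ℂ} (hf : MemLp f 2 volume) {R : ℝ}
    (hR : 0 ≤ R) (hsupp : ∀ x, R < ‖x‖ → f x = 0) {p : ℝ≥0∞} (hp : p ≤ 2)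
    {ε : ℝ≥0∞} (hε : ε ≠ 0) :
    ∃ ψ : 𝓢(E, ℂ), eLpNorm (f - ⇑ψ) p volume ≤ ε ∧ eLpNorm (f - ⇑ψ) 2 volume ≤ ε := by
  let χ : ContDiffBump (0 : E) := ⟨R + 1, R + 2, by linarith, by linarith⟩
  set K : Set E := Metric.closedBall 0 (R + 2)
  set M : ℝ≥0∞ := (volume K) ^ (1 / p.toReal - 1 / (2 : ℝ≥0∞).toReal) with hM
  have hMt : M ≠ ∞ := by
    rcases eq_or_ne p 0 with rfl | hp0
    · rw [hM]
      have h0 : volume K ≠ 0 := by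
        refine (Measure.measure_pos_of_nonempty_interior _ ?_).ne'
        exact ⟨0, mem_interior_iff_mem_nhds.2 (Metric.closedBall_mem_nhds _ (by linarith))⟩
      have h1 : volume K ≠ ∞ := measure_closedBall_lt_top.ne
      simp only [ENNReal.toReal_zero, div_zero, ENNReal.toReal_ofNat, zero_sub]
      exact ENNReal.rpow_ne_top_of_ne_zero h0 h1
    · refine ENNReal.rpow_ne_top_of_nonneg ?_ measure_closedBall_lt_top.ne
      have hpt : p ≠ ∞ := ne_top_of_le_ne_top (by simp) hp
      have : p.toReal ≤ (2 : ℝ≥0∞).toReal := ENNReal.toReal_mono (by simp) hp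
      have h0 := ENNReal.toReal_pos hp0 hpt
      have := one_div_le_one_div_of_le h0 this
      linarith
  obtain ⟨δ, hδ0, hδ1, hδ2⟩ : ∃ δ : ℝ, 0 < δ ∧ ENNReal.ofReal δ ≤ ε ∧ ENNReal.ofReal δ * M ≤ ε := by
    obtain ⟨δ, hδ0, hδ⟩ : ∃ δ : ℝ≥0∞, δ ≠ 0 ∧ δ * (M + 1) ≤ ε ∧ δ ≠ ∞ := by
      refine ⟨min (ε / (M + 1)) 1, ?_, ?_,
        ne_top_of_le_ne_top ENNReal.one_ne_top (min_le_right _ _)⟩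
      · refine (lt_min (ENNReal.div_pos hε (by finiteness)) one_pos).ne'
      · refine (mul_le_mul_left (min_le_left _ _) _).trans ?_
        rw [ENNReal.div_mul_cancel (by simp) (by finiteness)]
    refine ⟨δ.toReal, ENNReal.toReal_pos hδ0 hδ.2, ?_, ?_⟩
    · rw [ENNReal.ofReal_toReal hδ.2]
      exact le_trans (le_mul_of_one_le_right (zero_le) (by simp)) hδ.1
    · rw [ENNReal.ofReal_toReal hδ.2]
      refine le_trans ?_ hδ.1
      gcongr; simp
  obtain ⟨g, hg1, hg2, hg3⟩ := hf.exist_eLpNorm_sub_le (by simp) (by simp) hδ0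
  have hψ1 : HasCompactSupport fun x => (χ x : ℂ) * g x := hg1.mul_left
  have hψ2 : ContDiff ℝ (⊤ : ℕ∞) fun x => (χ x : ℂ) * g x :=
    (Complex.ofRealCLM.contDiff.comp χ.contDiff).mul hg2
  refine ⟨hψ1.toSchwartzMap hψ2, ?_⟩
  have hcoe : ⇑(hψ1.toSchwartzMap hψ2) = fun x => (χ x : ℂ) * g x := rfl
  rw [hcoe]
  set d : E → ℂ := f - fun x => (χ x : ℂ) * g x with hd
  have hdle : ∀ x, ‖d x‖ ≤ ‖(f - g) x‖ := by
    intro x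
    have : d x = (χ x : ℂ) * (f - g) x := by
      by_cases hx : ‖x‖ ≤ R
      · have : χ x = 1 := χ.one_of_mem_closedBall (by simp; linarith)
        simp [hd, this]
      · simp [hd, hsupp x (not_le.1 hx)]
    rw [this, norm_mul, Complex.norm_real, Real.norm_of_nonneg χ.nonneg]
    exact mul_le_of_le_one_left (norm_nonneg _) χ.le_one
  have hd2 : eLpNorm d 2 volume ≤ ENNReal.ofReal δ := (eLpNorm_mono hdle).trans hg3
  refine ⟨?_, hd2.trans hδ1⟩
  have hdK : ∀ x, x ∉ K → d x = 0 := by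
    intro x hx
    have hx' : R + 2 < ‖x‖ := by simpa [K] using hx
    have : χ x = 0 := χ.zero_of_le_dist (by simpa [χ] using hx'.le)
    simp [hd, this, hsupp x (by linarith)]
  have hdm : AEStronglyMeasurable d volume :=
    hf.1.sub (hψ2.continuous.aestronglyMeasurable)
  have hKm : MeasurableSet K := Metric.isClosed_closedBall.measurableSet
  have hind : K.indicator d = d := by
    ext x; by_cases hx : x ∈ K
    · simp [hx]
    · simp [hx, hdK x hx]
  calc eLpNorm d p volume = eLpNorm d p (volume.restrict K) := by
        rw [← eLpNorm_indicator_eq_eLpNorm_restrict hKm, hind]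
    _ ≤ eLpNorm d 2 (volume.restrict K) * M := by
        have := eLpNorm_le_eLpNorm_mul_rpow_measure_univ hp (hdm.restrict (s := K))
        rwa [Measure.restrict_apply_univ] at this
    _ ≤ ENNReal.ofReal δ * M := by
        gcongr
        exact (eLpNorm_mono_measure _ Measure.restrict_le_self).trans hd2
    _ ≤ ε := hδ2

lemma tendsto_eLpNorm_indicator_compl_closedBall {f : E → ℂ} {p : ℝ≥0∞} (hp : p ≠ ∞)
    (hf : MemLp f p volume) :
    Tendsto (fun N : ℕ => eLpNorm ((Metric.closedBall (0 : E) N)ᶜ.indicator f) p volume)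
      atTop (𝓝 0) := by
  rcases eq_or_ne p 0 with rfl | hp0
  · simp
  have hpr : 0 < p.toReal := ENNReal.toReal_pos hp0 hp
  have hB : ∀ N : ℕ, MeasurableSet (Metric.closedBall (0 : E) N)ᶜ := fun N =>
    Metric.isClosed_closedBall.measurableSet.compl
  have h1 : Tendsto (fun N : ℕ => ∫⁻ x, ‖(Metric.closedBall (0 : E) N)ᶜ.indicator f x‖ₑ ^ p.toReal)
      atTop (𝓝 (∫⁻ _ : E, 0)) := by
    refine tendsto_lintegral_of_dominated_convergence' (fun x => ‖f x‖ₑ ^ p.toReal) (fun N => ?_)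
      (fun N => .of_forall fun x => ?_) ?_ (.of_forall fun x => ?_)
    · exact (hf.1.indicator (hB N)).enorm.pow_const _
    · refine ENNReal.rpow_le_rpow ?_ hpr.le
      by_cases hx : x ∈ (Metric.closedBall (0 : E) N)ᶜ
      · rw [Set.indicator_of_mem hx]
      · rw [Set.indicator_of_notMem hx]; simp
    · exact (lintegral_rpow_enorm_lt_top_of_eLpNorm_lt_top hp0 hp hf.2).ne
    · obtain ⟨N, hN⟩ := exists_nat_ge ‖x‖
      refine tendsto_const_nhds.congr' ?_
      filter_upwards [eventually_ge_atTop N] with M hM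
      have : x ∉ (Metric.closedBall (0 : E) M)ᶜ := by
        simp; exact hN.trans (by exact_mod_cast hM)
      rw [Set.indicator_of_notMem this]; simp [hpr]
  simp only [lintegral_zero] at h1
  have := ((ENNReal.continuous_rpow_const (y := 1 / p.toReal)).tendsto 0).comp h1
  rw [ENNReal.zero_rpow_of_pos (by positivity)] at this
  refine this.congr fun N => ?_
  rw [eLpNorm_eq_lintegral_rpow_enorm_toReal hp0 hp]
  rfl

/-- Schwartz functions are dense in `L^p ∩ L^2`, `1 ≤ p ≤ 2`. -/
theorem exists_schwartz_eLpNorm_sub_le {f : E → ℂ} {p : ℝ≥0∞} (hp1 : 1 ≤ p) (hp : p ≤ 2)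
    (hfp : MemLp f p volume) (hf : MemLp f 2 volume) {ε : ℝ≥0∞} (hε : ε ≠ 0) :
    ∃ ψ : 𝓢(E, ℂ), eLpNorm (f - ⇑ψ) p volume ≤ ε ∧ eLpNorm (f - ⇑ψ) 2 volume ≤ ε := by
  have hε2 : ε / 2 ≠ 0 := by simpa using hε
  have hpt : p ≠ ∞ := ne_top_of_le_ne_top (by simp) hp
  have e1 := (tendsto_eLpNorm_indicator_compl_closedBall hpt hfp).eventually
    (gt_mem_nhds (pos_iff_ne_zero.2 hε2))
  have e2 := (tendsto_eLpNorm_indicator_compl_closedBall (by simp) hf).eventually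
    (gt_mem_nhds (pos_iff_ne_zero.2 hε2))
  obtain ⟨N, h1, h2⟩ := (e1.and e2).exists
  set B := Metric.closedBall (0 : E) N
  have hB : MeasurableSet B := Metric.isClosed_closedBall.measurableSet
  obtain ⟨ψ, hψ1, hψ2⟩ := exists_schwartz_eLpNorm_sub_le_of_support (hf.indicator hB)
    (Nat.cast_nonneg N) (fun x hx => Set.indicator_of_notMem (by simpa [B] using hx) f) hp hε2
  have hdec : f - ⇑ψ = Bᶜ.indicator f + (B.indicator f - ⇑ψ) := by
    rw [← add_sub_assoc, Set.indicator_compl_add_self]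
  have hm1 : AEStronglyMeasurable (Bᶜ.indicator f) volume := hf.1.indicator hB.compl
  have hm2 : AEStronglyMeasurable (B.indicator f - ⇑ψ) volume :=
    (hf.1.indicator hB).sub ψ.continuous.aestronglyMeasurable
  refine ⟨ψ, ?_, ?_⟩ <;> rw [hdec, ← ENNReal.add_halves ε]
  · exact (eLpNorm_add_le hm1 hm2 hp1).trans (add_le_add h1.le hψ1)
  · exact (eLpNorm_add_le hm1 hm2 (by norm_num)).trans (add_le_add h2.le hψ2)

/-- Simple functions are dense in `L^p ∩ L^2`. -/
theorem exists_simpleFunc_eLpNorm_sub_le {f : E → ℂ} {p : ℝ≥0∞} (hpt : p ≠ ∞) (hm : Measurable f)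
    (hfp : MemLp f p volume) (hf : MemLp f 2 volume) {ε : ℝ≥0∞} (hε : ε ≠ 0) :
    ∃ s : SimpleFunc E ℂ, MemLp s p volume ∧ MemLp s 2 volume ∧
      eLpNorm (⇑s - f) p volume ≤ ε ∧ eLpNorm (⇑s - f) 2 volume ≤ ε := by
  have e1 := (SimpleFunc.tendsto_approxOn_range_Lp_eLpNorm hpt hm hfp.2).eventually
    (gt_mem_nhds (pos_iff_ne_zero.2 hε))
  have e2 := (SimpleFunc.tendsto_approxOn_range_Lp_eLpNorm (by simp) hm hf.2).eventually
    (gt_mem_nhds (pos_iff_ne_zero.2 hε))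
  obtain ⟨N, h1, h2⟩ := (e1.and e2).exists
  exact ⟨_, SimpleFunc.memLp_approxOn_range hm hfp N, SimpleFunc.memLp_approxOn_range hm hf N,
    h1.le, h2.le⟩

end Density

section Duality

lemma lintegral_enorm_mul_le {α : Type*} [MeasurableSpace α] {μ : Measure α} {p q : ℝ}
    (hpq : p.HolderConjugate q) {f g : α → ℂ} (hf : AEStronglyMeasurable f μ)
    (hg : AEStronglyMeasurable g μ) :
    ∫⁻ x, ‖f x * g x‖ₑ ∂μ ≤
      eLpNorm f (ENNReal.ofReal p) μ * eLpNorm g (ENNReal.ofReal q) μ := by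
  have hp : 0 < p := hpq.pos
  have hq : 0 < q := hpq.symm.pos
  rw [eLpNorm_eq_lintegral_rpow_enorm_toReal (by simpa using hp) (by simp),
    eLpNorm_eq_lintegral_rpow_enorm_toReal (by simpa using hq) (by simp),
    ENNReal.toReal_ofReal hp.le, ENNReal.toReal_ofReal hq.le]
  simp_rw [enorm_mul]
  exact ENNReal.lintegral_mul_le_Lp_mul_Lq _ hpq hf.enorm hg.enorm

lemma enorm_integral_mul_le {α : Type*} [MeasurableSpace α] {μ : Measure α} {p q : ℝ}
    (hpq : p.HolderConjugate q) {f g : α → ℂ} (hf : AEStronglyMeasurable f μ)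
    (hg : AEStronglyMeasurable g μ) :
    ‖∫ x, f x * g x ∂μ‖ₑ ≤
      eLpNorm f (ENNReal.ofReal p) μ * eLpNorm g (ENNReal.ofReal q) μ :=
  (enorm_integral_le_lintegral_enorm _).trans (lintegral_enorm_mul_le hpq hf hg)

lemma enorm_integral_mul_le_two {α : Type*} [MeasurableSpace α] {μ : Measure α}
    {f g : α → ℂ} (hf : AEStronglyMeasurable f μ) (hg : AEStronglyMeasurable g μ) :
    ‖∫ x, f x * g x ∂μ‖ₑ ≤ eLpNorm f 2 μ * eLpNorm g 2 μ := by
  have := enorm_integral_mul_le (p := 2) (q := 2) Real.HolderConjugate.two_two hf hg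
  simpa using this

variable {E : Type*} [NormedAddCommGroup E] [InnerProductSpace ℝ E] [FiniteDimensional ℝ E]
  [MeasurableSpace E] [BorelSpace E]

lemma integrable_mul_of_memLp_two {f g : E → ℂ} (hf : MemLp f 2 volume) (hg : MemLp g 2 volume) :
    Integrable (fun x => f x * g x) volume := by
  exact hf.integrable_mul hg

/-- A bound for the pairing with Schwartz functions extends to `L^s ∩ L^2`. -/
lemma enorm_integral_mul_le_of_schwartz {s : ℝ} (hs1 : 1 ≤ s) (hs2 : s ≤ 2) {v : E → ℂ}
    (hv : MemLp v 2 volume) {M : ℝ≥0∞}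
    (hM : ∀ ψ : 𝓢(E, ℂ), ‖∫ x, v x * ψ x‖ₑ ≤ M * eLpNorm ψ (ENNReal.ofReal s) volume)
    {g : E → ℂ} (hgs : MemLp g (ENNReal.ofReal s) volume) (hg : MemLp g 2 volume) :
    ‖∫ x, v x * g x‖ₑ ≤ M * eLpNorm g (ENNReal.ofReal s) volume := by
  rcases eq_or_ne M ∞ with rfl | hMt
  · by_cases h0 : eLpNorm g (ENNReal.ofReal s) volume = 0
    · have : g =ᵐ[volume] 0 := (eLpNorm_eq_zero_iff hg.1 (by simpa using by linarith)).1 h0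
      have h : ∫ x, v x * g x = 0 := by
        rw [integral_eq_zero_of_ae]
        filter_upwards [this] with x hx
        simp [hx]
      simp [h]
    · rw [ENNReal.top_mul h0]; exact le_top
  have h1s : 1 ≤ ENNReal.ofReal s := by simpa using ENNReal.ofReal_le_ofReal hs1
  have h2s : ENNReal.ofReal s ≤ 2 := by simpa using ENNReal.ofReal_le_ofReal hs2
  refine ENNReal.le_of_forall_pos_le_add fun ε hε _ => ?_
  set V := eLpNorm v 2 volume
  have hVt : V ≠ ∞ := hv.2.ne
  obtain ⟨δ, hδ0, hδ⟩ : ∃ δ : ℝ≥0∞, δ ≠ 0 ∧ (M + V) * δ ≤ ε := by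
    refine ⟨ε / (M + V), ?_, ENNReal.mul_div_le⟩
    exact (ENNReal.div_pos (by simpa using hε.ne') (by finiteness)).ne'
  obtain ⟨ψ, hψ1, hψ2⟩ := exists_schwartz_eLpNorm_sub_le h1s h2s hgs hg hδ0
  have hsplit : ∫ x, v x * g x = (∫ x, v x * ψ x) + ∫ x, v x * (g - ⇑ψ) x := by
    rw [← integral_add (integrable_mul_of_memLp_two hv (ψ.memLp 2 volume))
      (integrable_mul_of_memLp_two hv (hg.sub (ψ.memLp 2 volume)))]
    congr 1; ext x; simp; ring
  have hψn : eLpNorm ψ (ENNReal.ofReal s) volume ≤ eLpNorm g (ENNReal.ofReal s) volume + δ := by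
    have : ⇑ψ = g - (g - ⇑ψ) := by abel
    rw [this]
    exact (eLpNorm_sub_le hg.1 (hg.sub (ψ.memLp 2 volume)).1 h1s).trans (by gcongr)
  calc ‖∫ x, v x * g x‖ₑ ≤ ‖∫ x, v x * ψ x‖ₑ + ‖∫ x, v x * (g - ⇑ψ) x‖ₑ := by
        rw [hsplit]; exact enorm_add_le _ _
    _ ≤ M * (eLpNorm g (ENNReal.ofReal s) volume + δ) + V * δ := by
        gcongr
        · exact (hM ψ).trans (by gcongr)
        · exact (enorm_integral_mul_le_two hv.1 (hg.sub (ψ.memLp 2 volume)).1).trans (by gcongr)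
    _ = M * eLpNorm g (ENNReal.ofReal s) volume + (M + V) * δ := by ring
    _ ≤ _ := by gcongr

/-- The `L^r` norm of an `L^2` function, `r > 2`, by duality against Schwartz functions. -/
theorem eLpNorm_le_of_forall_schwartz {r s : ℝ} (hrs : r.HolderConjugate s) (hr : 2 ≤ r) {v : E → ℂ}
    (hv : MemLp v 2 volume) {M : ℝ≥0∞}
    (hM : ∀ ψ : 𝓢(E, ℂ), ‖∫ x, v x * ψ x‖ₑ ≤ M * eLpNorm ψ (ENNReal.ofReal s) volume) :
    eLpNorm v (ENNReal.ofReal r) volume ≤ M := by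
  have hs1 : 1 < s := hrs.symm.lt
  have hs2 : s ≤ 2 := by
    rw [hrs.conjugate_eq, div_le_iff₀ (by linarith)]; linarith
  wlog hmeas : StronglyMeasurable v generalizing v
  · have hae := hv.1.ae_eq_mk
    rw [eLpNorm_congr_ae hae]
    refine this (hv.ae_eq hae) (fun ψ => ?_) hv.1.stronglyMeasurable_mk
    rw [← integral_congr_ae (f := fun x => v x * ψ x)]
    · exact hM ψ
    · filter_upwards [hae] with x hx; simp [hx]
  have hr0 : 0 < r := by linarith
  have hs0 : 0 < s := by linarith
  set T : ℕ → Set E := fun N => Metric.closedBall 0 N ∩ {x | ‖v x‖ ≤ N} with hT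
  have hTm : ∀ N, MeasurableSet (T N) := fun N =>
    Metric.isClosed_closedBall.measurableSet.inter
      (measurableSet_le hmeas.measurable.norm measurable_const)
  have hTmono : Monotone T := by
    intro N M hNM x hx
    have : (N : ℝ) ≤ M := by exact_mod_cast hNM
    refine ⟨Metric.closedBall_subset_closedBall this hx.1, ?_⟩
    exact (show ‖v x‖ ≤ N from hx.2).trans this
  have hTU : ⋃ N, T N = Set.univ := by
    refine Set.eq_univ_of_forall fun x => ?_
    obtain ⟨N, hN⟩ := exists_nat_ge (max ‖x‖ ‖v x‖)
    refine Set.mem_iUnion.2 ⟨N, ?_, (le_max_right _ _).trans hN⟩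
    simpa using (le_max_left _ _).trans hN
  have bound : ∀ N, ∫⁻ x in T N, ‖v x‖ₑ ^ r ≤ M ^ r := by
    intro N
    set S := ∫⁻ x in T N, ‖v x‖ₑ ^ r with hS
    set g : E → ℂ := (T N).indicator fun x => (starRingEnd ℂ (v x)) * ((‖v x‖ ^ (r - 2) : ℝ) : ℂ)
      with hg
    have hTfin : volume (T N) < ∞ :=
      (measure_mono Set.inter_subset_left).trans_lt measure_closedBall_lt_top
    have hgm : StronglyMeasurable g := by
      refine StronglyMeasurable.indicator ?_ (hTm N)
      refine Measurable.stronglyMeasurable ?_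
      have := hmeas.measurable
      exact ((Complex.continuous_conj.measurable).comp this).mul
        (Complex.measurable_ofReal.comp (this.norm.pow_const _))
    have hgn : ∀ x ∈ T N, ‖g x‖ = ‖v x‖ ^ (r - 1) := by
      intro x hx
      rw [hg, Set.indicator_of_mem hx, norm_mul, RCLike.norm_conj, Complex.norm_real,
        Real.norm_of_nonneg (by positivity)]
      rcases eq_or_ne ‖v x‖ 0 with h0 | h0
      · rw [h0, Real.zero_rpow (by linarith : r - 1 ≠ 0)]; simp
      · have h0' : 0 < ‖v x‖ := lt_of_le_of_ne (norm_nonneg _) h0.symm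
        nth_rw 1 [← Real.rpow_one ‖v x‖]
        rw [← Real.rpow_add h0']
        congr 1; ring
    have hgb : ∀ p : ℝ≥0∞, MemLp g p volume := by
      intro p
      have hgT : g = (T N).indicator g := by rw [hg, Set.indicator_indicator, Set.inter_self]
      rw [hgT, memLp_indicator_iff_restrict (hTm N)]
      have : IsFiniteMeasure (volume.restrict (T N)) := ⟨by simpa using hTfin⟩
      refine MemLp.of_bound hgm.aestronglyMeasurable ((N : ℝ) ^ (r - 1)) ?_
      refine (ae_restrict_iff' (hTm N)).2 (.of_forall fun x hx => ?_)
      rw [hgn x hx]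
      exact Real.rpow_le_rpow (norm_nonneg _) hx.2 (by linarith)
    have hSfin : S ≠ ∞ := by
      refine ne_of_lt ?_
      calc S ≤ ∫⁻ x in T N, (N : ℝ≥0∞) ^ r := by
            refine setLIntegral_mono measurable_const fun x hx => ?_
            refine ENNReal.rpow_le_rpow ?_ hr0.le
            rw [← ofReal_norm, ← ENNReal.ofReal_natCast]
            exact ENNReal.ofReal_le_ofReal hx.2
        _ = N ^ r * volume (T N) := by simp
        _ < ∞ := by
          refine ENNReal.mul_lt_top ?_ hTfin
          exact ENNReal.rpow_lt_top_of_nonneg hr0.le (by simp)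
    have hnorm : eLpNorm g (ENNReal.ofReal s) volume = S ^ (1 / s) := by
      rw [eLpNorm_eq_lintegral_rpow_enorm_toReal (by simpa using hs0) (by simp),
        ENNReal.toReal_ofReal hs0.le, hS, ← lintegral_indicator (hTm N)]
      congr 1
      refine lintegral_congr fun x => ?_
      by_cases hx : x ∈ T N
      · rw [Set.indicator_of_mem hx, ← ofReal_norm, hgn x hx, ← ofReal_norm,
          ENNReal.ofReal_rpow_of_nonneg (by positivity) hs0.le,
          ENNReal.ofReal_rpow_of_nonneg (by positivity) hr0.le, ← Real.rpow_mul (norm_nonneg _),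
          hrs.sub_one_mul_conj]
      · rw [hg, Set.indicator_of_notMem hx, Set.indicator_of_notMem hx]
        simp [hs0]
    have hint : ∫ x, v x * g x = ((∫ x in T N, ‖v x‖ ^ r : ℝ) : ℂ) := by
      rw [← integral_complex_ofReal, ← integral_indicator (hTm N)]
      congr 1; ext x
      by_cases hx : x ∈ T N
      · rw [hg, Set.indicator_of_mem hx, Set.indicator_of_mem hx, ← mul_assoc, Complex.mul_conj,
          Complex.normSq_eq_norm_sq, ← Complex.ofReal_mul]
        congr 1
        rcases eq_or_ne ‖v x‖ 0 with h0 | h0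
        · rw [h0, Real.zero_rpow hr0.ne']; simp
        · have h0' : 0 < ‖v x‖ := lt_of_le_of_ne (norm_nonneg _) h0.symm
          rw [← Real.rpow_natCast, ← Real.rpow_add h0']
          congr 1; push_cast; ring
      · rw [hg, Set.indicator_of_notMem hx, Set.indicator_of_notMem hx, mul_zero]
    have hSe : ‖∫ x, v x * g x‖ₑ = S := by
      rw [hint, ← ofReal_norm, Complex.norm_real,
        Real.norm_of_nonneg (integral_nonneg fun x => by positivity),
        integral_eq_lintegral_of_nonneg_ae (.of_forall fun x => by positivity)
          ((hmeas.measurable.norm.pow_const _).aestronglyMeasurable)]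
      have : ∫⁻ x in T N, ENNReal.ofReal (‖v x‖ ^ r) = S := by
        refine lintegral_congr fun x => ?_
        rw [← ofReal_norm, ENNReal.ofReal_rpow_of_nonneg (by positivity) hr0.le]
      rw [this, ENNReal.ofReal_toReal hSfin]
    have key := enorm_integral_mul_le_of_schwartz hs1.le hs2 hv hM (hgb _) (hgb 2)
    rw [hSe, hnorm] at key
    rcases eq_or_ne S 0 with h0 | h0
    · rw [h0]; exact zero_le
    have h1 : S ^ (1 / s) ≠ 0 := by simp [h0, hSfin]
    have h2 : S ^ (1 / s) ≠ ∞ := ENNReal.rpow_ne_top_of_nonneg (by positivity) hSfin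
    have h3 : S = S ^ (1 / r) * S ^ (1 / s) := by
      rw [← ENNReal.rpow_add _ _ h0 hSfin]
      have := hrs.inv_add_inv_eq_one
      rw [one_div, one_div, this, ENNReal.rpow_one]
    have h4 : S ^ (1 / r) ≤ M := by
      rw [h3] at key
      rw [← h3] at key
      have : S ^ (1 / r) * S ^ (1 / s) ≤ M * S ^ (1 / s) := by rw [← h3]; exact key
      exact (ENNReal.mul_le_mul_iff_left h1 h2).1 this
    calc S = (S ^ (1 / r)) ^ r := by
          rw [← ENNReal.rpow_mul, one_div_mul_cancel hr0.ne', ENNReal.rpow_one]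
      _ ≤ M ^ r := by gcongr
  rw [eLpNorm_eq_lintegral_rpow_enorm_toReal (by simpa using hr0) (by simp),
    ENNReal.toReal_ofReal hr0.le]
  have : ∫⁻ x, ‖v x‖ₑ ^ r ≤ M ^ r := by
    rw [← setLIntegral_univ, ← hTU, setLIntegral_iUnion_of_directed _ hTmono.directed_le]
    exact iSup_le bound
  calc _ ≤ (M ^ r) ^ (1 / r) := by gcongr
    _ = M := by rw [← ENNReal.rpow_mul, mul_one_div_cancel hr0.ne', ENNReal.rpow_one]

instance : SecondCountableTopology (Lp ℂ 2 (volume : Measure E)) := by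
  have : Fact ((2 : ℝ≥0∞) ≠ ∞) := ⟨by simp⟩
  infer_instance

/-- Variant of `eLpNorm_le_of_forall_schwartz` with normalized test functions. -/
theorem eLpNorm_le_of_forall_schwartz_normalized {r s : ℝ} (hrs : r.HolderConjugate s) (hr : 2 ≤ r)
    {v : E → ℂ} (hv : MemLp v 2 volume) {M : ℝ≥0∞}
    (dense : ∀ χ : 𝓢(E, ℂ), eLpNorm χ (ENNReal.ofReal s) volume ≤ 1 → ‖∫ x, v x * χ x‖ₑ ≤ M) :
    eLpNorm v (ENNReal.ofReal r) volume ≤ M := by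
  have hs0 : 0 < s := hrs.symm.pos
  refine eLpNorm_le_of_forall_schwartz hrs hr hv fun χ => ?_
  have hNt : eLpNorm χ (ENNReal.ofReal s) volume ≠ ∞ :=
    (χ.memLp (ENNReal.ofReal s) volume).eLpNorm_ne_top
  obtain ⟨N, hN⟩ : ∃ N, eLpNorm χ (ENNReal.ofReal s) volume = N := ⟨_, rfl⟩
  rw [hN] at hNt ⊢
  rcases eq_or_ne N 0 with h0 | h0
  · have : ⇑χ =ᵐ[volume] 0 := (eLpNorm_eq_zero_iff χ.continuous.aestronglyMeasurable
      (by simpa using hs0)).1 (hN.trans h0)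
    have h : ∫ x, v x * χ x = 0 := by
      rw [integral_eq_zero_of_ae]
      filter_upwards [this] with x hx
      simp [hx]
    simp [h]
  have hNr : 0 < N.toReal := ENNReal.toReal_pos h0 hNt
  have hen : ‖((N.toReal⁻¹ : ℝ) : ℂ)‖ₑ = N⁻¹ := by
    rw [← ofReal_norm, Complex.norm_real, Real.norm_of_nonneg (by positivity),
      ENNReal.ofReal_inv_of_pos hNr, ENNReal.ofReal_toReal hNt]
  have hcoe : ⇑(((N.toReal⁻¹ : ℝ) : ℂ) • χ) = ((N.toReal⁻¹ : ℝ) : ℂ) • ⇑χ := by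
    ext x; simp only [smul_apply, Pi.smul_apply]
  have h1 := dense (((N.toReal⁻¹ : ℝ) : ℂ) • χ)
    (by rw [hcoe, eLpNorm_const_smul, hen, hN, ENNReal.inv_mul_cancel h0 hNt])
  have h2 : ∫ x, v x * (((N.toReal⁻¹ : ℝ) : ℂ) • χ) x =
      ((N.toReal⁻¹ : ℝ) : ℂ) * ∫ x, v x * χ x := by
    rw [← integral_const_mul]
    congr 1; ext x
    simp only [smul_apply, smul_eq_mul]; ring
  rw [h2, enorm_mul, hen] at h1
  calc _ = (N⁻¹ * ‖∫ x, v x * χ x‖ₑ) * N := by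
        rw [mul_comm, ← mul_assoc, ENNReal.mul_inv_cancel h0 hNt, one_mul]
    _ ≤ _ := by gcongr

/-- There is a sequence of Schwartz functions that computes all `L^r` norms of `L^2` functions. -/
theorem exists_seq_schwartz_eLpNorm_eq_iSup {r s : ℝ} (hrs : r.HolderConjugate s) (hr : 2 ≤ r) :
    ∃ ψ : ℕ → 𝓢(E, ℂ), (∀ k, eLpNorm (ψ k) (ENNReal.ofReal s) volume ≤ 1) ∧
      ∀ v : E → ℂ, MemLp v 2 volume →
        eLpNorm v (ENNReal.ofReal r) volume = ⨆ k, ‖∫ x, v x * ψ k x‖ₑ := by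
  have hs0 : 0 < s := hrs.symm.pos
  set S : Set (Lp ℂ 2 (volume : Measure E)) :=
    {f | ∃ ψ : 𝓢(E, ℂ), eLpNorm ψ (ENNReal.ofReal s) volume ≤ 1 ∧ ψ.toLp 2 volume = f}
  have : Nonempty S := ⟨⟨(0 : 𝓢(E, ℂ)).toLp 2, 0, by simp, rfl⟩⟩
  obtain ⟨u, hu⟩ := TopologicalSpace.exists_dense_seq S
  choose ψ hψ1 hψ2 using fun k => (u k).2
  refine ⟨ψ, hψ1, fun v hv => le_antisymm ?_ (iSup_le fun k => ?_)⟩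
  · have dense : ∀ χ : 𝓢(E, ℂ), eLpNorm χ (ENNReal.ofReal s) volume ≤ 1 →
        ‖∫ x, v x * χ x‖ₑ ≤ ⨆ k, ‖∫ x, v x * ψ k x‖ₑ := by
      intro χ hχ
      refine ENNReal.le_of_forall_pos_le_add fun ε hε _ => ?_
      set V := eLpNorm v 2 volume
      have hVt : V ≠ ∞ := hv.2.ne
      obtain ⟨δ, hδ0, hδt, hδ⟩ : ∃ δ : ℝ≥0∞, δ ≠ 0 ∧ δ ≠ ∞ ∧ V * δ ≤ ε := by
        refine ⟨min (ε / V) 1, ?_, ne_top_of_le_ne_top ENNReal.one_ne_top (min_le_right _ _),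
          (by gcongr; exact min_le_left _ _ : V * min (ε / V) 1 ≤ V * (ε / V)).trans
            ENNReal.mul_div_le⟩
        exact (lt_min (ENNReal.div_pos (by simpa using hε.ne') hVt) one_pos).ne'
      obtain ⟨k, hk⟩ := hu.exists_dist_lt ⟨χ.toLp 2 volume, χ, hχ, rfl⟩ (ENNReal.toReal_pos hδ0 hδt)
      have hdist : eLpNorm (⇑χ - ⇑(ψ k)) 2 volume ≤ δ := by
        have h1 : edist (χ.toLp 2 (volume : Measure E)) ((ψ k).toLp 2 volume) < δ := by
          rw [hψ2 k, edist_dist, ← ENNReal.ofReal_toReal hδt]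
          exact (ENNReal.ofReal_lt_ofReal_iff (ENNReal.toReal_pos hδ0 hδt)).2 hk
        rw [Lp.edist_def] at h1
        refine le_trans (le_of_eq (eLpNorm_congr_ae ?_)) h1.le
        filter_upwards [χ.coeFn_toLp 2 volume, (ψ k).coeFn_toLp 2 volume] with x h1 h2
        simp [h1, h2]
      have hsub : MemLp (⇑χ - ⇑(ψ k)) 2 volume := (χ.memLp 2 volume).sub ((ψ k).memLp 2 volume)
      have hsplit : ∫ x, v x * χ x = (∫ x, v x * ψ k x) + ∫ x, v x * (⇑χ - ⇑(ψ k)) x := by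
        rw [← integral_add (integrable_mul_of_memLp_two hv ((ψ k).memLp 2 volume))
          (integrable_mul_of_memLp_two hv hsub)]
        congr 1; ext x; simp; ring
      calc _ ≤ ‖∫ x, v x * ψ k x‖ₑ + ‖∫ x, v x * (⇑χ - ⇑(ψ k)) x‖ₑ := by
            rw [hsplit]; exact enorm_add_le _ _
        _ ≤ _ := by
            gcongr
            · exact le_iSup (fun k => ‖∫ x, v x * ψ k x‖ₑ) k
            · exact ((enorm_integral_mul_le_two hv.1 hsub.1).trans (by gcongr)).trans hδ
    exact eLpNorm_le_of_forall_schwartz_normalized hrs hr hv dense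
  · exact (enorm_integral_mul_le hrs hv.1 (ψ k).continuous.aestronglyMeasurable).trans
      (mul_le_of_le_one_right zero_le (hψ1 k))

end Duality

/-! ### Interpolation between `L^1 → L^∞` and `L^2 → L^2` -/

section Interpolation

variable {E : Type*} [NormedAddCommGroup E] [InnerProductSpace ℝ E] [FiniteDimensional ℝ E]
  [MeasurableSpace E] [BorelSpace E]

/-- A bound for a sesquilinear form on `L^p ∩ L^2` extends from dense subsets. -/
lemma enorm_inner_le_of_dense (T : Lp ℂ 2 (volume : Measure E) →L[ℂ] Lp ℂ 2 (volume : Measure E))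
    {p : ℝ≥0∞} (hp : 1 ≤ p) {K : ℝ≥0∞} (hK : K ≠ ∞) (P : Lp ℂ 2 (volume : Measure E) → Prop)
    (hP : ∀ f g, P f → P g → ‖inner ℂ g (T f)‖ₑ ≤ K * (eLpNorm f p volume * eLpNorm g p volume))
    {f g : Lp ℂ 2 (volume : Measure E)}
    (hfp : eLpNorm f p volume ≠ ∞) (hgp : eLpNorm g p volume ≠ ∞)
    (hf : ∀ ε : ℝ≥0∞, ε ≠ 0 → ∃ f', P f' ∧ eLpNorm (⇑f - ⇑f') p volume ≤ ε ∧ edist f f' ≤ ε)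
    (hg : ∀ ε : ℝ≥0∞, ε ≠ 0 → ∃ g', P g' ∧ eLpNorm (⇑g - ⇑g') p volume ≤ ε ∧ edist g g' ≤ ε) :
    ‖inner ℂ g (T f)‖ₑ ≤ K * (eLpNorm f p volume * eLpNorm g p volume) := by
  set ε : ℕ → ℝ≥0∞ := fun k => ((k : ℝ≥0∞) + 1)⁻¹
  have hε0 : ∀ k, ε k ≠ 0 := fun k => by simp [ε]
  have hε : Tendsto ε atTop (𝓝 0) := by
    have := (tendsto_add_atTop_iff_nat 1).2 ENNReal.tendsto_inv_nat_nhds_zero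
    simpa [ε] using this
  choose F hF1 hF2 hF3 using fun k => hf (ε k) (hε0 k)
  choose G hG1 hG2 hG3 using fun k => hg (ε k) (hε0 k)
  have lim : ∀ (f : Lp ℂ 2 (volume : Measure E)) (F : ℕ → Lp ℂ 2 (volume : Measure E)),
      (∀ k, edist f (F k) ≤ ε k) → Tendsto F atTop (𝓝 f) := by
    intro f F h
    rw [tendsto_iff_edist_tendsto_0]
    refine tendsto_of_tendsto_of_tendsto_of_le_of_le tendsto_const_nhds hε (fun _ => zero_le)
      fun k => ?_
    rw [edist_comm]; exact h k
  have h1 : Tendsto (fun k => ‖inner ℂ (G k) (T (F k))‖ₑ) atTop (𝓝 ‖inner ℂ g (T f)‖ₑ) :=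
    ((lim g G hG3).inner ((T.continuous.tendsto f).comp (lim f F hF3))).enorm
  have h2 : Tendsto (fun k => K * ((eLpNorm f p volume + ε k) * (eLpNorm g p volume + ε k)))
      atTop (𝓝 (K * ((eLpNorm f p volume + 0) * (eLpNorm g p volume + 0)))) := by
    refine ENNReal.Tendsto.const_mul (ENNReal.Tendsto.mul (tendsto_const_nhds.add hε) (Or.inr ?_)
      (tendsto_const_nhds.add hε) (Or.inr ?_)) (Or.inr hK)
    · simpa using hgp
    · simpa using hfp
  rw [add_zero, add_zero] at h2
  have norm_le : ∀ f f' : Lp ℂ 2 (volume : Measure E),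
      eLpNorm f' p volume ≤ eLpNorm f p volume + eLpNorm (⇑f - ⇑f') p volume := by
    intro f f'
    have : ⇑f' = ⇑f - (⇑f - ⇑f') := by abel
    conv_lhs => rw [this]
    exact eLpNorm_sub_le (Lp.aestronglyMeasurable f)
      ((Lp.aestronglyMeasurable f).sub (Lp.aestronglyMeasurable f')) hp
  refine le_of_tendsto_of_tendsto' h1 h2 fun k => (hP _ _ (hF1 k) (hG1 k)).trans ?_
  gcongr
  · exact (norm_le f (F k)).trans (by gcongr; exact hF2 k)
  · exact (norm_le g (G k)).trans (by gcongr; exact hG2 k)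

/-- The element of `L^2` given by the indicator of a fibre of a simple function, or `0`. -/
noncomputable def fibreLp (s : SimpleFunc E ℂ) (a : ℂ) : Lp ℂ 2 (volume : Measure E) := by
  classical exact
  if h : MemLp ((s ⁻¹' {a}).indicator (1 : E → ℂ)) 2 volume then h.toLp else 0

lemma toLp_comp_simpleFunc (s : SimpleFunc E ℂ) (hs : MemLp s 2 volume) {φ : ℂ → ℂ} (h0 : φ 0 = 0)
    (hφ : MemLp (φ ∘ s) 2 volume) :
    hφ.toLp = ∑ a ∈ s.range with a ≠ 0, φ a • fibreLp s a := by
  have hmem : ∀ a, a ≠ 0 → MemLp ((s ⁻¹' {a}).indicator (1 : E → ℂ)) 2 volume := fun a ha =>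
    memLp_indicator_const 2 (s.measurableSet_fiber a) 1
      (Or.inr (SimpleFunc.measure_preimage_lt_top_of_memLp (by simp) (by simp) s hs a ha).ne)
  have hae : ∀ a ∈ s.range.filter (· ≠ 0), ∀ᵐ x, fibreLp s a x = (s ⁻¹' {a}).indicator 1 x := by
    intro a ha
    have h := hmem a (Finset.mem_filter.1 ha).2
    simp only [fibreLp, dif_pos h]
    exact h.coeFn_toLp
  have hsmul : ∀ a, ∀ᵐ x, (φ a • fibreLp s a : Lp ℂ 2 (volume : Measure E)) x =
      φ a * fibreLp s a x := fun a => by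
    filter_upwards [Lp.coeFn_smul (φ a) (fibreLp s a)] with x hx
    rw [hx]; rfl
  refine Lp.ext ?_
  have h1 : ∀ᵐ x, ∀ a ∈ s.range.filter (· ≠ 0),
      fibreLp s a x = (s ⁻¹' {a}).indicator 1 x := by
    exact (ae_ball_iff (Finset.countable_toSet _)).2 hae
  have h2 : ∀ᵐ x, ∀ a ∈ s.range.filter (· ≠ 0),
      (φ a • fibreLp s a : Lp ℂ 2 (volume : Measure E)) x = φ a * fibreLp s a x :=
    (ae_ball_iff (Finset.countable_toSet _)).2 fun a _ => hsmul a
  filter_upwards [hφ.coeFn_toLp, h1, h2, Lp.coeFn_finsetSum (s.range.filter (· ≠ 0))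
    (fun a => φ a • fibreLp s a)] with x hx h1 h2 h3
  rw [hx, h3, Finset.sum_apply, Finset.sum_congr rfl fun a ha => by rw [h2 a ha, h1 a ha]]
  by_cases hsx : s x = 0
  · rw [Finset.sum_eq_zero]
    · simp [hsx, h0]
    · intro a ha
      have : x ∉ s ⁻¹' {a} := by
        intro h
        exact (Finset.mem_filter.1 ha).2 (by rw [← hsx]; exact h.symm)
      simp [this]
  · rw [Finset.sum_eq_single (s x)]
    · simp
    · intro b _ hb
      have : x ∉ s ⁻¹' {b} := fun h => hb h.symm
      simp [this]
    · intro h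
      exact absurd (Finset.mem_filter.2 ⟨SimpleFunc.mem_range_self s x, hsx⟩) h

/-- The function `a ↦ (a / |a|) |a| ^ w`. -/
noncomputable def powPhase (w a : ℂ) : ℂ :=
  if a = 0 then 0 else a / ‖a‖ * Complex.exp (w * Real.log ‖a‖)

lemma norm_powPhase {w a : ℂ} (hw : 0 < w.re) : ‖powPhase w a‖ = ‖a‖ ^ w.re := by
  unfold powPhase
  split_ifs with h
  · simp [h, Real.zero_rpow hw.ne']
  · have h' : 0 < ‖a‖ := norm_pos_iff.2 h
    rw [norm_mul, norm_div, Complex.norm_real, norm_norm, div_self h'.ne', one_mul,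
      Complex.norm_exp, Complex.re_mul_ofReal, Real.rpow_def_of_pos h', mul_comm]

lemma powPhase_one (a : ℂ) : powPhase 1 a = a := by
  unfold powPhase
  split_ifs with h
  · exact h.symm
  · have h' : 0 < ‖a‖ := norm_pos_iff.2 h
    have : (‖a‖ : ℂ) ≠ 0 := by exact_mod_cast h'.ne'
    rw [one_mul, ← Complex.ofReal_exp, Real.exp_log h', div_mul_cancel₀ _ this]

lemma memLp_powPhase (s : SimpleFunc E ℂ) (hs : MemLp s 2 volume) (w : ℂ) {p : ℝ≥0∞}
    (hp0 : p ≠ 0) (hp : p ≠ ∞) : MemLp (powPhase w ∘ s) p volume := by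
  have h1 : s.FinMeasSupp volume := (SimpleFunc.memLp_iff_finMeasSupp (by simp) (by simp)).1 hs
  have h2 : (s.map (powPhase w)).FinMeasSupp volume := h1.map (by simp [powPhase])
  exact (SimpleFunc.memLp_iff_finMeasSupp hp0 hp).2 h2

lemma eLpNorm_powPhase (s : SimpleFunc E ℂ) {w : ℂ} {p e : ℝ} (he : 0 < e) (hw : 0 < w.re)
    (h : w.re * e = p) :
    eLpNorm (powPhase w ∘ s) (ENNReal.ofReal e) volume = (∫⁻ x, ‖s x‖ₑ ^ p) ^ (1 / e) := by
  rw [eLpNorm_eq_lintegral_rpow_enorm_toReal (by simpa using he) (by simp),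
    ENNReal.toReal_ofReal he.le]
  congr 1
  refine lintegral_congr fun x => ?_
  rw [← ofReal_norm, ← ofReal_norm, Function.comp_apply, norm_powPhase hw,
    ← ENNReal.ofReal_rpow_of_nonneg (norm_nonneg _) hw.le, ← ENNReal.rpow_mul, h]

lemma enorm_inner_simpleFunc_le
    (T : Lp ℂ 2 (volume : Measure E) →L[ℂ] Lp ℂ 2 (volume : Measure E)) (hT : ∀ f, ‖T f‖ ≤ ‖f‖)
    {κ θ p : ℝ} (hκ : 0 ≤ κ) (hθ0 : 0 ≤ θ) (hθ1 : θ ≤ 1) (hp : p * (1 + θ) = 2)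
    (h1 : ∀ f g : Lp ℂ 2 (volume : Measure E), eLpNorm f 1 volume ≠ ∞ → eLpNorm g 1 volume ≠ ∞ →
      ‖inner ℂ g (T f)‖ₑ ≤ ENNReal.ofReal κ * (eLpNorm f 1 volume * eLpNorm g 1 volume))
    (f g : SimpleFunc E ℂ) (hf : MemLp f 2 volume) (hg : MemLp g 2 volume) :
    ‖inner ℂ hg.toLp (T hf.toLp)‖ₑ ≤ ENNReal.ofReal (κ ^ θ) *
      (eLpNorm f (ENNReal.ofReal p) volume * eLpNorm g (ENNReal.ofReal p) volume) := by
  have hp0 : 0 < p := by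
    by_contra h
    nlinarith
  set α : ℂ → ℂ := fun z => ((p / 2 : ℝ) : ℂ) * (1 + z) with hα
  have hαre : ∀ z, (α z).re = p * (1 + z.re) / 2 := by
    intro z
    rw [hα, Complex.re_ofReal_mul]; simp; ring
  set L : (s : SimpleFunc E ℂ) → MemLp s 2 volume → ℂ → Lp ℂ 2 (volume : Measure E) := fun s hs w =>
    (memLp_powPhase s hs w (p := 2) (by simp) (by simp)).toLp with hL
  set Φ : ℂ → ℂ := fun z => ∑ a ∈ f.range with a ≠ 0, ∑ b ∈ g.range with b ≠ 0,
    (a / ‖a‖ * Complex.exp (α z * Real.log ‖a‖)) *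
      ((starRingEnd ℂ) (b / ‖b‖) * Complex.exp (α z * Real.log ‖b‖)) *
        inner ℂ (fibreLp g b) (T (fibreLp f a)) with hΦ
  have hΦL : ∀ z, Φ z = inner ℂ (L g hg (α ((starRingEnd ℂ) z))) (T (L f hf (α z))) := by
    intro z
    simp only [hL, hΦ]
    rw [toLp_comp_simpleFunc f hf (by simp [powPhase]), toLp_comp_simpleFunc g hg (by simp [powPhase]),
      map_sum, inner_sum]
    refine Finset.sum_congr rfl fun a ha => ?_
    rw [sum_inner]
    refine Finset.sum_congr rfl fun b hb => ?_
    rw [map_smul, inner_smul_left, inner_smul_right, powPhase, powPhase,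
      if_neg (Finset.mem_filter.1 ha).2, if_neg (Finset.mem_filter.1 hb).2, map_mul,
      ← Complex.exp_conj]
    have : (starRingEnd ℂ) (α ((starRingEnd ℂ) z) * Real.log ‖b‖) = α z * Real.log ‖b‖ := by
      simp only [hα, map_mul, map_add, map_one, Complex.conj_conj, Complex.conj_ofReal]
    rw [this]; ring
  have hd : DiffContOnCl ℂ Φ (Complex.HadamardThreeLines.verticalStrip 0 1) := by
    refine Differentiable.diffContOnCl ?_
    simp only [hΦ, hα]
    fun_prop
  have hB : BddAbove ((norm ∘ Φ) '' Complex.HadamardThreeLines.verticalClosedStrip 0 1) := by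
    refine ⟨∑ a ∈ f.range with a ≠ 0, ∑ b ∈ g.range with b ≠ 0,
      (‖a / ‖a‖‖ * Real.exp (p * |Real.log ‖a‖|)) *
        (‖(starRingEnd ℂ) (b / ‖b‖)‖ * Real.exp (p * |Real.log ‖b‖|)) *
          ‖inner ℂ (fibreLp g b) (T (fibreLp f a))‖, ?_⟩
    rintro _ ⟨z, hz, rfl⟩
    have hz : z.re ∈ Set.Icc (0 : ℝ) 1 := hz
    have hexp : ∀ t : ℝ, ‖Complex.exp (α z * t)‖ ≤ Real.exp (p * |t|) := by
      intro t
      rw [Complex.norm_exp, Complex.re_mul_ofReal, hαre]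
      refine Real.exp_le_exp.2 ?_
      have e1 : 0 ≤ p * (1 + z.re) / 2 := by have := hz.1; positivity
      have e2 : p * (1 + z.re) / 2 ≤ p := by nlinarith [hz.2]
      calc _ ≤ |p * (1 + z.re) / 2 * t| := le_abs_self _
        _ = p * (1 + z.re) / 2 * |t| := by rw [abs_mul, abs_of_nonneg e1]
        _ ≤ p * |t| := by gcongr
    refine (norm_sum_le _ _).trans (Finset.sum_le_sum fun a _ => ?_)
    refine (norm_sum_le _ _).trans (Finset.sum_le_sum fun b _ => ?_)
    rw [norm_mul, norm_mul, norm_mul, norm_mul]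
    gcongr <;> exact hexp _
  have fin : ∀ s : SimpleFunc E ℂ, MemLp s 2 volume → ∫⁻ x, ‖s x‖ₑ ^ p ≠ ∞ := by
    intro s hs
    have := (memLp_powPhase s hs (p : ℂ) (p := 1) (by simp) (by simp)).eLpNorm_ne_top
    have e := eLpNorm_powPhase s (w := p) (p := p) one_pos (by simp [hp0]) (by simp)
    rw [ENNReal.ofReal_one] at e
    rwa [e, one_div_one, ENNReal.rpow_one] at this
  set A := (∫⁻ x, ‖f x‖ₑ ^ p).toReal with hA
  set B := (∫⁻ x, ‖g x‖ₑ ^ p).toReal with hBdef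
  have hA0 : 0 ≤ A := ENNReal.toReal_nonneg
  have hB0 : 0 ≤ B := ENNReal.toReal_nonneg
  have norm2 : ∀ (s : SimpleFunc E ℂ) (hs : MemLp s 2 volume) (w : ℂ), w.re = p / 2 →
      ‖L s hs w‖ = (∫⁻ x, ‖s x‖ₑ ^ p).toReal ^ (1 / 2 : ℝ) := by
    intro s hs w hw
    rw [Lp.norm_def, eLpNorm_congr_ae (MemLp.coeFn_toLp _)]
    have := eLpNorm_powPhase s (w := w) (p := p) (e := 2) (by norm_num) (by rw [hw]; positivity)
      (by rw [hw]; ring)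
    rw [ENNReal.ofReal_ofNat] at this
    rw [this, ENNReal.toReal_rpow]
  have norm1 : ∀ (s : SimpleFunc E ℂ) (hs : MemLp s 2 volume) (w : ℂ), w.re = p →
      eLpNorm (L s hs w) 1 volume = ∫⁻ x, ‖s x‖ₑ ^ p := by
    intro s hs w hw
    rw [eLpNorm_congr_ae (MemLp.coeFn_toLp _)]
    have := eLpNorm_powPhase s (w := w) (p := p) (e := 1) (by norm_num) (by rw [hw]; positivity)
      (by rw [hw]; ring)
    rw [ENNReal.ofReal_one] at this
    rw [this, one_div_one, ENNReal.rpow_one]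
  have edge0 : ∀ z ∈ Complex.re ⁻¹' {0}, ‖Φ z‖ ≤ (A * B) ^ (1 / 2 : ℝ) := by
    intro z hz
    have hz : z.re = 0 := hz
    rw [hΦL, Real.mul_rpow hA0 hB0, mul_comm]
    refine (norm_inner_le_norm _ _).trans ?_
    rw [norm2 g hg _ (by rw [hαre, Complex.conj_re, hz]; ring)]
    gcongr
    refine (hT _).trans (le_of_eq ?_)
    rw [norm2 f hf _ (by rw [hαre, hz]; ring)]
  have edge1 : ∀ z ∈ Complex.re ⁻¹' {1}, ‖Φ z‖ ≤ κ * (A * B) := by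
    intro z hz
    have hz : z.re = 1 := hz
    rw [hΦL]
    have e1 := norm1 f hf (α z) (by rw [hαre, hz]; ring)
    have e2 := norm1 g hg (α ((starRingEnd ℂ) z)) (by rw [hαre, Complex.conj_re, hz]; ring)
    have := h1 (L f hf (α z)) (L g hg (α ((starRingEnd ℂ) z))) (by rw [e1]; exact fin f hf)
      (by rw [e2]; exact fin g hg)
    rw [e1, e2, ← ENNReal.ofReal_toReal (fin f hf), ← ENNReal.ofReal_toReal (fin g hg),
      ← ENNReal.ofReal_mul hA0, ← ENNReal.ofReal_mul hκ, ← ofReal_norm] at this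
    exact (ENNReal.ofReal_le_ofReal_iff (by positivity)).1 this
  have key := Complex.HadamardThreeLines.norm_le_interp_of_mem_verticalClosedStrip₀₁' Φ
    (z := (θ : ℂ)) (by exact ⟨by simpa using hθ0, by simpa using hθ1⟩) hd hB edge0 edge1
  have hαθ : α θ = 1 := by
    have : (p : ℂ) * (1 + θ) = 2 := by exact_mod_cast hp
    simp only [hα]; push_cast
    linear_combination this / 2
  have hLid : ∀ (s : SimpleFunc E ℂ) (hs : MemLp s 2 volume), L s hs 1 = hs.toLp := by
    intro s hs
    simp only [hL]
    congr 1
    ext x; simp [powPhase_one]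
  rw [hΦL, Complex.conj_ofReal, hαθ, hLid f hf, hLid g hg, Complex.ofReal_re,
    Real.mul_rpow hκ (by positivity),
    ← Real.rpow_mul (by positivity), mul_left_comm] at key
  have hexp : (A * B) ^ (1 / 2 * (1 - θ)) * (A * B) ^ θ = (A * B) ^ (1 / p) := by
    have e : 1 / p = 1 / 2 * (1 - θ) + θ := by
      have : 1 / p = (1 + θ) / 2 := by rw [← hp]; field_simp
      rw [this]; ring
    rw [e]
    rcases eq_or_lt_of_le (mul_nonneg hA0 hB0) with h0 | h0
    · rw [← h0]
      have : 1 / 2 * (1 - θ) + θ ≠ 0 := by rw [← e]; positivity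
      rw [Real.zero_rpow this]
      rcases eq_or_ne θ 0 with h | h
      · rw [h, Real.zero_rpow (by simp)]; simp
      · rw [Real.zero_rpow h, mul_zero]
    · rw [Real.rpow_add h0]
  rw [hexp] at key
  have nrm : ∀ s : SimpleFunc E ℂ, MemLp s 2 volume →
      eLpNorm s (ENNReal.ofReal p) volume = ENNReal.ofReal ((∫⁻ x, ‖s x‖ₑ ^ p).toReal ^ (1 / p)) := by
    intro s hs
    rw [eLpNorm_eq_lintegral_rpow_enorm_toReal (by simpa using hp0) (by simp),
      ENNReal.toReal_ofReal hp0.le, ← ENNReal.ofReal_rpow_of_nonneg ENNReal.toReal_nonneg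
      (by positivity), ENNReal.ofReal_toReal (fin s hs)]
  rw [nrm f hf, nrm g hg, ← ENNReal.ofReal_mul (by positivity), ← ENNReal.ofReal_mul (by positivity),
    ← ofReal_norm, ← Real.mul_rpow hA0 hB0]
  exact ENNReal.ofReal_le_ofReal key

/-- **Riesz-Thorin interpolation** for a contraction of `L^2` with an `L^1 → L^∞` bound, tested on
Schwartz functions. -/
theorem enorm_inner_schwartz_le
    (T : Lp ℂ 2 (volume : Measure E) →L[ℂ] Lp ℂ 2 (volume : Measure E)) (hT : ∀ f, ‖T f‖ ≤ ‖f‖)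
    {κ θ p : ℝ} (hκ : 0 ≤ κ) (hθ0 : 0 ≤ θ) (hθ1 : θ ≤ 1) (hp : p * (1 + θ) = 2)
    (h1 : ∀ ψ χ : 𝓢(E, ℂ), ‖inner ℂ (χ.toLp 2 volume) (T (ψ.toLp 2 volume))‖ₑ ≤
      ENNReal.ofReal κ * (eLpNorm ψ 1 volume * eLpNorm χ 1 volume)) (ψ χ : 𝓢(E, ℂ)) :
    ‖inner ℂ (χ.toLp 2 volume) (T (ψ.toLp 2 volume))‖ₑ ≤ ENNReal.ofReal (κ ^ θ) *
      (eLpNorm ψ (ENNReal.ofReal p) volume * eLpNorm χ (ENNReal.ofReal p) volume) := by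
  have hp1 : 1 ≤ p := by nlinarith
  have coe : ∀ (ψ : 𝓢(E, ℂ)), ⇑(ψ.toLp 2 volume) =ᵐ[volume] ⇑ψ := fun ψ => ψ.coeFn_toLp 2 volume
  have step1 : ∀ f g : Lp ℂ 2 (volume : Measure E), eLpNorm f 1 volume ≠ ∞ →
      eLpNorm g 1 volume ≠ ∞ →
      ‖inner ℂ g (T f)‖ₑ ≤ ENNReal.ofReal κ * (eLpNorm f 1 volume * eLpNorm g 1 volume) := by
    intro f g hf hg
    have approx : ∀ f : Lp ℂ 2 (volume : Measure E), eLpNorm f 1 volume ≠ ∞ → ∀ ε : ℝ≥0∞, ε ≠ 0 →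
        ∃ f', (∃ ψ : 𝓢(E, ℂ), ψ.toLp 2 volume = f') ∧ eLpNorm (⇑f - ⇑f') 1 volume ≤ ε ∧
          edist f f' ≤ ε := by
      intro f hf ε hε
      obtain ⟨ψ, h1, h2⟩ := exists_schwartz_eLpNorm_sub_le le_rfl (by norm_num)
        ⟨(Lp.memLp f).1, hf.lt_top⟩ (Lp.memLp f) hε
      refine ⟨_, ⟨ψ, rfl⟩, ?_, ?_⟩
      · rwa [eLpNorm_congr_ae (EventuallyEq.rfl.sub (coe ψ))]
      · rwa [Lp.edist_def, eLpNorm_congr_ae (EventuallyEq.rfl.sub (coe ψ))]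
    refine enorm_inner_le_of_dense T le_rfl (by simp) (fun f' => ∃ ψ : 𝓢(E, ℂ), ψ.toLp 2 volume = f')
      ?_ hf hg (approx f hf) (approx g hg)
    rintro _ _ ⟨ψ, rfl⟩ ⟨χ, rfl⟩
    rw [eLpNorm_congr_ae (coe ψ), eLpNorm_congr_ae (coe χ)]
    exact h1 ψ χ
  have approx : ∀ ψ : 𝓢(E, ℂ), ∀ ε : ℝ≥0∞, ε ≠ 0 → ∃ f',
      (∃ (s : SimpleFunc E ℂ) (hs : MemLp s 2 volume), hs.toLp = f') ∧
      eLpNorm (⇑(ψ.toLp 2 volume) - ⇑f') (ENNReal.ofReal p) volume ≤ ε ∧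
        edist (ψ.toLp 2 volume) f' ≤ ε := by
    intro ψ ε hε
    obtain ⟨s, _, hs, h1, h2⟩ := exists_simpleFunc_eLpNorm_sub_le (p := ENNReal.ofReal p)
      (by simp) ψ.continuous.measurable (ψ.memLp _ volume) (ψ.memLp 2 volume) hε
    refine ⟨_, ⟨s, hs, rfl⟩, ?_, ?_⟩
    · rwa [eLpNorm_congr_ae ((coe ψ).sub hs.coeFn_toLp), eLpNorm_sub_comm]
    · rwa [Lp.edist_def, eLpNorm_congr_ae ((coe ψ).sub hs.coeFn_toLp), eLpNorm_sub_comm]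
  have hfin : ∀ ψ : 𝓢(E, ℂ), eLpNorm (ψ.toLp 2 volume) (ENNReal.ofReal p) volume ≠ ∞ := fun ψ => by
    rw [eLpNorm_congr_ae (coe ψ)]; exact (ψ.memLp _ volume).eLpNorm_ne_top
  have := enorm_inner_le_of_dense T (p := ENNReal.ofReal p) (by simpa using hp1) (by simp)
    (fun f' => ∃ (s : SimpleFunc E ℂ) (hs : MemLp s 2 volume), hs.toLp = f')
    (K := ENNReal.ofReal (κ ^ θ)) (by
      rintro _ _ ⟨f, hf, rfl⟩ ⟨g, hg, rfl⟩
      rw [eLpNorm_congr_ae hf.coeFn_toLp, eLpNorm_congr_ae hg.coeFn_toLp]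
      exact enorm_inner_simpleFunc_le T hT hκ hθ0 hθ1 hp step1 f g hf hg)
    (hfin ψ) (hfin χ) (approx ψ) (approx χ)
  rwa [eLpNorm_congr_ae (coe ψ), eLpNorm_congr_ae (coe χ)] at this

end Interpolation

/-! ### The `T T*` argument -/

section TTStar

variable {X : Type*} [NormedAddCommGroup X] [InnerProductSpace ℂ X]

lemma inner_group_apply {U : ℝ → X →ₗᵢ[ℂ] X} (hU : ∀ s t x, U (s + t) x = U s (U t x)) (s t : ℝ)
    (x y : X) : inner ℂ (U s x) (U t y) = inner ℂ x (U (t - s) y) := by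
  have : U t y = U s (U (t - s) y) := by rw [← hU]; congr 2; ring
  rw [this, LinearIsometry.inner_map_map]

lemma exists_measurable_argmax {p : ℕ → ℝ → ℝ≥0∞} (hp : ∀ k, Measurable (p k)) (N : ℕ) :
    ∃ κ : ℝ → ℕ, Measurable κ ∧ (∀ t, κ t ≤ N) ∧ (Measurable fun t => p (κ t) t) ∧
      ∀ t, ∀ k ≤ N, p k t ≤ p (κ t) t := by
  classical
  induction N with
  | zero => exact ⟨fun _ => 0, measurable_const, fun _ => le_rfl, hp 0, fun t k hk => by
      rw [Nat.le_zero.1 hk]⟩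
  | succ N ih =>
    obtain ⟨κ, h1, h2, h3, h4⟩ := ih
    have hS : MeasurableSet {t | p (κ t) t ≤ p (N + 1) t} := measurableSet_le h3 (hp _)
    have e : (fun t => p (if p (κ t) t ≤ p (N + 1) t then N + 1 else κ t) t) =
        fun t => if p (κ t) t ≤ p (N + 1) t then p (N + 1) t else p (κ t) t := by
      ext t; split_ifs <;> rfl
    refine ⟨fun t => if p (κ t) t ≤ p (N + 1) t then N + 1 else κ t,
      Measurable.ite hS measurable_const h1, fun t => ?_, ?_, fun t k hk => ?_⟩
    · dsimp only
      split_ifs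
      · exact le_rfl
      · exact (h2 t).trans (Nat.le_succ N)
    · rw [e]; exact Measurable.ite hS (hp _) h3
    · dsimp only
      split_ifs with h
      · rcases Nat.le_succ_iff.1 hk with h' | h'
        · exact (h4 t k h').trans h
        · rw [h']
      · rcases Nat.le_succ_iff.1 hk with h' | h'
        · exact h4 t k h'
        · rw [h']; exact (not_le.1 h).le

lemma sq_lintegral_argmax_le [CompleteSpace X] {U : ℝ → X →ₗᵢ[ℂ] X}
    (hU : ∀ s t x, U (s + t) x = U s (U t x))
    (hUc : ∀ x, Continuous fun t => U t x) {ψ : ℕ → X} {K : ℝ → ℝ≥0∞}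
    (hK : ∀ k l t, t ≠ 0 → ‖inner ℂ (ψ k) (U t (ψ l))‖ₑ ≤ K t) (w : X) {N : ℕ} {κ : ℝ → ℕ}
    (hκ : Measurable κ) (hκN : ∀ t, κ t ≤ N) {g : ℝ → ℝ≥0∞} (hg : Measurable g)
    (hgN : ∀ t, g t ≤ N) (hg0 : ∀ t, t ∉ Set.Icc (-N : ℝ) N → g t = 0) :
    (∫⁻ t, g t * ‖inner ℂ (U (-t) (ψ (κ t))) w‖ₑ) ^ 2 ≤
      ‖w‖ₑ ^ 2 * ∫⁻ t, ∫⁻ s, g t * g s * K (t - s) := by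
  classical
  set z : ℕ → ℝ → ℂ := fun k t => inner ℂ (U (-t) (ψ k)) w with hz
  have hzc : ∀ k, Continuous (z k) := fun k =>
    ((hUc (ψ k)).comp continuous_neg).inner continuous_const
  set y : ℝ → X := fun t => ∑ k ∈ Finset.range (N + 1), {t | κ t = k}.indicator
    (fun t => (((g t).toReal : ℂ) * (z k t / ‖z k t‖)) • U (-t) (ψ k)) t with hy
  have hy_eq : ∀ t, y t = (((g t).toReal : ℂ) * (z (κ t) t / ‖z (κ t) t‖)) • U (-t) (ψ (κ t)) := by
    intro t
    rw [hy]
    simp only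
    rw [Finset.sum_eq_single (κ t)]
    · rw [Set.indicator_of_mem]; rfl
    · intro b _ hb
      rw [Set.indicator_of_notMem]
      exact fun h => hb (Eq.symm h)
    · intro h
      exact absurd (Finset.mem_range.2 (Nat.lt_succ_of_le (hκN t))) h
  have hg_top : ∀ t, g t ≠ ∞ := fun t => ne_top_of_le_ne_top (by simp) (hgN t)
  have hym : StronglyMeasurable y := by
    refine Finset.stronglyMeasurable_fun_sum _ fun k _ => StronglyMeasurable.indicator ?_
      (hκ (measurableSet_singleton k))
    refine StronglyMeasurable.smul ?_ (((hUc (ψ k)).comp continuous_neg).stronglyMeasurable)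
    refine Measurable.stronglyMeasurable ?_
    have h1 := (hzc k).measurable
    exact (Complex.measurable_ofReal.comp hg.ennreal_toReal).mul
      (h1.div (Complex.measurable_ofReal.comp h1.norm))
  have hphase : ∀ c : ℂ, ‖c / (‖c‖ : ℂ)‖ ≤ 1 := by
    intro c
    rw [norm_div, Complex.norm_real, norm_norm]; exact div_self_le_one _
  have hy_le : ∀ t, ‖y t‖ ≤ (g t).toReal * ‖ψ (κ t)‖ := by
    intro t
    rw [hy_eq, norm_smul, norm_mul, LinearIsometry.norm_map, Complex.norm_real,
      Real.norm_of_nonneg ENNReal.toReal_nonneg]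
    gcongr
    exact mul_le_of_le_one_right ENNReal.toReal_nonneg (hphase _)
  set M : ℝ := ∑ k ∈ Finset.range (N + 1), ‖ψ k‖ with hM
  have hψM : ∀ t, ‖ψ (κ t)‖ ≤ M := fun t =>
    Finset.single_le_sum (f := fun k => ‖ψ k‖) (fun _ _ => norm_nonneg _)
      (Finset.mem_range.2 (Nat.lt_succ_of_le (hκN t)))
  have hM0 : 0 ≤ M := Finset.sum_nonneg fun _ _ => norm_nonneg _
  have hyi : Integrable y := by
    have h1 : IntegrableOn (fun _ : ℝ => (N : ℝ) * M) (Set.Icc (-N : ℝ) N) :=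
      integrableOn_const (by rw [Real.volume_Icc]; exact ENNReal.ofReal_ne_top)
    refine (integrable_indicator_iff measurableSet_Icc |>.2 h1).mono hym.aestronglyMeasurable
      (.of_forall fun t => ?_)
    by_cases ht : t ∈ Set.Icc (-N : ℝ) N
    · rw [Set.indicator_of_mem ht, Real.norm_of_nonneg (by positivity)]
      refine (hy_le t).trans ?_
      gcongr
      · exact ENNReal.toReal_le_of_le_ofReal (by positivity) (by simpa using hgN t)
      · exact hψM t
    · have := hy_le t
      rw [hg0 t ht] at this
      rw [Set.indicator_of_notMem ht]; simpa using this
  set Y := ∫ t, y t with hY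
  have hwY : ‖inner ℂ w Y‖ₑ = ∫⁻ t, g t * ‖inner ℂ (U (-t) (ψ (κ t))) w‖ₑ := by
    rw [hY, ← integral_inner hyi]
    have e : ∀ t, inner ℂ w (y t) = (((g t).toReal * ‖z (κ t) t‖ : ℝ) : ℂ) := by
      intro t
      rw [hy_eq, inner_smul_right]
      have h1 : inner ℂ w (U (-t) (ψ (κ t))) = (starRingEnd ℂ) (z (κ t) t) :=
        (inner_conj_symm _ _).symm
      rw [h1, mul_assoc]
      push_cast
      congr 1
      rcases eq_or_ne (z (κ t) t) 0 with h0 | h0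
      · simp [h0]
      · have : (‖z (κ t) t‖ : ℂ) ≠ 0 := by exact_mod_cast (norm_ne_zero_iff.2 h0)
        rw [div_mul_eq_mul_div, Complex.mul_conj, Complex.normSq_eq_norm_sq]
        push_cast
        field_simp
    have hi : Integrable fun t => (g t).toReal * ‖z (κ t) t‖ := by
      have := (hyi.const_inner (𝕜 := ℂ) w).norm
      refine this.congr (.of_forall fun t => ?_)
      simp only
      rw [e, Complex.norm_real, Real.norm_of_nonneg (by positivity)]
    rw [integral_congr_ae (.of_forall e), integral_complex_ofReal, ← ofReal_norm,
      Complex.norm_real, Real.norm_of_nonneg (integral_nonneg fun t => by positivity),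
      ofReal_integral_eq_lintegral_ofReal hi (.of_forall fun t => by positivity)]
    refine lintegral_congr fun t => ?_
    rw [ENNReal.ofReal_mul ENNReal.toReal_nonneg, ENNReal.ofReal_toReal (hg_top t), ofReal_norm]
  have hyy : ∀ t s, t ≠ s → ‖inner ℂ (y t) (y s)‖ₑ ≤ g t * g s * K (t - s) := by
    intro t s hts
    rw [hy_eq t, hy_eq s, inner_smul_left, inner_smul_right, inner_group_apply hU, enorm_mul,
      enorm_mul, ← mul_assoc]
    have h1 : ∀ t, ‖((g t).toReal : ℂ) * (z (κ t) t / ‖z (κ t) t‖)‖ₑ ≤ g t := by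
      intro t
      rw [← ofReal_norm, norm_mul, Complex.norm_real, Real.norm_of_nonneg ENNReal.toReal_nonneg]
      refine (ENNReal.ofReal_le_ofReal (mul_le_of_le_one_right ENNReal.toReal_nonneg
        (hphase _))).trans ?_
      rw [ENNReal.ofReal_toReal (hg_top t)]
    gcongr
    · rw [RCLike.enorm_conj]; exact h1 t
    · exact h1 s
    · rw [show -s - -t = t - s by ring]; exact hK _ _ _ (sub_ne_zero.2 hts)
  have hYY : ‖Y‖ₑ ^ 2 ≤ ∫⁻ t, ∫⁻ s, g t * g s * K (t - s) := by
    have e : ‖Y‖ₑ ^ 2 = ‖inner ℂ Y Y‖ₑ := by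
      rw [inner_self_eq_norm_sq_to_K, ← ofReal_norm, ← ofReal_norm, norm_pow,
        ENNReal.ofReal_pow (norm_nonneg _)]
      simp
    rw [e]
    nth_rw 2 [hY]
    rw [← integral_inner hyi]
    refine (enorm_integral_le_lintegral_enorm _).trans (lintegral_mono fun t => ?_)
    have e2 : ‖inner ℂ Y (y t)‖ₑ = ‖inner ℂ (y t) Y‖ₑ := by
      rw [← ofReal_norm, ← ofReal_norm, norm_inner_symm]
    rw [e2, hY, ← integral_inner hyi]
    refine (enorm_integral_le_lintegral_enorm _).trans (lintegral_mono_ae ?_)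
    have : ∀ᵐ s : ℝ, s ≠ t := by simp [ae_iff]
    filter_upwards [this] with s hs
    exact hyy t s hs.symm
  rw [← hwY]
  calc ‖inner ℂ w Y‖ₑ ^ 2 ≤ (‖w‖ₑ * ‖Y‖ₑ) ^ 2 := by
        gcongr
        rw [← ofReal_norm, ← ofReal_norm, ← ofReal_norm, ← ENNReal.ofReal_mul (norm_nonneg _)]
        exact ENNReal.ofReal_le_ofReal (norm_inner_le_norm _ _)
    _ = ‖w‖ₑ ^ 2 * ‖Y‖ₑ ^ 2 := mul_pow _ _ _
    _ ≤ _ := by gcongr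

/-- The **`T T*` inequality** for a unitary group whose matrix coefficients against a family of
vectors are controlled by a kernel. -/
theorem sq_lintegral_iSup_inner_le [CompleteSpace X] {U : ℝ → X →ₗᵢ[ℂ] X}
    (hU : ∀ s t x, U (s + t) x = U s (U t x))
    (hUc : ∀ x, Continuous fun t => U t x) {ψ : ℕ → X} {K : ℝ → ℝ≥0∞}
    (hK : ∀ k l t, t ≠ 0 → ‖inner ℂ (ψ k) (U t (ψ l))‖ₑ ≤ K t) (w : X)
    {g : ℝ → ℝ≥0∞} (hg : Measurable g) :
    (∫⁻ t, g t * ⨆ k, ‖inner ℂ (U (-t) (ψ k)) w‖ₑ) ^ 2 ≤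
      ‖w‖ₑ ^ 2 * ∫⁻ t, ∫⁻ s, g t * g s * K (t - s) := by
  set p : ℕ → ℝ → ℝ≥0∞ := fun k t => ‖inner ℂ (U (-t) (ψ k)) w‖ₑ with hp_def
  have hp : ∀ k, Measurable (p k) := fun k =>
    (((hUc (ψ k)).comp continuous_neg).inner continuous_const).measurable.enorm
  set gN : ℕ → ℝ → ℝ≥0∞ := fun N => (Set.Icc (-N : ℝ) N).indicator fun t => min (g t) N with hgN
  have hgNm : ∀ N, Measurable (gN N) := fun N =>
    (hg.min measurable_const).indicator measurableSet_Icc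
  have hgNg : ∀ N t, gN N t ≤ g t := fun N t => by
    by_cases ht : t ∈ Set.Icc (-N : ℝ) N
    · simp only [hgN, Set.indicator_of_mem ht]; exact min_le_left _ _
    · simp only [hgN, Set.indicator_of_notMem ht]; exact zero_le
  have hgmono : ∀ t, Monotone fun N => gN N t := by
    intro t N M hNM
    have hc : (N : ℝ) ≤ M := by exact_mod_cast hNM
    by_cases ht : t ∈ Set.Icc (-N : ℝ) N
    · have ht' : t ∈ Set.Icc (-M : ℝ) M := ⟨by linarith [ht.1], by linarith [ht.2]⟩
      simp only [hgN, Set.indicator_of_mem ht, Set.indicator_of_mem ht']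
      gcongr
    · simp only [hgN, Set.indicator_of_notMem ht]; exact zero_le
  have hgsup : ∀ t, ⨆ N, gN N t = g t := by
    intro t
    refine le_antisymm (iSup_le fun N => hgNg N t) ?_
    obtain ⟨M, hM⟩ := exists_nat_ge |t|
    have hmem : ∀ N ≥ M, gN N t = min (g t) N := by
      intro N hN
      have : |t| ≤ N := hM.trans (by exact_mod_cast hN)
      simp only [hgN]
      rw [Set.indicator_of_mem (show t ∈ Set.Icc (-N : ℝ) N from abs_le.1 this)]
    refine ENNReal.le_of_forall_nnreal_lt fun a ha => ?_
    obtain ⟨N, hN⟩ := exists_nat_ge (a : ℝ≥0∞).toReal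
    refine le_iSup_of_le (max N M) ?_
    rw [hmem _ (le_max_right _ _)]
    refine le_min ha.le ?_
    have : (a : ℝ) ≤ (max N M : ℕ) := hN.trans (by exact_mod_cast le_max_left _ _)
    exact_mod_cast this
  set hN : ℕ → ℝ → ℝ≥0∞ := fun N t => (Finset.range (N + 1)).sup fun k => p k t with hhN
  have hmono : ∀ t, Monotone fun N => hN N t := fun t N M hNM =>
    Finset.sup_mono (Finset.range_mono (Nat.succ_le_succ hNM))
  have hsup : ∀ t, ⨆ k, p k t = ⨆ N, hN N t := by
    intro t
    refine le_antisymm (iSup_le fun k => le_iSup_of_le k ?_) (iSup_le fun N => ?_)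
    · exact Finset.le_sup (f := fun k => p k t) (Finset.self_mem_range_succ k)
    · exact Finset.sup_le fun k _ => le_iSup (fun k => p k t) k
  have hhm : ∀ N, Measurable (hN N) := by
    intro N
    have : hN N = (Finset.range (N + 1)).sup p := by
      ext t; rw [hhN, Finset.sup_apply]
    rw [this]
    exact Finset.sup_induction measurable_const (fun _ h1 _ h2 => h1.sup h2) fun k _ => hp k
  have hlim : ∫⁻ t, g t * ⨆ k, p k t = ⨆ N, ∫⁻ t, gN N t * hN N t := by
    rw [← lintegral_iSup (f := fun N t => gN N t * hN N t) (fun N => (hgNm N).mul (hhm N))]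
    · refine lintegral_congr fun t => ?_
      rw [hsup, ← hgsup t, ENNReal.iSup_mul]
      simp_rw [ENNReal.mul_iSup]
      refine le_antisymm (iSup_le fun i => iSup_le fun j => ?_)
        (iSup_le fun N => le_iSup_of_le N (le_iSup_of_le N le_rfl))
      exact le_iSup_of_le (max i j) (mul_le_mul' (hgmono t (le_max_left i j))
        (hmono t (le_max_right i j)))
    · intro N M hNM t
      exact mul_le_mul' (hgmono t hNM) (hmono t hNM)
  have key : ∀ N, (∫⁻ t, gN N t * hN N t) ^ 2 ≤
      ‖w‖ₑ ^ 2 * ∫⁻ t, ∫⁻ s, g t * g s * K (t - s) := by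
    intro N
    obtain ⟨κ, h1, h2, -, h4⟩ := exists_measurable_argmax hp N
    refine le_trans ?_ ((sq_lintegral_argmax_le hU hUc hK w h1 h2 (hgNm N) (fun t => ?_)
      (fun t ht => ?_)).trans ?_)
    · gcongr with t
      exact Finset.sup_le fun k hk => h4 t k (Nat.lt_succ_iff.1 (Finset.mem_range.1 hk))
    · by_cases ht : t ∈ Set.Icc (-N : ℝ) N
      · simp only [hgN, Set.indicator_of_mem ht]; exact min_le_right _ _
      · simp only [hgN, Set.indicator_of_notMem ht]; exact zero_le
    · simp only [hgN, Set.indicator_of_notMem ht]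
    · gcongr with t s
      · exact hgNg N t
      · exact hgNg N s
  rw [hlim]
  have : ∀ a : ℝ≥0∞, (∀ N, (∫⁻ t, gN N t * hN N t) ^ 2 ≤ a) →
      (⨆ N, ∫⁻ t, gN N t * hN N t) ^ 2 ≤ a := by
    intro a ha
    have h2 : ∀ x : ℝ≥0∞, x ^ 2 ≤ a ↔ x ≤ a ^ (1 / 2 : ℝ) := by
      intro x
      rw [← ENNReal.rpow_natCast, one_div, ENNReal.le_rpow_inv_iff (by norm_num)]
      norm_num
    rw [h2]
    exact iSup_le fun N => (h2 _).1 (ha N)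
  exact this _ key

end TTStar

/-! ### Propagators on Schwartz space and on `L^2` -/

section Propagator

/-- Square integrable complex functions. -/
noncomputable abbrev L2 (E : Type*) [NormedAddCommGroup E] [InnerProductSpace ℝ E]
    [FiniteDimensional ℝ E]
    [MeasurableSpace E] [BorelSpace E] := Lp ℂ 2 (volume : Measure E)

variable {E : Type*} [NormedAddCommGroup E] [InnerProductSpace ℝ E] [FiniteDimensional ℝ E]
  [MeasurableSpace E] [BorelSpace E]

/-- Complex conjugation on `L^2`. -/
noncomputable def conjL2 : L2 E →L[ℝ] L2 E :=
  ContinuousLinearMap.compLpL 2 volume (Complex.conjCLE : ℂ →L[ℝ] ℂ)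

lemma coeFn_conjL2 (v : L2 E) : conjL2 v =ᵐ[volume] fun x => (starRingEnd ℂ) (v x) :=
  ContinuousLinearMap.coeFn_compLpL _ v

lemma eLpNorm_conjL2 (v : L2 E) (p : ℝ≥0∞) : eLpNorm (conjL2 v) p volume = eLpNorm v p volume := by
  refine eLpNorm_congr_norm_ae ?_
  filter_upwards [coeFn_conjL2 v] with x hx
  rw [hx, RCLike.norm_conj]

lemma norm_conjL2 (v : L2 E) : ‖conjL2 v‖ = ‖v‖ := by
  rw [Lp.norm_def, Lp.norm_def, eLpNorm_conjL2]

lemma conjL2_conjL2 (v : L2 E) : conjL2 (conjL2 v) = v := by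
  refine Lp.ext ?_
  filter_upwards [coeFn_conjL2 (conjL2 v), coeFn_conjL2 v] with x h1 h2
  rw [h1, h2, Complex.conj_conj]

lemma conjL2_real_smul (c : ℝ) (v : L2 E) : conjL2 ((c : ℂ) • v) = (c : ℂ) • conjL2 v := by
  have : ∀ w : L2 E, (c : ℂ) • w = c • w := fun w => Complex.coe_smul c w
  rw [this, this, map_smul]

lemma inner_conjL2_toLp (v : L2 E) (ψ : 𝓢(E, ℂ)) :
    inner ℂ (conjL2 v) (ψ.toLp 2 volume) = ∫ x, v x * ψ x := by
  rw [L2.inner_def]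
  refine integral_congr_ae ?_
  filter_upwards [coeFn_conjL2 v, ψ.coeFn_toLp 2 volume] with x h1 h2
  rw [h1, h2, RCLike.inner_apply, Complex.conj_conj, mul_comm]

lemma inner_toLp_eq_integral (v : L2 E) (ψ : 𝓢(E, ℂ)) :
    inner ℂ v (ψ.toLp 2 volume) = ∫ x, conjL2 v x * ψ x := by
  rw [← inner_conjL2_toLp, conjL2_conjL2]

/-- Interpolation of `L^r`, `r ≥ 2`, between a uniform bound and an `L^2` bound. -/
lemma eLpNorm_le_of_bound_of_eLpNorm_two {r M : ℝ} (hr : 2 ≤ r) {f : E → ℂ} (hM : 0 ≤ M)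
    (h1 : ∀ x, ‖f x‖ ≤ M) (h2 : eLpNorm f 2 volume ≤ ENNReal.ofReal M) :
    eLpNorm f (ENNReal.ofReal r) volume ≤ ENNReal.ofReal M := by
  have hr0 : 0 < r := by linarith
  rcases eq_or_lt_of_le hM with h0 | h0
  · have : f = 0 := by
      ext x; have := h1 x; rw [← h0] at this; simpa using this
    simp [this]
  rw [eLpNorm_eq_lintegral_rpow_enorm_toReal (by simpa using hr0) (by simp),
    ENNReal.toReal_ofReal hr0.le]
  have h2' : ∫⁻ x, ‖f x‖ₑ ^ (2 : ℝ) ≤ ENNReal.ofReal M ^ (2 : ℝ) := by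
    rw [eLpNorm_eq_lintegral_rpow_enorm_toReal (by simp) (by simp), ENNReal.toReal_ofNat,
      one_div, ENNReal.rpow_inv_le_iff (by norm_num)] at h2
    exact h2
  have : ∫⁻ x, ‖f x‖ₑ ^ r ≤ ENNReal.ofReal M ^ r := by
    calc ∫⁻ x, ‖f x‖ₑ ^ r ≤ ∫⁻ x, ENNReal.ofReal M ^ (r - 2) * ‖f x‖ₑ ^ (2 : ℝ) := by
          refine lintegral_mono fun x => ?_
          have e : r = (r - 2) + 2 := by ring
          conv_lhs => rw [e]
          rw [ENNReal.rpow_add_of_nonneg _ _ (by linarith) (by norm_num)]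
          refine mul_le_mul' (ENNReal.rpow_le_rpow ?_ (by linarith)) le_rfl
          rw [← ofReal_norm]; exact ENNReal.ofReal_le_ofReal (h1 x)
      _ = ENNReal.ofReal M ^ (r - 2) * ∫⁻ x, ‖f x‖ₑ ^ (2 : ℝ) := by
          rw [lintegral_const_mul' _ _ (ENNReal.rpow_ne_top_of_nonneg (by linarith) (by simp))]
      _ ≤ ENNReal.ofReal M ^ (r - 2) * ENNReal.ofReal M ^ (2 : ℝ) := by gcongr
      _ = _ := by
          rw [← ENNReal.rpow_add_of_nonneg _ _ (by linarith) (by norm_num)]; congr 1; ring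
  calc _ ≤ (ENNReal.ofReal M ^ r) ^ (1 / r) := by gcongr
    _ = _ := by rw [← ENNReal.rpow_mul, mul_one_div_cancel hr0.ne', ENNReal.rpow_one]

/-- A group `G` of operators on Schwartz space with generator `-L`, that is `exp (β t)` times the
restriction of a unitary group `U` on `L^2`. -/
structure Propagator (E : Type*) [NormedAddCommGroup E] [InnerProductSpace ℝ E]
    [FiniteDimensional ℝ E] [MeasurableSpace E] [BorelSpace E] (β : ℝ)
    (L : 𝓢(E, ℂ) → 𝓢(E, ℂ)) where
  U : ℝ → L2 E →ₗᵢ[ℂ] L2 E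
  G : ℝ → 𝓢(E, ℂ) →ₗ[ℂ] 𝓢(E, ℂ)
  U_zero : ∀ f, U 0 f = f
  U_add : ∀ s t f, U (s + t) f = U s (U t f)
  G_zero : ∀ ψ, G 0 ψ = ψ
  G_add : ∀ s t ψ, G (s + t) ψ = G s (G t ψ)
  toLp_G : ∀ t ψ, (G t ψ).toLp 2 volume = ((Real.exp (β * t) : ℝ) : ℂ) • U t (ψ.toLp 2 volume)
  tendsto_slope : ∀ ψ, Tendsto (fun h : ℝ => h⁻¹ • ((G h ψ).toLp 2 volume - ψ.toLp 2 volume))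
    (𝓝[≠] 0) (𝓝 (-(L ψ).toLp 2 volume))
  lipschitz : ∀ ψ, ∃ C : ℝ, ∀ᶠ h in 𝓝 (0 : ℝ), ∀ x, ‖G h ψ x - ψ x‖ ≤ C * |h|

namespace Propagator

variable {β : ℝ} {L : 𝓢(E, ℂ) → 𝓢(E, ℂ)} (P : Propagator E β L)
include P

lemma U_toLp (t : ℝ) (ψ : 𝓢(E, ℂ)) : P.U t (ψ.toLp 2 volume) =
    ((Real.exp (-(β * t)) : ℝ) : ℂ) • (P.G t ψ).toLp 2 volume := by
  rw [P.toLp_G, smul_smul, ← Complex.ofReal_mul, ← Real.exp_add]; simp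

lemma eventually_norm_toLp_sub_le (ψ : 𝓢(E, ℂ)) : ∃ C : ℝ, ∀ᶠ h in 𝓝 (0 : ℝ),
    ‖(P.G h ψ).toLp 2 volume - ψ.toLp 2 volume‖ ≤ C * |h| := by
  refine ⟨‖(L ψ).toLp 2 volume‖ + 1, ?_⟩
  have h1 := (P.tendsto_slope ψ).norm.eventually (gt_mem_nhds
    (show ‖-(L ψ).toLp 2 volume‖ < ‖(L ψ).toLp 2 volume‖ + 1 by rw [norm_neg]; linarith))
  rw [eventually_nhdsWithin_iff] at h1
  filter_upwards [h1] with h hh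
  rcases eq_or_ne h 0 with rfl | h0
  · simp [P.G_zero]
  · have := hh h0
    rw [norm_smul, norm_inv, Real.norm_eq_abs, inv_mul_lt_iff₀ (abs_pos.2 h0)] at this
    linarith

lemma tendsto_toLp_G (ψ : 𝓢(E, ℂ)) :
    Tendsto (fun h : ℝ => (P.G h ψ).toLp 2 volume) (𝓝 0) (𝓝 (ψ.toLp 2 volume)) := by
  obtain ⟨C, hC⟩ := P.eventually_norm_toLp_sub_le ψ
  rw [tendsto_iff_norm_sub_tendsto_zero]
  refine squeeze_zero' (.of_forall fun _ => norm_nonneg _) hC ?_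
  have : Tendsto (fun h : ℝ => C * |h|) (𝓝 0) (𝓝 (C * |0|)) :=
    (continuous_const.mul continuous_abs).tendsto 0
  simpa using this

lemma continuous_U (f : L2 E) : Continuous fun t => P.U t f := by
  have h0 : Tendsto (fun h => P.U h f) (𝓝 0) (𝓝 f) := by
    rw [Metric.tendsto_nhds]
    intro ε hε
    obtain ⟨_, ⟨ψ, rfl⟩, hψ⟩ := Metric.mem_closure_iff.1
      (SchwartzMap.denseRange_toLpCLM (p := 2) (μ := (volume : Measure E)) (F := ℂ)
        ENNReal.ofNat_ne_top f) (ε / 3) (by positivity)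
    rw [SchwartzMap.toLpCLM_apply] at hψ
    have h1 : Tendsto (fun h => P.U h (ψ.toLp 2 volume)) (𝓝 0) (𝓝 (ψ.toLp 2 volume)) := by
      have hc : Tendsto (fun h : ℝ => ((Real.exp (-(β * h)) : ℝ) : ℂ)) (𝓝 0) (𝓝 1) := by
        have : Continuous fun h : ℝ => ((Real.exp (-(β * h)) : ℝ) : ℂ) := by fun_prop
        simpa using this.tendsto 0
      simpa [P.U_toLp] using hc.smul (P.tendsto_toLp_G ψ)
    filter_upwards [Metric.tendsto_nhds.1 h1 (ε / 3) (by positivity)] with h hh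
    calc dist (P.U h f) f ≤ dist (P.U h f) (P.U h (ψ.toLp 2 volume)) +
          dist (P.U h (ψ.toLp 2 volume)) (ψ.toLp 2 volume) + dist (ψ.toLp 2 volume) f :=
          dist_triangle4 _ _ _ _
      _ < ε / 3 + ε / 3 + ε / 3 := by
          rw [(P.U h).dist_map, dist_comm (ψ.toLp 2 volume) f]
          gcongr
      _ = ε := by ring
  refine continuous_iff_continuousAt.2 fun t => ?_
  have h1 : Tendsto (fun s => P.U t (P.U (s - t) f)) (𝓝 t) (𝓝 (P.U t f)) := by
    refine ((P.U t).continuous.tendsto f).comp (h0.comp ?_)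
    have : Tendsto (fun s : ℝ => s - t) (𝓝 t) (𝓝 (t - t)) :=
      (continuous_id.sub continuous_const).tendsto t
    simpa using this
  refine h1.congr fun s => ?_
  rw [← P.U_add]; congr 2; ring

lemma eventually_eLpNorm_sub_le {r : ℝ} (hr : 2 ≤ r) (ψ : 𝓢(E, ℂ)) : ∃ C : ℝ, 0 ≤ C ∧
    ∀ᶠ h in 𝓝 (0 : ℝ),
      eLpNorm (⇑(P.G h ψ) - ⇑ψ) (ENNReal.ofReal r) volume ≤ ENNReal.ofReal (C * |h|) := by
  obtain ⟨C₁, h₁⟩ := P.lipschitz ψ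
  obtain ⟨C₂, h₂⟩ := P.eventually_norm_toLp_sub_le ψ
  refine ⟨max (max C₁ C₂) 0, le_max_right _ _, ?_⟩
  filter_upwards [h₁, h₂] with h h1 h2
  have e1 : C₁ ≤ max (max C₁ C₂) 0 := (le_max_left _ _).trans (le_max_left _ _)
  have e2 : C₂ ≤ max (max C₁ C₂) 0 := (le_max_right _ _).trans (le_max_left _ _)
  refine eLpNorm_le_of_bound_of_eLpNorm_two hr (by positivity) (fun x => ?_) ?_
  · exact (h1 x).trans (by gcongr)
  · have h3 : eLpNorm (⇑(P.G h ψ) - ⇑ψ) 2 volume =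
        ENNReal.ofReal ‖(P.G h ψ).toLp 2 volume - ψ.toLp 2 volume‖ := by
      rw [Lp.norm_def, ENNReal.ofReal_toReal (Lp.eLpNorm_ne_top _)]
      refine eLpNorm_congr_ae ?_
      filter_upwards [(P.G h ψ).coeFn_toLp 2 volume, ψ.coeFn_toLp 2 volume,
        Lp.coeFn_sub ((P.G h ψ).toLp 2 volume) (ψ.toLp 2 volume)] with x a b c
      rw [c, Pi.sub_apply, Pi.sub_apply, a, b]
    rw [h3]
    exact ENNReal.ofReal_le_ofReal (h2.trans (by gcongr))

lemma continuous_toLp_G {r : ℝ} (hr : 2 ≤ r) [Fact (1 ≤ ENNReal.ofReal r)] (ψ : 𝓢(E, ℂ)) :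
    Continuous fun t => (P.G t ψ).toLp (ENNReal.ofReal r) volume := by
  refine continuous_iff_continuousAt.2 fun t => ?_
  obtain ⟨C, -, hC⟩ := P.eventually_eLpNorm_sub_le hr (P.G t ψ)
  have hs : Tendsto (fun s : ℝ => s - t) (𝓝 t) (𝓝 0) := by
    have : Tendsto (fun s : ℝ => s - t) (𝓝 t) (𝓝 (t - t)) :=
      (continuous_id.sub continuous_const).tendsto t
    simpa using this
  change Tendsto _ _ _
  rw [tendsto_iff_edist_tendsto_0]
  have hlim : Tendsto (fun s : ℝ => ENNReal.ofReal (C * |s - t|)) (𝓝 t) (𝓝 0) := by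
    have : Tendsto (fun s : ℝ => ENNReal.ofReal (C * |s - t|)) (𝓝 t)
      (𝓝 (ENNReal.ofReal (C * |t - t|))) := by
      exact (ENNReal.continuous_ofReal.comp (by fun_prop : Continuous fun s : ℝ =>
        C * |s - t|)).tendsto t
    simpa using this
  refine tendsto_of_tendsto_of_tendsto_of_le_of_le' tendsto_const_nhds hlim
    (.of_forall fun _ => zero_le) ?_
  filter_upwards [hs.eventually hC] with s h
  rw [← P.G_add, sub_add_cancel] at h
  rw [Lp.edist_def]
  refine le_trans (le_of_eq (eLpNorm_congr_ae ?_)) h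
  filter_upwards [(P.G s ψ).coeFn_toLp (ENNReal.ofReal r) volume,
    (P.G t ψ).coeFn_toLp (ENNReal.ofReal r) volume] with x a b
  rw [Pi.sub_apply, Pi.sub_apply, a, b]

/-- `‖G t ψ‖_{L^r}` is bounded locally uniformly in `t`. -/
lemma exists_eLpNorm_G_le {r : ℝ} (hr : 2 ≤ r) (ψ : 𝓢(E, ℂ)) (a b : ℝ) : ∃ C : ℝ≥0∞, C ≠ ∞ ∧
    ∀ t ∈ Set.Icc a b, eLpNorm (P.G t ψ) (ENNReal.ofReal r) volume ≤ C := by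
  have : Fact (1 ≤ ENNReal.ofReal r) :=
    ⟨by rw [← ENNReal.ofReal_one]; exact ENNReal.ofReal_le_ofReal (by linarith)⟩
  obtain ⟨C, hC⟩ := isCompact_Icc.exists_bound_of_continuousOn
    (P.continuous_toLp_G hr ψ).continuousOn (s := Set.Icc a b)
  refine ⟨ENNReal.ofReal C, by simp, fun t ht => ?_⟩
  have := hC t ht
  rw [Lp.norm_def, eLpNorm_congr_ae ((P.G t ψ).coeFn_toLp _ volume)] at this
  exact ENNReal.le_ofReal_iff_toReal_le ((P.G t ψ).memLp _ volume).eLpNorm_ne_top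
    (ENNReal.toReal_nonneg.trans this) |>.2 this

lemma continuous_uncurry_G (ψ : 𝓢(E, ℂ)) : Continuous fun z : ℝ × E => P.G z.1 ψ z.2 := by
  refine continuous_iff_continuousAt.2 fun ⟨t, x⟩ => ?_
  obtain ⟨C, hC⟩ := P.lipschitz (P.G t ψ)
  have hs : Tendsto (fun z : ℝ × E => z.1 - t) (𝓝 (t, x)) (𝓝 0) := by
    have : Tendsto (fun z : ℝ × E => z.1 - t) (𝓝 (t, x)) (𝓝 (t - t)) :=
      (continuous_fst.sub continuous_const).tendsto (t, x)
    simpa using this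
  change Tendsto _ _ _
  have h1 : Tendsto (fun z : ℝ × E => P.G t ψ z.2) (𝓝 (t, x)) (𝓝 (P.G t ψ x)) :=
    ((P.G t ψ).continuous.comp continuous_snd).tendsto (t, x)
  have h2 : Tendsto (fun z : ℝ × E => P.G z.1 ψ z.2 - P.G t ψ z.2) (𝓝 (t, x)) (𝓝 0) := by
    refine squeeze_zero_norm' (a := fun z : ℝ × E => C * |z.1 - t|) ?_ ?_
    · filter_upwards [hs.eventually hC] with z hz
      have := hz z.2
      rwa [← P.G_add, sub_add_cancel] at this
    · have : Tendsto (fun z : ℝ × E => C * |z.1 - t|) (𝓝 (t, x)) (𝓝 (C * |t - t|)) := by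
        refine Continuous.tendsto ?_ (t, x)
        fun_prop
      simpa using this
  simpa using h2.add h1

end Propagator

end Propagator

/-! ### Inhomogeneous terms -/

section Forcing

variable {E : Type*} [NormedAddCommGroup E] [InnerProductSpace ℝ E] [FiniteDimensional ℝ E]
  [MeasurableSpace E] [BorelSpace E]

/-- The primitive over `[t, t + h]` of an integrand of size `O(h)` times a locally integrable
function has vanishing derivative at `h = 0`. -/
lemma hasDerivAt_integral_zero {f₀ : ℝ → ℝ} (hf : ∀ a b, IntervalIntegrable f₀ volume a b)
    {e : ℝ → ℝ → ℂ} {C t : ℝ}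
    (he : ∀ᶠ h in 𝓝 (0 : ℝ), ∀ᵐ σ ∂volume.restrict (Set.uIoc t (t + h)),
      ‖e h σ‖ ≤ C * |h| * f₀ σ) :
    HasDerivAt (fun h => ∫ σ in t..t + h, e h σ) 0 0 := by
  rw [hasDerivAt_iff_isLittleO_nhds_zero]
  have hI : Tendsto (fun h => |C| * |∫ σ in t..t + h, f₀ σ|) (𝓝 0) (𝓝 0) := by
    have h1 : Continuous fun h => |C| * |∫ σ in t..t + h, f₀ σ| :=
      continuous_const.mul
        ((intervalIntegral.continuous_primitive hf t).comp (continuous_const.add continuous_id)).abs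
    simpa using h1.tendsto 0
  rw [Asymptotics.isLittleO_iff]
  intro c hc
  filter_upwards [he, hI.eventually (gt_mem_nhds hc)] with h h1 h2
  simp only [zero_add, add_zero, intervalIntegral.integral_same, sub_zero, smul_zero]
  calc ‖∫ σ in t..t + h, e h σ‖ ≤ |∫ σ in t..t + h, C * |h| * f₀ σ| :=
        intervalIntegral.norm_integral_le_abs_of_norm_le h1 ((hf _ _).const_mul _)
    _ = |C| * |∫ σ in t..t + h, f₀ σ| * |h| := by
        rw [intervalIntegral.integral_const_mul, abs_mul, abs_mul, abs_abs]; ring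
    _ ≤ c * ‖h‖ := by rw [Real.norm_eq_abs]; gcongr

/-- A measurable function of space and time that is locally integrable in time with values in
`L^s`. -/
structure IsForcing (s : ℝ) (F : ℝ → E → ℂ) : Prop where
  meas : AEStronglyMeasurable (Function.uncurry F) (volume.prod volume)
  loc : ∀ a b, ∫⁻ t in Set.Icc a b, eLpNorm (F t) (ENNReal.ofReal s) volume ≠ ∞

lemma aemeasurable_eLpNorm_slice {s : ℝ} (hs : 0 < s) {F : ℝ → E → ℂ}
    (hF : AEStronglyMeasurable (Function.uncurry F) (volume.prod volume)) :
    AEMeasurable fun t => eLpNorm (F t) (ENNReal.ofReal s) volume := by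
  have : (fun t => eLpNorm (F t) (ENNReal.ofReal s) volume) =
      fun t => (∫⁻ x, ‖F t x‖ₑ ^ s) ^ (1 / s) := by
    ext t
    rw [eLpNorm_eq_lintegral_rpow_enorm_toReal (by simpa using hs) (by simp),
      ENNReal.toReal_ofReal hs.le]
  rw [this]
  exact ((hF.enorm.pow_const s).lintegral_prod_right').pow_const _

namespace IsForcing

variable {s : ℝ} {F : ℝ → E → ℂ} (hF : IsForcing s F)
include hF

lemma intervalIntegrable (hs : 0 < s) (a b : ℝ) :
    IntervalIntegrable (fun t => (eLpNorm (F t) (ENNReal.ofReal s) volume).toReal) volume a b := by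
  rw [intervalIntegrable_iff]
  exact (integrable_toReal_of_lintegral_ne_top (aemeasurable_eLpNorm_slice hs hF.meas).restrict
    (hF.loc (min a b) (max a b))).mono_measure
      (Measure.restrict_mono (Set.uIoc_subset_uIcc) le_rfl)

lemma ae_memLp (hs : 0 < s) : ∀ᵐ t, MemLp (F t) (ENNReal.ofReal s) volume := by
  have h1 : ∀ᵐ t, ∀ n : ℕ, t ∈ Set.Icc (-n : ℝ) n → eLpNorm (F t) (ENNReal.ofReal s) volume < ∞ := by
    rw [ae_all_iff]
    intro n
    rw [← ae_restrict_iff' measurableSet_Icc]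
    exact ae_lt_top' (aemeasurable_eLpNorm_slice hs hF.meas).restrict (hF.loc _ _)
  filter_upwards [h1, hF.meas.prodMk_left] with t h2 h3
  obtain ⟨n, hn⟩ := exists_nat_ge |t|
  exact ⟨h3, h2 n (abs_le.1 hn)⟩

end IsForcing

lemma integrable_mul_schwartz {r s : ℝ} (hrs : r.HolderConjugate s) {f : E → ℂ}
    (hf : MemLp f (ENNReal.ofReal s) volume) (χ : 𝓢(E, ℂ)) :
    Integrable (fun x => f x * χ x) volume := by
  refine ⟨hf.1.mul χ.continuous.aestronglyMeasurable, ?_⟩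
  refine (lintegral_enorm_mul_le hrs.symm hf.1 χ.continuous.aestronglyMeasurable).trans_lt ?_
  exact ENNReal.mul_lt_top hf.2 (χ.memLp _ volume).2

lemma integral_mul_schwartz_sub {r s : ℝ} (hrs : r.HolderConjugate s) {f : E → ℂ}
    (hf : MemLp f (ENNReal.ofReal s) volume) (χ η : 𝓢(E, ℂ)) :
    ∫ x, f x * (χ - η) x = (∫ x, f x * χ x) - ∫ x, f x * η x := by
  rw [← integral_sub (integrable_mul_schwartz hrs hf χ) (integrable_mul_schwartz hrs hf η)]
  simp [mul_sub]

lemma norm_integral_mul_schwartz_le {r s : ℝ} (hrs : r.HolderConjugate s) {f : E → ℂ}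
    (hf : MemLp f (ENNReal.ofReal s) volume) {χ : 𝓢(E, ℂ)} {C : ℝ} (hC : 0 ≤ C)
    (hχ : eLpNorm χ (ENNReal.ofReal r) volume ≤ ENNReal.ofReal C) :
    ‖∫ x, f x * χ x‖ ≤ C * (eLpNorm f (ENNReal.ofReal s) volume).toReal := by
  have h1 := enorm_integral_mul_le hrs.symm hf.1 χ.continuous.aestronglyMeasurable (μ := volume)
  rw [← ofReal_norm] at h1
  have h2 := h1.trans (mul_le_mul' le_rfl hχ)
  rw [← ENNReal.ofReal_toReal hf.2.ne, ← ENNReal.ofReal_mul (by positivity)] at h2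
  rw [mul_comm]
  exact (ENNReal.ofReal_le_ofReal_iff (by positivity)).1 h2

lemma intervalIntegrable_integral_mul {r s : ℝ} (hrs : r.HolderConjugate s)
    {F : ℝ → E → ℂ} (hF : IsForcing s F) (ψ : 𝓢(E, ℂ)) (a b : ℝ) :
    IntervalIntegrable (fun t => ∫ x, F t x * ψ x) volume a b := by
  have h1 : Continuous fun z : ℝ × E => ψ z.2 := ψ.continuous.comp continuous_snd
  have hm : AEStronglyMeasurable (fun t => ∫ x, F t x * ψ x) volume :=
    (hF.meas.mul h1.aestronglyMeasurable).integral_prod_right'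
  have hC : eLpNorm ψ (ENNReal.ofReal r) volume ≠ ∞ := (ψ.memLp _ volume).2.ne
  refine ((hF.intervalIntegrable hrs.symm.pos a b).const_mul
    (eLpNorm ψ (ENNReal.ofReal r) volume).toReal).mono_fun hm.restrict ?_
  filter_upwards [ae_restrict_of_ae (hF.ae_memLp hrs.symm.pos)] with t ht
  refine (norm_integral_mul_schwartz_le hrs ht ENNReal.toReal_nonneg ?_).trans (le_abs_self _)
  rw [ENNReal.ofReal_toReal hC]

lemma continuous_integral_mul_schwartz {u : ℝ → L2 E} (hu : Continuous u) (ψ : 𝓢(E, ℂ)) :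
    Continuous fun t => ∫ x, u t x * ψ x := by
  simp only [← inner_conjL2_toLp]
  exact (conjL2.continuous.comp hu).inner continuous_const

namespace Propagator

variable {β : ℝ} {L : 𝓢(E, ℂ) → 𝓢(E, ℂ)} (P : Propagator E β L)
include P

lemma aestronglyMeasurable_integral_mul_G {s : ℝ} {F : ℝ → E → ℂ} (hF : IsForcing s F)
    (ψ : 𝓢(E, ℂ)) (c : ℝ) :
    AEStronglyMeasurable (fun t => ∫ x, F t x * P.G (t - c) ψ x) volume := by
  have h1 : Continuous fun z : ℝ × E => P.G (z.1 - c) ψ z.2 :=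
    (P.continuous_uncurry_G ψ).comp ((continuous_fst.sub continuous_const).prodMk continuous_snd)
  exact (hF.meas.mul h1.aestronglyMeasurable).integral_prod_right'

lemma intervalIntegrable_integral_mul_G {r s : ℝ} (hrs : r.HolderConjugate s) (hr : 2 ≤ r)
    {F : ℝ → E → ℂ} (hF : IsForcing s F) (ψ : 𝓢(E, ℂ)) (c a b : ℝ) :
    IntervalIntegrable (fun t => ∫ x, F t x * P.G (t - c) ψ x) volume a b := by
  obtain ⟨C, hC, h⟩ := P.exists_eLpNorm_G_le hr ψ (min a b - c) (max a b - c)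
  refine ((hF.intervalIntegrable hrs.symm.pos a b).const_mul C.toReal).mono_fun
    (P.aestronglyMeasurable_integral_mul_G hF ψ c).restrict ?_
  filter_upwards [ae_restrict_of_ae (hF.ae_memLp hrs.symm.pos),
    ae_restrict_mem measurableSet_uIoc] with t ht hI
  refine (norm_integral_mul_schwartz_le hrs ht (C := C.toReal) ENNReal.toReal_nonneg ?_).trans
    (le_abs_self _)
  rw [ENNReal.ofReal_toReal hC]
  have := Set.uIoc_subset_uIcc hI
  rw [Set.uIcc, Set.mem_Icc] at this
  exact h _ ⟨by linarith [this.1], by linarith [this.2]⟩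

/-- Duhamel's formula, tested against Schwartz functions. -/
theorem integral_mul_eq_of_weak_eq {r s : ℝ} (hrs : r.HolderConjugate s) (hr : 2 ≤ r)
    {F : ℝ → E → ℂ} (hF : IsForcing s F) {u : ℝ → L2 E} (hu : Continuous u) {φ : L2 E}
    (hw : ∀ (ψ : 𝓢(E, ℂ)) (t : ℝ), ∫ x, u t x * ψ x = (∫ x, φ x * ψ x) +
      ∫ σ in (0 : ℝ)..t, ((∫ x, u σ x * L ψ x) + ∫ x, F σ x * ψ x)) (T : ℝ) (ψ : 𝓢(E, ℂ)) :
    ∫ x, u T x * ψ x = (∫ x, φ x * P.G (-T) ψ x) +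
      ∫ σ in (0 : ℝ)..T, ∫ x, F σ x * P.G (σ - T) ψ x := by
  have hs0 := hrs.symm.pos
  have hint : ∀ c a b, IntervalIntegrable (fun σ => ∫ x, F σ x * P.G (σ - c) ψ x) volume a b :=
    fun c a b => P.intervalIntegrable_integral_mul_G hrs hr hF ψ c a b
  set R : ℝ → ℂ := fun t => (∫ x, u t x * P.G (t - T) ψ x) -
    ∫ σ in (0 : ℝ)..t, ∫ x, F σ x * P.G (σ - T) ψ x with hR
  have hder : ∀ t, HasDerivAt R 0 t := by
    intro t
    set χ := P.G (t - T) ψ with hχ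
    have hGχ : ∀ h, P.G (t + h - T) ψ = P.G h χ := fun h => by
      rw [hχ, ← P.G_add]; congr 2; ring
    have hA : HasDerivAt (fun h => inner ℂ (conjL2 (u (t + h)))
        ((P.G h χ).toLp 2 volume - χ.toLp 2 volume)) (-∫ x, u t x * L χ x) 0 := by
      rw [hasDerivAt_iff_tendsto_slope_zero]
      have h1 : Tendsto (fun h => conjL2 (u (t + h))) (𝓝[≠] 0) (𝓝 (conjL2 (u t))) := by
        have : Continuous fun h => conjL2 (u (t + h)) :=
          conjL2.continuous.comp (hu.comp (continuous_const.add continuous_id))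
        have := this.tendsto 0
        rw [add_zero] at this
        exact this.mono_left nhdsWithin_le_nhds
      have h2 := h1.inner (𝕜 := ℂ) (P.tendsto_slope χ)
      rw [inner_neg_right, inner_conjL2_toLp] at h2
      refine h2.congr fun h => ?_
      rw [zero_add, P.G_zero, sub_self, inner_zero_right, sub_zero]
      exact inner_smul_right_eq_smul _ _ _
    have hB : HasDerivAt (fun h => ∫ σ in t..t + h, ∫ x, u σ x * L χ x) (∫ x, u t x * L χ x) 0 := by
      have h1 : HasDerivAt (fun y => ∫ σ in t..y, ∫ x, u σ x * L χ x) (∫ x, u t x * L χ x) (t + 0) := by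
        rw [add_zero]
        exact ((continuous_integral_mul_schwartz hu (L χ)).integral_hasStrictDerivAt t t).hasDerivAt
      exact h1.comp_const_add t 0
    obtain ⟨C, hC0, hC⟩ := P.eventually_eLpNorm_sub_le hr χ
    have hD : HasDerivAt (fun h => ∫ σ in t..t + h, ∫ x, F σ x * (P.G (σ - T) ψ - χ) x) 0 0 := by
      refine hasDerivAt_integral_zero (hF.intervalIntegrable hs0) (C := C)
        (e := fun _ σ => ∫ x, F σ x * (P.G (σ - T) ψ - χ) x) ?_
      obtain ⟨ε, hε, hb⟩ := Metric.eventually_nhds_iff.1 hC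
      filter_upwards [Metric.ball_mem_nhds (0 : ℝ) hε] with h hh
      filter_upwards [ae_restrict_of_ae (hF.ae_memLp hs0), ae_restrict_mem measurableSet_uIoc]
        with σ h1 h2
      have h3 : |σ - t| ≤ |h| := by
        have := Set.abs_sub_left_of_mem_uIcc (Set.uIoc_subset_uIcc h2)
        simpa using this
      have h4 := @hb (σ - t) (by
        rw [Real.dist_0_eq_abs]
        rw [mem_ball_zero_iff, Real.norm_eq_abs] at hh
        linarith)
      rw [← hGχ, show t + (σ - t) - T = σ - T by ring] at h4
      refine norm_integral_mul_schwartz_le hrs h1 (by positivity) (h4.trans ?_)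
      exact ENNReal.ofReal_le_ofReal (by gcongr)
    have hsum := (hA.add hB).sub hD
    have hsum' : HasDerivAt (fun h => R (t + h)) 0 0 := by
      have h0 := hsum.add_const (R t)
      simp only [neg_add_cancel, sub_zero] at h0
      refine h0.congr_of_eventuallyEq (.of_forall fun h => ?_)
      have e1 : ∫ x, u (t + h) x * χ x - u t x * χ x = (∫ x, u (t + h) x * χ x) - ∫ x, u t x * χ x := by
        refine integral_sub ?_ ?_
        · exact integrable_mul_of_memLp_two (Lp.memLp _) (χ.memLp 2 volume)
        · exact integrable_mul_of_memLp_two (Lp.memLp _) (χ.memLp 2 volume)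
      have e2 : (∫ x, u (t + h) x * χ x) - ∫ x, u t x * χ x =
          (∫ σ in t..t + h, ∫ x, u σ x * L χ x) + ∫ σ in t..t + h, ∫ x, F σ x * χ x := by
        have i1 : ∀ a b, IntervalIntegrable (fun σ => ∫ x, u σ x * L χ x) volume a b := fun a b =>
          (continuous_integral_mul_schwartz hu (L χ)).intervalIntegrable a b
        have i2 := intervalIntegrable_integral_mul hrs hF χ
        rw [hw χ (t + h), hw χ t, ← intervalIntegral.integral_add (i1 _ _) (i2 _ _),
          ← intervalIntegral.integral_add_adjacent_intervals
            ((i1 0 t).add (i2 0 t)) ((i1 t (t + h)).add (i2 t (t + h)))]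
        ring
      have e3 : ∫ σ in t..t + h, ∫ x, F σ x * (P.G (σ - T) ψ - χ) x =
          (∫ σ in t..t + h, ∫ x, F σ x * P.G (σ - T) ψ x) - ∫ σ in t..t + h, ∫ x, F σ x * χ x := by
        rw [← intervalIntegral.integral_sub (hint T _ _)
          (intervalIntegrable_integral_mul hrs hF χ _ _)]
        refine intervalIntegral.integral_congr_ae ?_
        filter_upwards [hF.ae_memLp hs0] with σ h1 _
        exact integral_mul_schwartz_sub hrs h1 _ _
      have e4 := intervalIntegral.integral_add_adjacent_intervals (hint T 0 t) (hint T t (t + h))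
      simp only [hR, Pi.add_apply, Pi.sub_apply, inner_sub_right, inner_conjL2_toLp, hGχ, e3]
      rw [← e4, ← hχ]
      linear_combination e2
    have h5 : HasDerivAt (fun y => R (t + (y - t))) 0 t := by
      have h6 : HasDerivAt (fun h => R (t + h)) 0 (t - t) := by rw [sub_self]; exact hsum'
      simpa using h6.comp_sub_const t t
    simpa using h5
  have hconst : R T = R 0 :=
    is_const_of_deriv_eq_zero (fun t => (hder t).differentiableAt) (fun t => (hder t).deriv) T 0
  have hu0 : ∫ x, u 0 x * P.G (-T) ψ x = ∫ x, φ x * P.G (-T) ψ x := by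
    have := hw (P.G (-T) ψ) 0
    simpa using this
  simp only [hR, sub_self, P.G_zero, zero_sub, intervalIntegral.integral_same, sub_zero] at hconst
  rw [← hu0, ← hconst]; ring

end Propagator

end Forcing

/-! ### The abstract Strichartz estimate -/

section Strichartz

variable {E : Type*} [NormedAddCommGroup E] [InnerProductSpace ℝ E] [FiniteDimensional ℝ E]
  [MeasurableSpace E] [BorelSpace E]

/-- The norm of `L^{a'} ∩ L^{b'}` on the line. -/
noncomputable def dualNorm (a b : ℝ) (g : ℝ → ℝ≥0∞) : ℝ≥0∞ :=
  DegenerateSchrodinger.interNorm (ENNReal.ofReal a.conjExponent) (ENNReal.ofReal b.conjExponent) g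

/-- The weighted `L^s` norm of an inhomogeneous term at time `t`. -/
noncomputable def weightedSlice (β s : ℝ) (F : ℝ → E → ℂ) (t : ℝ) : ℝ≥0∞ :=
  ENNReal.ofReal (Real.exp (β * t)) * eLpNorm (F t) (ENNReal.ofReal s) volume

lemma eLpNorm_eq_ofReal_exp_mul_weightedSlice (β s : ℝ) (F : ℝ → E → ℂ) (t : ℝ) :
    eLpNorm (F t) (ENNReal.ofReal s) volume =
      ENNReal.ofReal (Real.exp (-(β * t))) * weightedSlice β s F t := by
  rw [weightedSlice, ← mul_assoc, ← ENNReal.ofReal_mul (Real.exp_nonneg _), ← Real.exp_add]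
  simp

lemma aemeasurable_weightedSlice (β : ℝ) {s : ℝ} (hs : 0 < s) {F : ℝ → E → ℂ}
    (hF : AEStronglyMeasurable (Function.uncurry F) (volume.prod volume)) :
    AEMeasurable (weightedSlice β s F) := by
  have : Continuous fun t : ℝ => ENNReal.ofReal (Real.exp (β * t)) :=
    ENNReal.continuous_ofReal.comp (by fun_prop)
  exact this.measurable.aemeasurable.mul (aemeasurable_eLpNorm_slice hs hF)

lemma lintegral_rpow_ne_top_of_dualNorm {a b : ℝ} (ha : 1 < a) {w : ℝ → ℝ≥0∞}
    (hw : dualNorm a b w ≠ ∞) : ∫⁻ t, w t ^ a.conjExponent ≠ ∞ := by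
  have hpos : 0 < a.conjExponent := (Real.HolderConjugate.conjExponent ha).symm.pos
  have h1 : eLpNorm w (ENNReal.ofReal a.conjExponent) volume ≠ ∞ :=
    ne_top_of_le_ne_top hw (le_max_left _ _)
  rw [eLpNorm_ofReal_eq hpos] at h1
  intro h
  rw [h, ENNReal.top_rpow_of_pos (by positivity)] at h1
  exact h1 rfl

lemma isForcing_of_dualNorm {a b β s : ℝ} (ha : 1 < a) {F : ℝ → E → ℂ}
    (hF : AEStronglyMeasurable (Function.uncurry F) (volume.prod volume))
    (hw : dualNorm a b (weightedSlice β s F) ≠ ∞) : IsForcing s F := by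
  refine ⟨hF, fun c d => ?_⟩
  have h1 := lintegral_rpow_ne_top_of_dualNorm ha hw
  have hp1 : 1 < a.conjExponent := (Real.HolderConjugate.conjExponent ha).symm.lt
  obtain ⟨M, hM⟩ := isCompact_Icc.exists_bound_of_continuousOn
    (s := Set.Icc c d) (f := fun t => Real.exp (-(β * t)))
    (Continuous.continuousOn (by fun_prop))
  refine ne_top_of_le_ne_top (b := ∫⁻ t in Set.Icc c d, ENNReal.ofReal M *
    (1 + weightedSlice β s F t ^ a.conjExponent)) ?_ ?_
  · rw [lintegral_const_mul' _ _ (by simp), lintegral_add_left measurable_const]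
    refine ENNReal.mul_ne_top (by simp) (ENNReal.add_ne_top.2 ⟨by simp, ?_⟩)
    exact ne_top_of_le_ne_top h1 (setLIntegral_le_lintegral _ _)
  · refine setLIntegral_mono' measurableSet_Icc fun t ht => ?_
    rw [eLpNorm_eq_ofReal_exp_mul_weightedSlice β]
    refine mul_le_mul' (ENNReal.ofReal_le_ofReal ((le_abs_self _).trans (hM t ht))) ?_
    rcases le_total (weightedSlice β s F t) 1 with h | h
    · exact h.trans le_self_add
    · calc weightedSlice β s F t = weightedSlice β s F t ^ (1 : ℝ) := (ENNReal.rpow_one _).symm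
        _ ≤ _ := (ENNReal.rpow_le_rpow_of_exponent_le h hp1.le).trans le_add_self

namespace Propagator

variable {β : ℝ} {L : 𝓢(E, ℂ) → 𝓢(E, ℂ)}

/-- The dispersive estimate, with a kernel satisfying a bilinear estimate of
Hardy–Littlewood–Sobolev type. -/
structure IsDispersive (P : Propagator E β L) (r s a b : ℝ) (K : ℝ → ℝ≥0∞) (A : ℝ≥0∞) : Prop where
  conj : r.HolderConjugate s
  two_lt : 2 < r
  two_lt_left : 2 < a
  lt : a < b
  even : ∀ t, K (-t) = K t
  ne_top : A ≠ ∞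
  bilinear : ∀ f g : ℝ → ℝ≥0∞, AEMeasurable f → AEMeasurable g →
    ∫⁻ x, ∫⁻ y, f x * g y * K (x - y) ≤ A * (dualNorm a b f * dualNorm a b g)
  disp : ∀ (t : ℝ), t ≠ 0 → ∀ (ψ χ : 𝓢(E, ℂ)),
    ‖inner ℂ (χ.toLp 2 volume) (P.U t (ψ.toLp 2 volume))‖ₑ ≤
      K t * (eLpNorm ψ (ENNReal.ofReal s) volume * eLpNorm χ (ENNReal.ofReal s) volume)

namespace IsDispersive

variable {P : Propagator E β L} {r s a b : ℝ} {K : ℝ → ℝ≥0∞} {A : ℝ≥0∞}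
  (hP : P.IsDispersive r s a b K A)
include hP

lemma eLpNorm_U_le {t : ℝ} (ht : t ≠ 0) (ψ : 𝓢(E, ℂ)) :
    eLpNorm (P.U t (ψ.toLp 2 volume)) (ENNReal.ofReal r) volume ≤
      K t * eLpNorm ψ (ENNReal.ofReal s) volume := by
  rw [← eLpNorm_conjL2]
  refine eLpNorm_le_of_forall_schwartz hP.conj hP.two_lt.le (Lp.memLp _) fun χ => ?_
  rw [← inner_toLp_eq_integral, ← ofReal_norm, norm_inner_symm, ofReal_norm, mul_assoc]
  exact hP.disp t ht ψ χ

lemma eLpNorm_G_le {t : ℝ} (ht : t ≠ 0) (ψ : 𝓢(E, ℂ)) :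
    eLpNorm (P.G t ψ) (ENNReal.ofReal r) volume ≤
      ENNReal.ofReal (Real.exp (β * t)) * (K t * eLpNorm ψ (ENNReal.ofReal s) volume) := by
  rw [← eLpNorm_congr_ae ((P.G t ψ).coeFn_toLp 2 volume), P.toLp_G,
    eLpNorm_congr_ae (Lp.coeFn_smul _ _), eLpNorm_const_smul]
  refine mul_le_mul' (le_of_eq ?_) (hP.eLpNorm_U_le ht ψ)
  rw [← ofReal_norm, Complex.norm_real, Real.norm_eq_abs, abs_of_pos (Real.exp_pos _)]

/-- The homogeneous estimate, in dual form. -/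
lemma lintegral_iSup_inner_le {ψ : ℕ → 𝓢(E, ℂ)}
    (hψ : ∀ k, eLpNorm (ψ k) (ENNReal.ofReal s) volume ≤ 1) (w : L2 E)
    {g : ℝ → ℝ≥0∞} (hg : AEMeasurable g) :
    ∫⁻ t, g t * ⨆ k, ‖inner ℂ (P.U (-t) ((ψ k).toLp 2 volume)) w‖ₑ ≤
      ‖w‖ₑ * A ^ (1 / 2 : ℝ) * dualNorm a b g := by
  have hcongr : dualNorm a b (hg.mk g) = dualNorm a b g := by
    rw [dualNorm, dualNorm, DegenerateSchrodinger.interNorm, DegenerateSchrodinger.interNorm,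
      eLpNorm_congr_ae hg.ae_eq_mk, eLpNorm_congr_ae hg.ae_eq_mk]
  rw [← hcongr]
  have e1 : ∫⁻ t, g t * ⨆ k, ‖inner ℂ (P.U (-t) ((ψ k).toLp 2 volume)) w‖ₑ =
      ∫⁻ t, hg.mk g t * ⨆ k, ‖inner ℂ (P.U (-t) ((ψ k).toLp 2 volume)) w‖ₑ := by
    refine lintegral_congr_ae ?_
    filter_upwards [hg.ae_eq_mk] with t ht
    rw [ht]
  rw [e1]
  have h1 := sq_lintegral_iSup_inner_le P.U_add P.continuous_U (ψ := fun k => (ψ k).toLp 2 volume)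
    (K := K) (fun k l t ht => (hP.disp t ht (ψ l) (ψ k)).trans (by
      calc K t * _ ≤ K t * (1 * 1) := mul_le_mul' le_rfl (mul_le_mul' (hψ l) (hψ k))
        _ = K t := by rw [mul_one, mul_one])) w hg.measurable_mk
  have h2 := h1.trans (mul_le_mul' le_rfl
    (hP.bilinear _ _ hg.measurable_mk.aemeasurable hg.measurable_mk.aemeasurable))
  have h3 : ‖w‖ₑ ^ 2 * (A * (dualNorm a b (hg.mk g) * dualNorm a b (hg.mk g))) =
      (‖w‖ₑ * A ^ (1 / 2 : ℝ) * dualNorm a b (hg.mk g)) ^ 2 := by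
    have : A = (A ^ (1 / 2 : ℝ)) ^ 2 := by
      rw [← ENNReal.rpow_natCast, ← ENNReal.rpow_mul]; norm_num
    conv_lhs => rw [this]
    ring
  rw [h3] at h2
  exact (ENNReal.pow_le_pow_left_iff two_ne_zero).1 h2

/-- The Strichartz estimate for weak solutions. -/
theorem sumNorm_le {F : ℝ → E → ℂ}
    (hF : AEStronglyMeasurable (Function.uncurry F) (volume.prod volume))
    (hN : dualNorm a b (weightedSlice β s F) ≠ ∞) {u : ℝ → L2 E} (hu : Continuous u) {φ : L2 E}
    (hw : ∀ (ψ : 𝓢(E, ℂ)) (t : ℝ), ∫ x, u t x * ψ x = (∫ x, φ x * ψ x) +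
      ∫ σ in (0 : ℝ)..t, ((∫ x, u σ x * L ψ x) + ∫ x, F σ x * ψ x)) :
    DegenerateSchrodinger.sumNorm (ENNReal.ofReal a) (ENNReal.ofReal b)
        (weightedSlice β r fun t x => u t x) ≤
      2 * (‖φ‖ₑ * A ^ (1 / 2 : ℝ) + A * dualNorm a b (weightedSlice β s F)) := by
  have ha : 1 < a := by linarith [hP.two_lt_left]
  have hs0 := hP.conj.symm.pos
  have hfor := isForcing_of_dualNorm ha hF hN
  have hwm := aemeasurable_weightedSlice β hs0 hF
  obtain ⟨ψ, hψ, hsup⟩ := exists_seq_schwartz_eLpNorm_eq_iSup (E := E) hP.conj hP.two_lt.le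
  have hH : weightedSlice β r (fun t x => u t x) =
      fun t => ENNReal.ofReal (Real.exp (β * t)) * ⨆ k, ‖∫ x, u t x * ψ k x‖ₑ := by
    ext t
    rw [weightedSlice, ← hsup _ (Lp.memLp (u t))]
  have hHm : Measurable (weightedSlice β r fun t x => u t x) := by
    rw [hH]
    have : Continuous fun t : ℝ => ENNReal.ofReal (Real.exp (β * t)) :=
      ENNReal.continuous_ofReal.comp (by fun_prop)
    exact this.measurable.mul (Measurable.iSup fun k =>
      (continuous_integral_mul_schwartz hu (ψ k)).measurable.enorm)
  have hpt : ∀ t, weightedSlice β r (fun t x => u t x) t ≤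
      (⨆ k, ‖inner ℂ (P.U (-t) ((ψ k).toLp 2 volume)) (conjL2 φ)‖ₑ) +
        ∫⁻ σ, weightedSlice β s F σ * K (t - σ) := by
    intro t
    rw [hH]
    dsimp only
    rw [ENNReal.mul_iSup]
    refine iSup_le fun k => ?_
    rw [P.integral_mul_eq_of_weak_eq hP.conj hP.two_lt.le hfor hu hw t (ψ k)]
    refine (mul_le_mul' le_rfl (enorm_add_le _ _)).trans ?_
    rw [mul_add]
    refine add_le_add ?_ ?_
    · refine le_trans (le_of_eq ?_)
        (le_iSup (fun k => ‖inner ℂ (P.U (-t) ((ψ k).toLp 2 volume)) (conjL2 φ)‖ₑ) k)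
      rw [← inner_conjL2_toLp, P.toLp_G, inner_smul_right, enorm_mul, ← mul_assoc,
        ← ofReal_norm (inner ℂ (P.U _ _) _), norm_inner_symm, ofReal_norm]
      rw [← ofReal_norm (((Real.exp (β * -t) : ℝ) : ℂ)), Complex.norm_real, Real.norm_eq_abs,
        abs_of_pos (Real.exp_pos _), ← ENNReal.ofReal_mul (Real.exp_nonneg _), ← Real.exp_add]
      simp
    · have h1 : ‖∫ σ in (0 : ℝ)..t, ∫ x, F σ x * P.G (σ - t) (ψ k) x‖ₑ ≤
          ∫⁻ σ, ‖∫ x, F σ x * P.G (σ - t) (ψ k) x‖ₑ := by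
        rw [← ofReal_norm, intervalIntegral.norm_intervalIntegral_eq, ofReal_norm]
        exact (enorm_integral_le_lintegral_enorm _).trans (setLIntegral_le_lintegral _ _)
      refine (mul_le_mul' le_rfl h1).trans ?_
      rw [← lintegral_const_mul' _ _ (by simp)]
      refine lintegral_mono_ae ?_
      filter_upwards [hfor.ae_memLp hs0, Measure.ae_ne volume t] with σ h2 h3
      have h4 := enorm_integral_mul_le hP.conj.symm h2.1
        (P.G (σ - t) (ψ k)).continuous.aestronglyMeasurable (μ := volume)
      have h5 := hP.eLpNorm_G_le (sub_ne_zero.2 h3) (ψ k)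
      calc _ ≤ ENNReal.ofReal (Real.exp (β * t)) * (eLpNorm (F σ) (ENNReal.ofReal s) volume *
            (ENNReal.ofReal (Real.exp (β * (σ - t))) * (K (σ - t) * 1))) := by
            refine mul_le_mul' le_rfl (h4.trans (mul_le_mul' le_rfl (h5.trans ?_)))
            exact mul_le_mul' le_rfl (mul_le_mul' le_rfl (hψ k))
        _ = (ENNReal.ofReal (Real.exp (β * t)) * ENNReal.ofReal (Real.exp (β * (σ - t)))) *
            eLpNorm (F σ) (ENNReal.ofReal s) volume * K (t - σ) := by
            rw [mul_one, show σ - t = -(t - σ) by ring, hP.even]; ring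
        _ = _ := by
            rw [weightedSlice, ← ENNReal.ofReal_mul (Real.exp_nonneg _), ← Real.exp_add]
            ring_nf
  refine sumNorm_le_of_pairing ha hP.lt hHm.aemeasurable fun g hg => ?_
  calc ∫⁻ t, g t * weightedSlice β r (fun t x => u t x) t
      ≤ ∫⁻ t, (g t * (⨆ k, ‖inner ℂ (P.U (-t) ((ψ k).toLp 2 volume)) (conjL2 φ)‖ₑ) +
          g t * ∫⁻ σ, weightedSlice β s F σ * K (t - σ)) := by
        refine lintegral_mono fun t => ?_
        rw [← mul_add]
        exact mul_le_mul' le_rfl (hpt t)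
    _ = (∫⁻ t, g t * (⨆ k, ‖inner ℂ (P.U (-t) ((ψ k).toLp 2 volume)) (conjL2 φ)‖ₑ)) +
          ∫⁻ t, g t * ∫⁻ σ, weightedSlice β s F σ * K (t - σ) := by
        refine lintegral_add_left (hg.mul (Measurable.iSup fun k => ?_)) _
        exact (((P.continuous_U _).comp continuous_neg).inner continuous_const).measurable.enorm
    _ ≤ ‖conjL2 φ‖ₑ * A ^ (1 / 2 : ℝ) * dualNorm a b g +
          A * (dualNorm a b g * dualNorm a b (weightedSlice β s F)) := by
        refine add_le_add (hP.lintegral_iSup_inner_le hψ _ hg.aemeasurable) ?_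
        refine le_trans (lintegral_mono fun t => ?_) (hP.bilinear g _ hg.aemeasurable hwm)
        refine (lintegral_const_mul_le _ _).trans (le_of_eq ?_)
        exact lintegral_congr fun σ => (mul_assoc _ _ _).symm
    _ = _ := by
        rw [← ofReal_norm, norm_conjL2, ofReal_norm]
        simp only [dualNorm]
        ring

end IsDispersive

end Propagator

end Strichartz

/-! ### Existence of weak solutions -/

section Existence

variable {E : Type*} [NormedAddCommGroup E] [InnerProductSpace ℝ E] [FiniteDimensional ℝ E]
  [MeasurableSpace E] [BorelSpace E]

lemma denseRange_schwartz_toLp : DenseRange fun ψ : 𝓢(E, ℂ) => ψ.toLp 2 (volume : Measure E) := by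
  have := SchwartzMap.denseRange_toLpCLM (p := 2) (μ := (volume : Measure E)) (F := ℂ)
    ENNReal.ofNat_ne_top
  exact this

lemma norm_le_of_forall_schwartz {v : L2 E} {M : ℝ} (hM : 0 ≤ M)
    (h : ∀ ψ : 𝓢(E, ℂ), ‖inner ℂ v (ψ.toLp 2 volume)‖ ≤ M * ‖ψ.toLp 2 (volume : Measure E)‖) :
    ‖v‖ ≤ M := by
  have h1 : ∀ w : L2 E, ‖inner ℂ v w‖ ≤ M * ‖w‖ := fun w => by
    refine denseRange_schwartz_toLp.induction_on (p := fun w => ‖inner ℂ v w‖ ≤ M * ‖w‖) w ?_ h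
    exact isClosed_le (continuous_const.inner continuous_id).norm
      (continuous_const.mul continuous_norm)
  rcases eq_or_lt_of_le (norm_nonneg v) with h0 | h0
  · rwa [← h0]
  · have h2 := h1 v
    rw [inner_self_eq_norm_sq_to_K, norm_pow] at h2
    simp only [Complex.coe_algebraMap, Complex.norm_real, norm_norm] at h2
    nlinarith

/-- A functional on Schwartz functions that is bounded in `L^2` is given by an element of `L^2`. -/
lemma exists_inner_eq (ℓ : 𝓢(E, ℂ) →ₗ[ℂ] ℂ) {M : ℝ}
    (h : ∀ ψ, ‖ℓ ψ‖ ≤ M * ‖ψ.toLp 2 (volume : Measure E)‖) :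
    ∃ y : L2 E, ∀ ψ : 𝓢(E, ℂ), inner ℂ y (ψ.toLp 2 volume) = ℓ ψ := by
  set e : 𝓢(E, ℂ) →ₗ[ℂ] L2 E := (SchwartzMap.toLpCLM ℂ ℂ 2 volume).toLinearMap with he
  set T : L2 E →L[ℂ] ℂ := ℓ.extendOfNorm e
  refine ⟨(InnerProductSpace.toDual ℂ (L2 E)).symm T, fun ψ => ?_⟩
  rw [InnerProductSpace.toDual_symm_apply]
  exact LinearMap.extendOfNorm_eq denseRange_schwartz_toLp ⟨M, h⟩ ψ

lemma dualNorm_indicator_ne_top {a b : ℝ} {w : ℝ → ℝ≥0∞} (hN : dualNorm a b w ≠ ∞) (S : Set ℝ) :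
    dualNorm a b (S.indicator w) ≠ ∞ := by
  refine ne_top_of_le_ne_top hN (max_le_max ?_ ?_) <;>
  · refine eLpNorm_mono_enorm fun t => ?_
    simp only [enorm_eq_self]
    exact Set.indicator_le_self _ _ _

lemma tendsto_dualNorm_indicator {a b : ℝ} (ha : 1 < a) (hb : 1 < b) {w : ℝ → ℝ≥0∞}
    (hN : dualNorm a b w ≠ ∞) (t : ℝ) :
    Tendsto (fun τ => dualNorm a b ((Set.uIoc t τ).indicator w)) (𝓝 t) (𝓝 0) := by
  have key : ∀ c : ℝ, 1 < c → eLpNorm w (ENNReal.ofReal c) volume ≠ ∞ →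
      Tendsto (fun τ => eLpNorm ((Set.uIoc t τ).indicator w)
        (ENNReal.ofReal c) volume) (𝓝 t) (𝓝 0) := by
    intro c hc hfin
    have hc0 : 0 < c := by linarith
    rw [eLpNorm_ofReal_eq hc0] at hfin
    have h1 : ∫⁻ t, w t ^ c ≠ ∞ := by
      intro h
      rw [h, ENNReal.top_rpow_of_pos (by positivity)] at hfin
      exact hfin rfl
    have hv : Tendsto (fun τ => volume (Set.uIoc t τ)) (𝓝 t) (𝓝 0) := by
      have h2 : Tendsto (fun τ : ℝ => ENNReal.ofReal |τ - t|) (𝓝 t) (𝓝 (ENNReal.ofReal |t - t|)) :=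
        (ENNReal.continuous_ofReal.comp
          (by fun_prop : Continuous fun τ : ℝ => |τ - t|)).tendsto t
      simpa [Real.volume_uIoc] using h2
    have h3 := tendsto_setLIntegral_zero h1 hv
    have h4 : Tendsto (fun τ => (∫⁻ σ in Set.uIoc t τ, w σ ^ c) ^ (1 / c)) (𝓝 t)
        (𝓝 (0 ^ (1 / c))) :=
      (ENNReal.continuous_rpow_const.tendsto _).comp h3
    rw [ENNReal.zero_rpow_of_pos (by positivity)] at h4
    refine h4.congr fun τ => ?_
    rw [eLpNorm_ofReal_eq hc0, ← lintegral_indicator measurableSet_uIoc]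
    congr 1
    refine lintegral_congr fun σ => ?_
    by_cases hσ : σ ∈ Set.uIoc t τ
    · simp [hσ]
    · simp [hσ, hc0]
  have h1 := key _ (Real.HolderConjugate.conjExponent ha).symm.lt
    (ne_top_of_le_ne_top hN (le_max_left _ _))
  have h2 := key _ (Real.HolderConjugate.conjExponent hb).symm.lt
    (ne_top_of_le_ne_top hN (le_max_right _ _))
  have h3 := h1.max h2
  rw [max_self] at h3
  exact h3

namespace Propagator

variable {β : ℝ} {L : 𝓢(E, ℂ) → 𝓢(E, ℂ)}

namespace IsDispersive

variable {P : Propagator E β L} {r s a b : ℝ} {K : ℝ → ℝ≥0∞} {A : ℝ≥0∞}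
  (hP : P.IsDispersive r s a b K A)
include hP

/-- The dual of the homogeneous estimate. -/
lemma lintegral_integral_mul_G_le {F : ℝ → E → ℂ} (hF : IsForcing s F)
    {S : Set ℝ} (hS : MeasurableSet S) (η : 𝓢(E, ℂ)) :
    ∫⁻ t in S, ‖∫ x, F t x * P.G t η x‖ₑ ≤
      ‖η.toLp 2 (volume : Measure E)‖ₑ * A ^ (1 / 2 : ℝ) *
        dualNorm a b (S.indicator (weightedSlice β s F)) := by
  obtain ⟨ψ, hψ, hsup⟩ := exists_seq_schwartz_eLpNorm_eq_iSup (E := E) hP.conj hP.two_lt.le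
  have hwm := aemeasurable_weightedSlice β hP.conj.symm.pos hF.meas
  refine le_trans ?_ (hP.lintegral_iSup_inner_le hψ (η.toLp 2 volume) (hwm.indicator hS))
  rw [← lintegral_indicator hS]
  refine lintegral_mono_ae ?_
  filter_upwards [hF.ae_memLp hP.conj.symm.pos] with t ht
  by_cases htS : t ∈ S
  · rw [Set.indicator_of_mem htS, Set.indicator_of_mem htS]
    have h1 := enorm_integral_mul_le hP.conj.symm ht.1
      (P.G t η).continuous.aestronglyMeasurable (μ := volume)
    refine h1.trans (le_of_eq ?_)
    rw [← eLpNorm_congr_ae ((P.G t η).coeFn_toLp 2 volume), P.toLp_G,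
      eLpNorm_congr_ae (Lp.coeFn_smul _ _), eLpNorm_const_smul, ← eLpNorm_conjL2,
      hsup _ (Lp.memLp _)]
    rw [← ofReal_norm (((Real.exp (β * t) : ℝ) : ℂ)), Complex.norm_real, Real.norm_eq_abs,
      abs_of_pos (Real.exp_pos _), ← mul_assoc, mul_comm (eLpNorm _ _ _), weightedSlice]
    congr 1
    refine iSup_congr fun k => ?_
    rw [← inner_toLp_eq_integral, ← ofReal_norm, ← ofReal_norm (inner ℂ (P.U _ _) _)]
    have := inner_group_apply P.U_add t 0 (η.toLp 2 volume) ((ψ k).toLp 2 volume)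
    rw [P.U_zero, zero_sub] at this
    rw [this, norm_inner_symm]
  · simp [Set.indicator_of_notMem htS]

variable {F : ℝ → E → ℂ} (hF : IsForcing s F)
  (hN : dualNorm a b (weightedSlice β s F) ≠ ∞)
include hF hN

lemma exists_inner_eq_integral (t : ℝ) : ∃ y : L2 E, ∀ η : 𝓢(E, ℂ),
    inner ℂ y (η.toLp 2 volume) = ∫ σ in (0 : ℝ)..t, ∫ x, F σ x * P.G σ η x := by
  have hint : ∀ η, IntervalIntegrable (fun σ => ∫ x, F σ x * P.G σ η x) volume 0 t := fun η => by
    simpa using P.intervalIntegrable_integral_mul_G hP.conj hP.two_lt.le hF η 0 0 t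
  have hmem := hF.ae_memLp hP.conj.symm.pos
  let ℓ : 𝓢(E, ℂ) →ₗ[ℂ] ℂ :=
    { toFun := fun η => ∫ σ in (0 : ℝ)..t, ∫ x, F σ x * P.G σ η x
      map_add' := fun η χ => by
        rw [← intervalIntegral.integral_add (hint η) (hint χ)]
        refine intervalIntegral.integral_congr_ae ?_
        filter_upwards [hmem] with σ h _
        rw [← integral_add (integrable_mul_schwartz hP.conj h _)
          (integrable_mul_schwartz hP.conj h _)]
        simp [mul_add]
      map_smul' := fun c η => by
        rw [← intervalIntegral.integral_smul]
        refine intervalIntegral.integral_congr fun σ _ => ?_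
        simp only [map_smul, smul_apply, smul_eq_mul, RingHom.id_apply]
        rw [← integral_const_mul]
        congr 1; ext x; ring }
  have hfin : A ^ (1 / 2 : ℝ) *
      dualNorm a b ((Set.uIoc 0 t).indicator (weightedSlice β s F)) ≠ ∞ :=
    ENNReal.mul_ne_top (ENNReal.rpow_ne_top_of_nonneg (by norm_num) hP.ne_top)
      (dualNorm_indicator_ne_top hN _)
  refine exists_inner_eq ℓ (M := (A ^ (1 / 2 : ℝ) *
    dualNorm a b ((Set.uIoc 0 t).indicator (weightedSlice β s F))).toReal) fun η => ?_
  have h1 := hP.lintegral_integral_mul_G_le hF (measurableSet_uIoc (a := 0) (b := t)) η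
  rw [mul_assoc] at h1
  have h2 : ‖ℓ η‖ₑ ≤ _ := le_trans (by
    change ‖∫ σ in (0 : ℝ)..t, ∫ x, F σ x * P.G σ η x‖ₑ ≤ _
    rw [← ofReal_norm, intervalIntegral.norm_intervalIntegral_eq, ofReal_norm]
    exact enorm_integral_le_lintegral_enorm _) h1
  have h3 := ENNReal.toReal_mono (ENNReal.mul_ne_top enorm_ne_top hfin) h2
  rw [ENNReal.toReal_mul, toReal_enorm, toReal_enorm] at h3
  rwa [mul_comm]

/-- Existence of weak solutions. -/
theorem exists_solution (φ : L2 E) : ∃ u : ℝ → L2 E, Continuous u ∧ u 0 = φ ∧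
    ∀ (ψ : 𝓢(E, ℂ)) (t : ℝ), ∫ x, u t x * ψ x = (∫ x, φ x * ψ x) +
      ∫ σ in (0 : ℝ)..t, ((∫ x, u σ x * L ψ x) + ∫ x, F σ x * ψ x) := by
  have hs0 := hP.conj.symm.pos
  choose y hy using hP.exists_inner_eq_integral hF hN
  have hint : ∀ η c a b, IntervalIntegrable (fun σ => ∫ x, F σ x * P.G (σ - c) η x) volume a b :=
    fun η c a b => P.intervalIntegrable_integral_mul_G hP.conj hP.two_lt.le hF η c a b
  have hint0 : ∀ η a b, IntervalIntegrable (fun σ => ∫ x, F σ x * P.G σ η x) volume a b :=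
    fun η a b => by simpa using hint η 0 a b
  have hy0 : y 0 = 0 := by
    rw [← norm_le_zero_iff]
    refine norm_le_of_forall_schwartz le_rfl fun ψ => ?_
    simp [hy]
  have hyc : Continuous y := by
    refine continuous_iff_continuousAt.2 fun t => ?_
    have hfin : ∀ τ, A ^ (1 / 2 : ℝ) *
        dualNorm a b ((Set.uIoc t τ).indicator (weightedSlice β s F)) ≠ ∞ := fun τ =>
      ENNReal.mul_ne_top (ENNReal.rpow_ne_top_of_nonneg (by norm_num) hP.ne_top)
        (dualNorm_indicator_ne_top hN _)
    have hlim : Tendsto (fun τ => (A ^ (1 / 2 : ℝ) *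
        dualNorm a b ((Set.uIoc t τ).indicator (weightedSlice β s F))).toReal) (𝓝 t) (𝓝 0) := by
      have h1 := ENNReal.Tendsto.const_mul (a := A ^ (1 / 2 : ℝ))
        (tendsto_dualNorm_indicator (by linarith [hP.two_lt_left])
          (by linarith [hP.two_lt_left, hP.lt]) hN t)
        (Or.inr (ENNReal.rpow_ne_top_of_nonneg (by norm_num) hP.ne_top))
      rw [mul_zero] at h1
      have h2 := (ENNReal.tendsto_toReal ENNReal.zero_ne_top).comp h1
      rwa [ENNReal.toReal_zero] at h2
    change Tendsto _ _ _
    rw [tendsto_iff_norm_sub_tendsto_zero]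
    refine squeeze_zero (fun _ => norm_nonneg _) (fun τ => ?_) hlim
    refine norm_le_of_forall_schwartz ENNReal.toReal_nonneg fun η => ?_
    have h1 := hP.lintegral_integral_mul_G_le hF (measurableSet_uIoc (a := t) (b := τ)) η
    rw [mul_assoc] at h1
    rw [inner_sub_left, hy, hy, intervalIntegral.integral_interval_sub_left (hint0 _ _ _)
      (hint0 _ _ _)]
    have h2 := le_trans (enorm_integral_le_lintegral_enorm
      (μ := volume.restrict (Set.uIoc t τ)) fun σ => ∫ x, F σ x * P.G σ η x) h1
    have h3 := ENNReal.toReal_mono (ENNReal.mul_ne_top enorm_ne_top (hfin τ)) h2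
    rw [ENNReal.toReal_mul, toReal_enorm, toReal_enorm,
      ← intervalIntegral.norm_intervalIntegral_eq] at h3
    rwa [mul_comm]
  set z : ℝ → L2 E := fun t => conjL2 φ + y t with hz
  have hzc : Continuous z := continuous_const.add hyc
  set v : ℝ → L2 E := fun t => P.U t (z t) with hv
  have hvc : Continuous v := by
    refine continuous_iff_continuousAt.2 fun t => ?_
    have h1 : Tendsto (fun τ => ‖z τ - z t‖ + ‖P.U τ (z t) - P.U t (z t)‖) (𝓝 t) (𝓝 (0 + 0)) :=
      (tendsto_iff_norm_sub_tendsto_zero.1 (hzc.tendsto t)).add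
        (tendsto_iff_norm_sub_tendsto_zero.1 ((P.continuous_U (z t)).tendsto t))
    rw [add_zero] at h1
    change Tendsto _ _ _
    rw [tendsto_iff_norm_sub_tendsto_zero]
    refine squeeze_zero (fun _ => norm_nonneg _) (fun τ => ?_) h1
    calc ‖v τ - v t‖ = ‖P.U τ (z τ - z t) + (P.U τ (z t) - P.U t (z t))‖ := by
          rw [map_sub]; congr 1; simp only [hv]; abel
      _ ≤ _ := (norm_add_le _ _).trans (by rw [(P.U τ).norm_map])
  set u : ℝ → L2 E := fun t => ((Real.exp (-(β * t)) : ℝ) : ℂ) • conjL2 (v t) with hu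
  have huc : Continuous u :=
    (Complex.continuous_ofReal.comp (by fun_prop)).smul (conjL2.continuous.comp hvc)
  have hpair : ∀ t (ψ : 𝓢(E, ℂ)), ∫ x, u t x * ψ x = inner ℂ (z t) ((P.G (-t) ψ).toLp 2 volume) := by
    intro t ψ
    rw [← inner_conjL2_toLp, hu, conjL2_real_smul, conjL2_conjL2, inner_smul_left, P.toLp_G,
      inner_smul_right, Complex.conj_ofReal]
    have := inner_group_apply P.U_add t 0 (z t) (ψ.toLp 2 volume)
    rw [P.U_zero, zero_sub] at this
    simp only [hv]
    rw [this, mul_neg]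
  have hpair' : ∀ t (ψ : 𝓢(E, ℂ)), ∫ x, u t x * ψ x = (∫ x, φ x * P.G (-t) ψ x) +
      ∫ σ in (0 : ℝ)..t, ∫ x, F σ x * P.G (σ - t) ψ x := by
    intro t ψ
    rw [hpair, hz, inner_add_left, inner_conjL2_toLp, hy]
    simp only [← P.G_add, sub_eq_add_neg]
  refine ⟨u, huc, ?_, fun ψ t => ?_⟩
  · simp [hu, hv, hz, hy0, P.U_zero, conjL2_conjL2]
  set R : ℝ → ℂ := fun t => (∫ x, u t x * ψ x) - ∫ σ in (0 : ℝ)..t, ∫ x, F σ x * ψ x with hR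
  have hder : ∀ t, HasDerivAt R (∫ x, u t x * L ψ x) t := by
    intro t
    have hA : HasDerivAt (fun h => inner ℂ (z t) ((P.G (-t) (P.G (-h) ψ)).toLp 2 volume))
        (∫ x, u t x * L ψ x) 0 := by
      rw [hasDerivAt_iff_tendsto_slope_zero]
      have hneg : Tendsto (fun h : ℝ => -h) (𝓝[≠] 0) (𝓝[≠] 0) := by
        refine tendsto_nhdsWithin_iff.2 ⟨?_, ?_⟩
        · have := (continuous_neg (G := ℝ)).tendsto 0
          rw [neg_zero] at this
          exact this.mono_left nhdsWithin_le_nhds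
        · filter_upwards [self_mem_nhdsWithin] with h hh
          exact neg_ne_zero.2 hh
      have h2 := ((tendsto_const_nhds (x := conjL2 (u t))).inner (𝕜 := ℂ)
        ((P.tendsto_slope ψ).comp hneg)).neg
      rw [inner_neg_right, inner_conjL2_toLp, neg_neg] at h2
      refine h2.congr fun h => ?_
      simp only [Function.comp, zero_add, neg_zero, P.G_zero]
      rw [← hpair, ← hpair, ← inner_conjL2_toLp, ← inner_conjL2_toLp, ← inner_sub_right,
        inner_smul_right_eq_smul, inv_neg, neg_smul, neg_neg]
    obtain ⟨C, hC0, hC⟩ := P.eventually_eLpNorm_sub_le hP.two_lt.le ψ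
    have hD : HasDerivAt (fun h => ∫ σ in t..t + h, ∫ x, F σ x * (P.G (σ - (t + h)) ψ - ψ) x)
        0 0 := by
      refine hasDerivAt_integral_zero (hF.intervalIntegrable hs0) (C := C)
        (e := fun h σ => ∫ x, F σ x * (P.G (σ - (t + h)) ψ - ψ) x) ?_
      obtain ⟨ε, hε, hb⟩ := Metric.eventually_nhds_iff.1 hC
      filter_upwards [Metric.ball_mem_nhds (0 : ℝ) hε] with h hh
      filter_upwards [ae_restrict_of_ae (hF.ae_memLp hs0), ae_restrict_mem measurableSet_uIoc]
        with σ h1 h2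
      have h3 : |σ - (t + h)| ≤ |h| := by
        have := Set.abs_sub_right_of_mem_uIcc (Set.uIoc_subset_uIcc h2)
        rw [abs_sub_comm]
        simpa using this
      have h4 := @hb (σ - (t + h)) (by
        rw [Real.dist_0_eq_abs]
        rw [mem_ball_zero_iff, Real.norm_eq_abs] at hh
        linarith)
      refine norm_integral_mul_schwartz_le hP.conj h1 (by positivity) (h4.trans ?_)
      exact ENNReal.ofReal_le_ofReal (by gcongr)
    have hsum' : HasDerivAt (fun h => R (t + h)) (∫ x, u t x * L ψ x) 0 := by
      have h0 := (hA.add hD).add_const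
        (-∫ σ in (0 : ℝ)..t, ∫ x, F σ x * ψ x)
      rw [add_zero] at h0
      refine h0.congr_of_eventuallyEq (.of_forall fun h => ?_)
      have i2 := intervalIntegrable_integral_mul hP.conj hF ψ
      have e3 : ∫ σ in t..t + h, ∫ x, F σ x * (P.G (σ - (t + h)) ψ - ψ) x =
          (∫ σ in t..t + h, ∫ x, F σ x * P.G (σ - (t + h)) ψ x) -
            ∫ σ in t..t + h, ∫ x, F σ x * ψ x := by
        rw [← intervalIntegral.integral_sub (hint _ _ _ _) (i2 _ _)]
        refine intervalIntegral.integral_congr_ae ?_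
        filter_upwards [hF.ae_memLp hs0] with σ h1 _
        exact integral_mul_schwartz_sub hP.conj h1 _ _
      have e4 := intervalIntegral.integral_add_adjacent_intervals
        (hint ψ (t + h) 0 t) (hint ψ (t + h) t (t + h))
      have e5 := intervalIntegral.integral_add_adjacent_intervals (i2 0 t) (i2 t (t + h))
      have e6 : inner ℂ (z t) ((P.G (-t) (P.G (-h) ψ)).toLp 2 volume) =
          (∫ x, φ x * P.G (-(t + h)) ψ x) +
            ∫ σ in (0 : ℝ)..t, ∫ x, F σ x * P.G (σ - (t + h)) ψ x := by
        rw [← hpair, hpair']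
        have ea : -t + -h = -(t + h) := by ring
        have eb : ∀ σ, σ - t + -h = σ - (t + h) := fun σ => by ring
        simp only [← P.G_add, ea, eb]
      simp only [hR, Pi.add_apply, e3, e6, hpair']
      rw [← e4, ← e5]
      ring
    have h6 : HasDerivAt (fun h => R (t + h)) (∫ x, u t x * L ψ x) (t - t) := by
      rw [sub_self]; exact hsum'
    simpa using h6.comp_sub_const t t
  have hcont := continuous_integral_mul_schwartz huc (L ψ)
  have hftc := intervalIntegral.integral_eq_sub_of_hasDerivAt (fun τ _ => hder τ)
    (hcont.intervalIntegrable 0 t)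
  rw [intervalIntegral.integral_add (hcont.intervalIntegrable 0 t)
    (intervalIntegrable_integral_mul hP.conj hF ψ _ _), hftc]
  have hu0 : ∫ x, u 0 x * ψ x = ∫ x, φ x * ψ x := by
    rw [hpair']; simp [P.G_zero]
  simp only [hR, intervalIntegral.integral_same, hu0]
  ring

end IsDispersive

end Propagator

end Existence

/-! ### Linear flows -/

section LinearFlow

/-- The derivative of the determinant along a curve through the identity matrix. -/
lemma hasDerivAt_det_of_eq_one {ι : Type*} [Fintype ι] [DecidableEq ι] {M : ℝ → Matrix ι ι ℝ}
    {X : Matrix ι ι ℝ} (h0 : M 0 = 1) (hM : ∀ i j, HasDerivAt (fun t => M t i j) (X i j) 0) :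
    HasDerivAt (fun t => (M t).det) X.trace 0 := by
  have key : ∀ M : ℝ → Matrix ι ι ℝ, M 0 = 1 → (∀ i j, HasDerivAt (fun t => M t i j) (X i j) 0) →
      HasDerivAt (fun t => (M t).det) (∑ σ : Equiv.Perm ι, Equiv.Perm.sign σ •
        ∑ i, (∏ j ∈ Finset.univ.erase i, (1 : Matrix ι ι ℝ) (σ j) j) • X (σ i) i) 0 := by
    intro M h0 hM
    simp only [Matrix.det_apply]
    refine HasDerivAt.fun_sum fun σ _ => ?_
    have := HasDerivAt.fun_finsetProd (u := Finset.univ) (f := fun i t => M t (σ i) i)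
      (f' := fun i => X (σ i) i) (x := 0) fun i _ => hM (σ i) i
    rw [h0] at this
    exact this.const_smul (Equiv.Perm.sign σ)
  have h1 := key (fun t => 1 + t • X) (by simp) fun i j => by
    have := ((hasDerivAt_id (0 : ℝ)).mul_const (X i j)).const_add ((1 : Matrix ι ι ℝ) i j)
    simpa using this
  have h2 : HasDerivAt (fun t : ℝ => (1 + t • X).det) X.trace 0 := by
    have h3 := ((1 + (Polynomial.X : Polynomial ℝ) • X.map Polynomial.C).det).hasDerivAt 0
    rw [Matrix.derivative_det_one_add_X_smul] at h3
    refine h3.congr_of_eventuallyEq (.of_forall fun t => ?_)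
    dsimp only
    rw [← Polynomial.coe_evalRingHom, RingHom.map_det]
    congr 1
    ext i j
    by_cases hij : i = j <;> simp [hij] <;> exact mul_comm _ _
  rw [← h1.unique h2]
  exact key M h0 hM

variable {E : Type*} [NormedAddCommGroup E] [InnerProductSpace ℝ E]

/-- The flow of a linear vector field. -/
noncomputable def linearFlow (N : E →L[ℝ] E) (t : ℝ) : E →L[ℝ] E := NormedSpace.exp (t • N)

variable (N S : E →L[ℝ] E)

lemma linearFlow_zero : linearFlow N 0 = 1 := by simp [linearFlow, NormedSpace.exp_zero]

variable [FiniteDimensional ℝ E]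

lemma linearFlow_add (s t : ℝ) : linearFlow N (s + t) = linearFlow N s * linearFlow N t := by
  let : NormedAlgebra ℚ (E →L[ℝ] E) := NormedAlgebra.restrictScalars ℚ ℝ _
  rw [linearFlow, add_smul, NormedSpace.exp_add_of_commute]
  · rfl
  · exact ((Commute.refl N).smul_left s).smul_right t

lemma linearFlow_add_apply (s t : ℝ) (x : E) :
    linearFlow N (s + t) x = linearFlow N s (linearFlow N t x) := by
  rw [linearFlow_add]; rfl

lemma linearFlow_neg_apply (t : ℝ) (x : E) : linearFlow N (-t) (linearFlow N t x) = x := by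
  rw [← linearFlow_add_apply, neg_add_cancel, linearFlow_zero]; rfl

lemma hasDerivAt_linearFlow (t : ℝ) :
    HasDerivAt (linearFlow N) (N * linearFlow N t) t :=
  hasDerivAt_exp_smul_const' N t

lemma continuous_linearFlow : Continuous (linearFlow N) :=
  continuous_iff_continuousAt.2 fun t => (hasDerivAt_linearFlow N t).continuousAt

lemma hasDerivAt_linearFlow_apply (t : ℝ) (x : E) :
    HasDerivAt (fun t => linearFlow N t x) (N (linearFlow N t x)) t := by
  have := (hasDerivAt_linearFlow N t).clm_apply (hasDerivAt_const t x)
  simpa using this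

lemma exists_norm_linearFlow_le : ∃ C : ℝ, 1 ≤ C ∧ ∀ t ∈ Set.Icc (-1 : ℝ) 1, ∀ x,
    ‖linearFlow N t x‖ ≤ C * ‖x‖ := by
  obtain ⟨C, hC⟩ := (isCompact_Icc (a := (-1 : ℝ)) (b := 1)).exists_bound_of_continuousOn
    (continuous_linearFlow N).continuousOn
  refine ⟨max C 1, le_max_right _ _, fun t ht x => ?_⟩
  exact ((linearFlow N t).le_opNorm x).trans (by gcongr; exact (hC t ht).trans (le_max_left _ _))

/-- The flow of a linear vector field, as an equivalence. -/
noncomputable def linearFlowEquiv (t : ℝ) : E ≃L[ℝ] E :=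
  ContinuousLinearEquiv.equivOfInverse (linearFlow N t) (linearFlow N (-t))
    (linearFlow_neg_apply N t) (fun x => by simpa using linearFlow_neg_apply N (-t) x)

@[simp] lemma linearFlowEquiv_apply (t : ℝ) (x : E) : linearFlowEquiv N t x = linearFlow N t x := rfl

/-- Liouville's formula. -/
lemma det_linearFlow (t : ℝ) :
    (linearFlow N t).det = Real.exp (t * LinearMap.trace ℝ E N) := by
  set τ := LinearMap.trace ℝ E N with hτ
  let b := stdOrthonormalBasis ℝ E
  have hmul : ∀ s t, (linearFlow N (s + t)).det = (linearFlow N s).det * (linearFlow N t).det := by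
    intro s t
    rw [linearFlow_add]
    exact LinearMap.det_comp _ _
  have hder0 : HasDerivAt (fun t => (linearFlow N t).det) τ 0 := by
    have h1 := hasDerivAt_det_of_eq_one
      (M := fun t => LinearMap.toMatrix b.toBasis b.toBasis (linearFlow N t : E →ₗ[ℝ] E))
      (X := LinearMap.toMatrix b.toBasis b.toBasis (N : E →ₗ[ℝ] E))
      (by rw [linearFlow_zero]; exact LinearMap.toMatrix_one _) (fun i j => by
        have h2 := hasDerivAt_linearFlow_apply N 0 (b j)
        rw [linearFlow_zero] at h2
        have h3 := (hasDerivAt_const (0 : ℝ) (b i)).inner ℝ h2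
        simpa [LinearMap.toMatrix_apply, b.repr_apply_apply] using h3)
    rw [← LinearMap.trace_eq_matrix_trace ℝ b.toBasis] at h1
    simpa only [LinearMap.det_toMatrix] using h1
  have hder : ∀ t, HasDerivAt (fun t => (linearFlow N t).det) (τ * (linearFlow N t).det) t := by
    intro t
    have h1 : HasDerivAt (fun s => (linearFlow N s).det * (linearFlow N t).det)
      (τ * (linearFlow N t).det) (t - t) := by rw [sub_self]; exact hder0.mul_const _
    have h2 := h1.comp_sub_const t t
    refine h2.congr_of_eventuallyEq (.of_forall fun s => ?_)
    dsimp only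
    rw [← hmul, sub_add_cancel]
  have h3 : ∀ t, HasDerivAt (fun t => (linearFlow N t).det * Real.exp (-(t * τ))) 0 t := by
    intro t
    have := (hder t).mul (((hasDerivAt_id t).mul_const τ).neg.exp)
    refine this.congr_deriv ?_
    simp; ring
  have h4 := is_const_of_deriv_eq_zero (fun t => (h3 t).differentiableAt) (fun t => (h3 t).deriv) t 0
  have h5 : (linearFlow N 0).det = 1 := by rw [linearFlow_zero]; exact LinearMap.det_id
  rw [h5, zero_mul, neg_zero, Real.exp_zero, mul_one, Real.exp_neg] at h4
  field_simp at h4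
  linarith

/-- The operator `∫ (flow N σ)* S (flow N σ) dσ` over `[0, t]`. -/
noncomputable def flowGram (t : ℝ) : E →L[ℝ] E :=
  ∫ σ in (0 : ℝ)..t, (linearFlow N σ).adjoint ∘L S ∘L linearFlow N σ

lemma continuous_flowGram_integrand :
    Continuous fun σ => (linearFlow N σ).adjoint ∘L S ∘L linearFlow N σ := by
  have h1 : Continuous fun σ => (linearFlow N σ).adjoint :=
    ContinuousLinearMap.adjoint.continuous.comp (continuous_linearFlow N)
  exact h1.clm_comp (continuous_const.clm_comp (continuous_linearFlow N))

lemma inner_flowGram (t : ℝ) (x y : E) : inner ℝ x (flowGram N S t y) =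
    ∫ σ in (0 : ℝ)..t, inner ℝ (linearFlow N σ x) (S (linearFlow N σ y)) := by
  have hi := (continuous_flowGram_integrand N S).intervalIntegrable (μ := volume) 0 t
  let ℓ : (E →L[ℝ] E) →L[ℝ] ℝ := (innerSL ℝ x).comp (ContinuousLinearMap.apply ℝ E y)
  have := ℓ.intervalIntegral_comp_comm hi
  rw [flowGram]
  refine this.symm.trans (intervalIntegral.integral_congr fun σ _ => ?_)
  simp [ℓ, ContinuousLinearMap.adjoint_inner_right]

/-- The quadratic form of `flowGram`. -/
noncomputable def flowQuad (t : ℝ) (x : E) : ℝ := inner ℝ x (flowGram N S t x)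

lemma continuous_flowQuad_integrand (x : E) :
    Continuous fun σ => inner ℝ (linearFlow N σ x) (S (linearFlow N σ x)) := by
  have h1 : Continuous fun σ => linearFlow N σ x := (continuous_linearFlow N).clm_apply continuous_const
  exact h1.inner (S.continuous.comp h1)

lemma flowQuad_zero (x : E) : flowQuad N S 0 x = 0 := by simp [flowQuad, flowGram]

lemma flowQuad_add (s t : ℝ) (x : E) :
    flowQuad N S (s + t) x = flowQuad N S s x + flowQuad N S t (linearFlow N s x) := by
  have hi := fun a b => (continuous_flowQuad_integrand N S x).intervalIntegrable (μ := volume) a b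
  rw [flowQuad, flowQuad, flowQuad, inner_flowGram, inner_flowGram, inner_flowGram,
    ← intervalIntegral.integral_add_adjacent_intervals (hi 0 s) (hi s (s + t))]
  congr 1
  have h := intervalIntegral.integral_comp_add_right (a := 0) (b := t)
    (fun σ => inner ℝ (linearFlow N σ x) (S (linearFlow N σ x))) s
  rw [zero_add, add_comm t s] at h
  rw [← h]
  refine intervalIntegral.integral_congr fun σ _ => ?_
  simp only [linearFlow_add_apply]

lemma hasDerivAt_flowQuad (t : ℝ) (x : E) : HasDerivAt (fun t => flowQuad N S t x)
    (inner ℝ (linearFlow N t x) (S (linearFlow N t x))) t := by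
  simp only [flowQuad, inner_flowGram]
  exact ((continuous_flowQuad_integrand N S x).integral_hasStrictDerivAt 0 t).hasDerivAt

end LinearFlow

section Oscillation

lemma hasTemperateGrowth_cexp_I : (fun y : ℝ => Complex.exp (Complex.I * y)).HasTemperateGrowth := by
  have h1 : ContDiff ℝ ⊤ fun y : ℝ => Complex.exp (Complex.I * y) :=
    (contDiff_const.mul Complex.ofRealCLM.contDiff).cexp
  refine ⟨h1.of_le (by simp), fun n => ⟨0, 1, fun x => ?_⟩⟩
  rw [norm_iteratedFDeriv_eq_norm_iteratedDeriv]
  have h2 : iteratedDeriv n (fun y : ℝ => Complex.exp (Complex.I * y)) =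
      fun y : ℝ => Complex.I ^ n * Complex.exp (Complex.I * y) := by
    induction n with
    | zero => simp
    | succ n ih =>
      rw [iteratedDeriv_succ, ih]
      ext y
      have h3 : HasDerivAt (fun y : ℝ => Complex.I ^ n * Complex.exp (Complex.I * y))
          (Complex.I ^ n * (Complex.exp (Complex.I * y) * (Complex.I * 1))) y :=
        ((Complex.ofRealCLM.hasDerivAt.const_mul Complex.I).cexp).const_mul _
      rw [h3.deriv]; ring
  rw [h2]
  simp [mul_comm Complex.I, Complex.norm_exp_ofReal_mul_I]

variable {E : Type*} [NormedAddCommGroup E] [InnerProductSpace ℝ E]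

lemma hasTemperateGrowth_cexp_quadratic (c : ℝ) (M : E →L[ℝ] E) :
    (fun x : E => Complex.exp (Complex.I * ((c * inner ℝ x (M x) : ℝ) : ℂ))).HasTemperateGrowth := by
  have h2 : (fun x : E => c * inner ℝ x (M x)).HasTemperateGrowth := by
    have h3 : (fun x : E => (M x)).HasTemperateGrowth := M.hasTemperateGrowth
    exact (Function.HasTemperateGrowth.const c).mul
      ((innerSL ℝ).bilinear_hasTemperateGrowth Function.HasTemperateGrowth.id' h3)
  exact hasTemperateGrowth_cexp_I.comp h2

end Oscillation

/-! ### The Fourier side of the propagator -/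

section FourierFlow

variable {E : Type*} [NormedAddCommGroup E] [InnerProductSpace ℝ E] [FiniteDimensional ℝ E]

lemma lintegral_comp_continuousLinearEquiv [MeasurableSpace E] [BorelSpace E]
    (T : E ≃L[ℝ] E) {f : E → ℝ≥0∞} (hf : Measurable f) :
    ∫⁻ x, f (T x) = ENNReal.ofReal |((T : E →L[ℝ] E).det)⁻¹| * ∫⁻ x, f x := by
  have hdet : LinearMap.det ((T : E →L[ℝ] E) : E →ₗ[ℝ] E) ≠ 0 :=
    (LinearEquiv.isUnit_det' T.toLinearEquiv).ne_zero
  have h := Measure.map_linearMap_addHaar_eq_smul_addHaar (volume : Measure E) hdet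
  have h2 : ∫⁻ x, f (T x) = ∫⁻ y, f y ∂(volume.map ((T : E →L[ℝ] E) : E →ₗ[ℝ] E)) :=
    (lintegral_map hf T.continuous.measurable).symm
  rw [h2, h, lintegral_smul_measure]
  rfl

lemma lintegral_sq_inv_one_add_norm_ne_top [MeasurableSpace E] [BorelSpace E] (C : ℝ) :
    ∫⁻ ξ : E, ENNReal.ofReal (C * ((1 + ‖ξ‖) ^ (Module.finrank ℝ E + 1))⁻¹) ^ (2 : ℝ) ≠ ∞ := by
  have h1 := finite_integral_one_add_norm (E := E) (μ := volume)
    (r := (Module.finrank ℝ E + 1 : ℕ)) (by push_cast; linarith)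
  refine ne_top_of_le_ne_top (b := ENNReal.ofReal |C| ^ (2 : ℝ) * ∫⁻ ξ : E,
    ENNReal.ofReal ((1 + ‖ξ‖) ^ (-((Module.finrank ℝ E + 1 : ℕ) : ℝ))))
    (ENNReal.mul_ne_top (by simp) h1.ne) ?_
  rw [← lintegral_const_mul' _ _ (by simp)]
  refine lintegral_mono fun ξ => ?_
  have h2 : (0 : ℝ) ≤ ((1 + ‖ξ‖) ^ (Module.finrank ℝ E + 1))⁻¹ := by positivity
  have h3 : ((1 + ‖ξ‖) ^ (Module.finrank ℝ E + 1))⁻¹ ≤ 1 :=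
    inv_le_one_of_one_le₀ (one_le_pow₀ (by linarith [norm_nonneg ξ]))
  rw [Real.rpow_neg (by positivity), Real.rpow_natCast]
  calc ENNReal.ofReal (C * ((1 + ‖ξ‖) ^ (Module.finrank ℝ E + 1))⁻¹) ^ (2 : ℝ)
      ≤ ENNReal.ofReal (|C| * ((1 + ‖ξ‖) ^ (Module.finrank ℝ E + 1))⁻¹) ^ (2 : ℝ) := by
        gcongr; exact le_abs_self C
    _ = ENNReal.ofReal |C| ^ (2 : ℝ) *
        ENNReal.ofReal ((1 + ‖ξ‖) ^ (Module.finrank ℝ E + 1))⁻¹ ^ (2 : ℝ) := by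
        rw [ENNReal.ofReal_mul (abs_nonneg C), ENNReal.mul_rpow_of_nonneg _ _ (by norm_num)]
    _ ≤ _ := by
        refine mul_le_mul' le_rfl ?_
        rw [ENNReal.ofReal_rpow_of_nonneg h2 (by norm_num)]
        refine ENNReal.ofReal_le_ofReal ?_
        rw [Real.rpow_two]
        nlinarith

variable (N S : E →L[ℝ] E)

/-- The propagator on the Fourier side. -/
noncomputable def fourierFlow (t : ℝ) : 𝓢(E, ℂ) →L[ℂ] 𝓢(E, ℂ) :=
  (SchwartzMap.smulLeftCLM ℂ fun ξ : E =>
      Complex.exp (Complex.I * ((4 * Real.pi ^ 2 * flowQuad N S t ξ : ℝ) : ℂ))) ∘L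
    SchwartzMap.compCLMOfContinuousLinearEquiv ℂ (linearFlowEquiv N t)

lemma fourierFlow_apply (t : ℝ) (χ : 𝓢(E, ℂ)) (ξ : E) : fourierFlow N S t χ ξ =
    Complex.exp (Complex.I * ((4 * Real.pi ^ 2 * flowQuad N S t ξ : ℝ) : ℂ)) *
      χ (linearFlow N t ξ) := by
  have h : (fun ξ : E => Complex.exp (Complex.I *
      ((4 * Real.pi ^ 2 * flowQuad N S t ξ : ℝ) : ℂ))).HasTemperateGrowth :=
    hasTemperateGrowth_cexp_quadratic _ (flowGram N S t)
  rw [fourierFlow, ContinuousLinearMap.comp_apply, SchwartzMap.smulLeftCLM_apply_apply h]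
  simp

lemma norm_fourierFlow_apply (t : ℝ) (χ : 𝓢(E, ℂ)) (ξ : E) :
    ‖fourierFlow N S t χ ξ‖ = ‖χ (linearFlow N t ξ)‖ := by
  rw [fourierFlow_apply, norm_mul, mul_comm Complex.I, Complex.norm_exp_ofReal_mul_I, one_mul]

lemma fourierFlow_zero (χ : 𝓢(E, ℂ)) : fourierFlow N S 0 χ = χ := by
  ext ξ
  simp [fourierFlow_apply, flowQuad_zero, linearFlow_zero]

lemma fourierFlow_add (s t : ℝ) (χ : 𝓢(E, ℂ)) :
    fourierFlow N S (s + t) χ = fourierFlow N S s (fourierFlow N S t χ) := by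
  ext ξ
  rw [fourierFlow_apply, fourierFlow_apply, fourierFlow_apply, ← mul_assoc, ← Complex.exp_add,
    flowQuad_add, add_comm s t, linearFlow_add_apply]
  congr 2
  push_cast
  ring

lemma norm_toLp_fourierFlow [MeasurableSpace E] [BorelSpace E] (t : ℝ) (χ : 𝓢(E, ℂ)) :
    ‖(fourierFlow N S t χ).toLp 2 (volume : Measure E)‖ =
      Real.exp (-(LinearMap.trace ℝ E N / 2) * t) * ‖χ.toLp 2 (volume : Measure E)‖ := by
  rw [SchwartzMap.norm_toLp, SchwartzMap.norm_toLp,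
    ← ENNReal.toReal_ofReal (Real.exp_nonneg (-(LinearMap.trace ℝ E N / 2) * t)),
    ← ENNReal.toReal_mul]
  congr 1
  rw [eLpNorm_eq_lintegral_rpow_enorm_toReal (by simp) (by simp),
    eLpNorm_eq_lintegral_rpow_enorm_toReal (by simp) (by simp)]
  have h1 : ∫⁻ ξ, ‖fourierFlow N S t χ ξ‖ₑ ^ (2 : ℝ≥0∞).toReal =
      ∫⁻ ξ, (fun η => ‖χ η‖ₑ ^ (2 : ℝ≥0∞).toReal) (linearFlowEquiv N t ξ) := by
    refine lintegral_congr fun ξ => ?_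
    rw [← ofReal_norm, norm_fourierFlow_apply, ofReal_norm]
    rfl
  rw [h1, lintegral_comp_continuousLinearEquiv _ (χ.continuous.measurable.enorm.pow_const _),
    ENNReal.mul_rpow_of_nonneg _ _ (by positivity)]
  congr 1
  have h2 : ((linearFlowEquiv N t : E ≃L[ℝ] E) : E →L[ℝ] E) = linearFlow N t := rfl
  rw [h2, det_linearFlow, ← Real.exp_neg, abs_of_pos (Real.exp_pos _),
    ENNReal.ofReal_rpow_of_pos (Real.exp_pos _), ← Real.exp_mul]
  congr 2
  simp
  ring

/-- Rapid decay of `fourierFlow N S t χ`, uniformly for `t ∈ [-1, 1]`. -/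
lemma exists_norm_fourierFlow_le (χ : 𝓢(E, ℂ)) (k : ℕ) : ∃ C : ℝ, 0 ≤ C ∧
    ∀ t ∈ Set.Icc (-1 : ℝ) 1, ∀ ξ, ‖fourierFlow N S t χ ξ‖ ≤ C * ((1 + ‖ξ‖) ^ k)⁻¹ := by
  obtain ⟨c, hc1, hc⟩ := exists_norm_linearFlow_le N
  obtain ⟨C, hC⟩ : ∃ C, ∀ η, (1 + ‖η‖) ^ k * ‖χ η‖ ≤ C := ⟨_, fun η => by
    simpa using SchwartzMap.one_add_le_sup_seminorm_apply (𝕜 := ℂ) (m := (k, 0)) le_rfl le_rfl χ η⟩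
  have hC0 : 0 ≤ C := le_trans (by positivity) (hC 0)
  refine ⟨c ^ k * C, by positivity, fun t ht ξ => ?_⟩
  rw [norm_fourierFlow_apply, ← div_eq_mul_inv, le_div_iff₀ (by positivity)]
  have h1 : ‖ξ‖ ≤ c * ‖linearFlow N t ξ‖ := by
    have := hc (-t) ⟨by linarith [ht.2], by linarith [ht.1]⟩ (linearFlow N t ξ)
    rwa [linearFlow_neg_apply] at this
  have h2 : 1 + ‖ξ‖ ≤ c * (1 + ‖linearFlow N t ξ‖) := by linarith
  calc ‖χ (linearFlow N t ξ)‖ * (1 + ‖ξ‖) ^ k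
      ≤ ‖χ (linearFlow N t ξ)‖ * (c * (1 + ‖linearFlow N t ξ‖)) ^ k := by gcongr
    _ = c ^ k * ((1 + ‖linearFlow N t ξ‖) ^ k * ‖χ (linearFlow N t ξ)‖) := by rw [mul_pow]; ring
    _ ≤ c ^ k * C := by gcongr; exact hC _

/-- `X` is the generator of `fourierFlow N S`. -/
def IsFourierGenerator (X : 𝓢(E, ℂ) → 𝓢(E, ℂ)) : Prop :=
  ∀ (χ : 𝓢(E, ℂ)) (η : E), X χ η =
    Complex.I * ((4 * Real.pi ^ 2 * inner ℝ η (S η) : ℝ) : ℂ) * χ η + fderiv ℝ χ η (N η)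

variable {N S} {X : 𝓢(E, ℂ) → 𝓢(E, ℂ)} (hX : IsFourierGenerator N S X)
include hX

lemma IsFourierGenerator.hasDerivAt (χ : 𝓢(E, ℂ)) (ξ : E) (t : ℝ) :
    HasDerivAt (fun t => fourierFlow N S t χ ξ) (fourierFlow N S t (X χ) ξ) t := by
  have h1 : HasDerivAt (fun t => χ (linearFlow N t ξ))
      (fderiv ℝ χ (linearFlow N t ξ) (N (linearFlow N t ξ))) t :=
    (χ.differentiable.differentiableAt.hasFDerivAt).comp_hasDerivAt t
      (hasDerivAt_linearFlow_apply N t ξ)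
  have h2 := ((hasDerivAt_flowQuad N S t ξ).const_mul (4 * Real.pi ^ 2)).ofReal_comp
  have h3 := ((h2.const_mul Complex.I).cexp).mul h1
  simp only [fourierFlow_apply]
  refine h3.congr_deriv ?_
  rw [hX]
  ring

lemma IsFourierGenerator.exists_norm_sub_le (χ : 𝓢(E, ℂ)) (k : ℕ) : ∃ C : ℝ, 0 ≤ C ∧
    ∀ t ∈ Set.Icc (-1 : ℝ) 1, ∀ ξ,
      ‖fourierFlow N S t χ ξ - χ ξ‖ ≤ C * |t| * ((1 + ‖ξ‖) ^ k)⁻¹ := by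
  obtain ⟨C, hC0, hC⟩ := exists_norm_fourierFlow_le N S (X χ) k
  refine ⟨C, hC0, fun t ht ξ => ?_⟩
  have h1 := Convex.norm_image_sub_le_of_norm_hasDerivWithin_le (s := Set.Icc (-1 : ℝ) 1)
    (f := fun t => fourierFlow N S t χ ξ) (C := C * ((1 + ‖ξ‖) ^ k)⁻¹)
    (fun s _ => (hX.hasDerivAt χ ξ s).hasDerivWithinAt) (fun s hs => hC s hs ξ)
    (convex_Icc _ _) (x := 0) (y := t) (by norm_num) ht
  rw [fourierFlow_zero, sub_zero, Real.norm_eq_abs] at h1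
  linarith

lemma IsFourierGenerator.tendsto_slope [MeasurableSpace E] [BorelSpace E] (χ : 𝓢(E, ℂ)) :
    Tendsto (fun t : ℝ => (t⁻¹ • (fourierFlow N S t χ - χ) - X χ).toLp 2 (volume : Measure E))
      (𝓝[≠] 0) (𝓝 0) := by
  obtain ⟨C₁, hC₁0, hC₁⟩ := hX.exists_norm_sub_le χ (Module.finrank ℝ E + 1)
  obtain ⟨C₂, hC₂0, hC₂⟩ := exists_norm_fourierFlow_le N S (X χ) (Module.finrank ℝ E + 1)
  have hlim : Tendsto (fun t : ℝ => ∫⁻ ξ, ‖(t⁻¹ • (fourierFlow N S t χ - χ) - X χ) ξ‖ₑ ^ (2 : ℝ))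
      (𝓝[≠] 0) (𝓝 (∫⁻ _ : E, 0)) := by
    refine tendsto_lintegral_filter_of_dominated_convergence
      (fun ξ : E => ENNReal.ofReal
        ((C₁ + C₂) * ((1 + ‖ξ‖) ^ (Module.finrank ℝ E + 1))⁻¹) ^ (2 : ℝ))
      (.of_forall fun t => (SchwartzMap.continuous _).measurable.enorm.pow_const _) ?_
      (lintegral_sq_inv_one_add_norm_ne_top _) (.of_forall fun ξ => ?_)
    · have h1 : Set.Icc (-1 : ℝ) 1 ∈ 𝓝[≠] (0 : ℝ) :=
        nhdsWithin_le_nhds (Icc_mem_nhds (by norm_num) (by norm_num))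
      filter_upwards [h1, self_mem_nhdsWithin] with t ht ht0
      refine .of_forall fun ξ => ?_
      refine ENNReal.rpow_le_rpow ?_ (by norm_num)
      rw [← ofReal_norm]
      refine ENNReal.ofReal_le_ofReal ?_
      have h2 := hC₂ 0 (by norm_num) ξ
      rw [fourierFlow_zero] at h2
      have h3 : 0 < |t| := abs_pos.2 ht0
      calc ‖t⁻¹ • (fourierFlow N S t χ ξ - χ ξ) - X χ ξ‖
          ≤ |t|⁻¹ * ‖fourierFlow N S t χ ξ - χ ξ‖ + ‖X χ ξ‖ := by
            refine (norm_sub_le _ _).trans ?_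
            rw [norm_smul, norm_inv, Real.norm_eq_abs]
        _ ≤ |t|⁻¹ * (C₁ * |t| * ((1 + ‖ξ‖) ^ (Module.finrank ℝ E + 1))⁻¹) +
            C₂ * ((1 + ‖ξ‖) ^ (Module.finrank ℝ E + 1))⁻¹ := by
            gcongr; exact hC₁ t ht ξ
        _ = _ := by field_simp
    · have h1 := hasDerivAt_iff_tendsto_slope_zero.1 (hX.hasDerivAt χ ξ 0)
      rw [fourierFlow_zero, fourierFlow_zero] at h1
      have h2 := (h1.sub_const (X χ ξ)).enorm
      have h3 := (ENNReal.continuous_rpow_const (y := 2)).tendsto _ |>.comp h2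
      simpa [Function.comp_def] using h3
  rw [lintegral_zero] at hlim
  rw [tendsto_zero_iff_norm_tendsto_zero]
  have h3 := ((ENNReal.continuous_rpow_const (y := 1 / 2)).tendsto _).comp hlim
  rw [ENNReal.zero_rpow_of_pos (by norm_num)] at h3
  have h4 := (ENNReal.tendsto_toReal ENNReal.zero_ne_top).comp h3
  rw [ENNReal.toReal_zero] at h4
  refine h4.congr fun t => ?_
  rw [SchwartzMap.norm_toLp, eLpNorm_eq_lintegral_rpow_enorm_toReal (by simp) (by simp),
    ENNReal.toReal_ofNat]
  rfl

end FourierFlow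

/-! ### The propagator on Schwartz functions -/

section SchrodingerFlow

variable {E : Type*} [NormedAddCommGroup E] [InnerProductSpace ℝ E] [FiniteDimensional ℝ E]
  [MeasurableSpace E] [BorelSpace E]

/-- A map on Schwartz functions that preserves the `L^2` norm extends to `L^2`. -/
lemma exists_linearIsometry_extension (T : 𝓢(E, ℂ) →ₗ[ℂ] L2 E)
    (hT : ∀ ψ, ‖T ψ‖ = ‖ψ.toLp 2 (volume : Measure E)‖) :
    ∃ U : L2 E →ₗᵢ[ℂ] L2 E, ∀ ψ : 𝓢(E, ℂ), U (ψ.toLp 2 volume) = T ψ := by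
  set e : 𝓢(E, ℂ) →ₗ[ℂ] L2 E := (SchwartzMap.toLpCLM ℂ ℂ 2 volume).toLinearMap with he
  have hext : ∀ ψ : 𝓢(E, ℂ), T.extendOfNorm e (ψ.toLp 2 volume) = T ψ := fun ψ =>
    LinearMap.extendOfNorm_eq (e := e) denseRange_schwartz_toLp
      ⟨1, fun ψ => by rw [one_mul]; exact (hT ψ).le⟩ ψ
  refine ⟨⟨(T.extendOfNorm e).toLinearMap, fun f => ?_⟩, hext⟩
  refine denseRange_schwartz_toLp.induction_on
    (p := fun f => ‖T.extendOfNorm e f‖ = ‖f‖) f ?_ fun ψ => ?_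
  · exact isClosed_eq (T.extendOfNorm e).continuous.norm continuous_norm
  · rw [hext, hT]

lemma norm_toLp_fourierInv (χ : 𝓢(E, ℂ)) :
    ‖(𝓕⁻ χ).toLp 2 (volume : Measure E)‖ = ‖χ.toLp 2 (volume : Measure E)‖ := by
  have := SchwartzMap.norm_fourier_toL2_eq (𝓕⁻ χ)
  rw [FourierTransform.fourier_fourierInv_eq] at this
  exact this.symm

lemma norm_fourierInv_apply_le (χ : 𝓢(E, ℂ)) (x : E) : ‖𝓕⁻ χ x‖ ≤ ∫ ξ, ‖χ ξ‖ := by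
  rw [SchwartzMap.fourierInv_apply_eq, ← SchwartzMap.norm_toLp_one (μ := volume)]
  exact SchwartzMap.norm_fourier_apply_le_toLp_one χ _

variable (N S : E →L[ℝ] E)

/-- The propagator on Schwartz functions. -/
noncomputable def schrodingerFlow (t : ℝ) : 𝓢(E, ℂ) →ₗ[ℂ] 𝓢(E, ℂ) :=
  (FourierTransform.fourierInvₗ ℂ 𝓢(E, ℂ)) ∘ₗ (fourierFlow N S t).toLinearMap ∘ₗ
    (FourierTransform.fourierₗ ℂ 𝓢(E, ℂ))

lemma schrodingerFlow_apply (t : ℝ) (ψ : 𝓢(E, ℂ)) :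
    schrodingerFlow N S t ψ = 𝓕⁻ (fourierFlow N S t (𝓕 ψ)) := rfl

lemma norm_toLp_schrodingerFlow (t : ℝ) (ψ : 𝓢(E, ℂ)) :
    ‖(schrodingerFlow N S t ψ).toLp 2 (volume : Measure E)‖ =
      Real.exp (-(LinearMap.trace ℝ E N / 2) * t) * ‖ψ.toLp 2 (volume : Measure E)‖ := by
  rw [schrodingerFlow_apply, norm_toLp_fourierInv, norm_toLp_fourierFlow]
  congr 1
  exact SchwartzMap.norm_fourier_toL2_eq ψ

lemma schrodingerFlow_zero (ψ : 𝓢(E, ℂ)) : schrodingerFlow N S 0 ψ = ψ := by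
  rw [schrodingerFlow_apply, fourierFlow_zero, FourierTransform.fourierInv_fourier_eq]

lemma schrodingerFlow_add (s t : ℝ) (ψ : 𝓢(E, ℂ)) :
    schrodingerFlow N S (s + t) ψ = schrodingerFlow N S s (schrodingerFlow N S t ψ) := by
  simp only [schrodingerFlow_apply, FourierTransform.fourier_fourierInv_eq, fourierFlow_add]

lemma exists_unitary_schrodingerFlow (t : ℝ) : ∃ U : L2 E →ₗᵢ[ℂ] L2 E, ∀ ψ : 𝓢(E, ℂ),
    U (ψ.toLp 2 volume) = ((Real.exp (LinearMap.trace ℝ E N / 2 * t) : ℝ) : ℂ) •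
      (schrodingerFlow N S t ψ).toLp 2 volume := by
  refine exists_linearIsometry_extension
    (((Real.exp (LinearMap.trace ℝ E N / 2 * t) : ℝ) : ℂ) •
      ((SchwartzMap.toLpCLM ℂ ℂ 2 volume).toLinearMap ∘ₗ schrodingerFlow N S t)) fun ψ => ?_
  change ‖((Real.exp (LinearMap.trace ℝ E N / 2 * t) : ℝ) : ℂ) •
      (schrodingerFlow N S t ψ).toLp 2 (volume : Measure E)‖ = _
  rw [norm_smul, norm_toLp_schrodingerFlow, ← mul_assoc, Complex.norm_real, Real.norm_eq_abs,
    abs_of_pos (Real.exp_pos _), ← Real.exp_add]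
  simp

variable {N S} {X L : 𝓢(E, ℂ) → 𝓢(E, ℂ)}

/-- The propagator generated by `-L`. -/
noncomputable def schrodingerPropagator (hX : IsFourierGenerator N S X)
    (hL : ∀ ψ, 𝓕 (L ψ) = -X (𝓕 ψ)) :
    Propagator E (-(LinearMap.trace ℝ E N / 2)) L where
  U t := (exists_unitary_schrodingerFlow N S t).choose
  G := schrodingerFlow N S
  U_zero f := by
    refine denseRange_schwartz_toLp.induction_on
      (p := fun f => (exists_unitary_schrodingerFlow N S 0).choose f = f) f ?_ fun ψ => ?_
    · exact isClosed_eq (LinearIsometry.continuous _) continuous_id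
    · rw [(exists_unitary_schrodingerFlow N S 0).choose_spec, schrodingerFlow_zero]
      simp
  U_add s t f := by
    refine denseRange_schwartz_toLp.induction_on
      (p := fun f => (exists_unitary_schrodingerFlow N S (s + t)).choose f =
        (exists_unitary_schrodingerFlow N S s).choose
          ((exists_unitary_schrodingerFlow N S t).choose f)) f ?_ fun ψ => ?_
    · exact isClosed_eq (LinearIsometry.continuous _)
        ((LinearIsometry.continuous _).comp (LinearIsometry.continuous _))
    · rw [(exists_unitary_schrodingerFlow N S (s + t)).choose_spec,
        (exists_unitary_schrodingerFlow N S t).choose_spec, map_smul,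
        (exists_unitary_schrodingerFlow N S s).choose_spec, schrodingerFlow_add, smul_smul,
        ← Complex.ofReal_mul, ← Real.exp_add]
      congr 4
      ring
  G_zero := schrodingerFlow_zero N S
  G_add := schrodingerFlow_add N S
  toLp_G t ψ := by
    rw [(exists_unitary_schrodingerFlow N S t).choose_spec, smul_smul, ← Complex.ofReal_mul,
      ← Real.exp_add]
    simp
  tendsto_slope ψ := by
    have h1 := hX.tendsto_slope (𝓕 ψ)
    rw [← tendsto_sub_nhds_zero_iff, tendsto_zero_iff_norm_tendsto_zero]
    rw [tendsto_zero_iff_norm_tendsto_zero] at h1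
    refine h1.congr fun t => ?_
    rw [← norm_toLp_fourierInv]
    congr 1
    have h2 : L ψ = -𝓕⁻ (X (𝓕 ψ)) := by
      rw [← FourierTransform.fourierInv_neg, ← hL, FourierTransform.fourierInv_fourier_eq]
    have h3 : 𝓕⁻ (t⁻¹ • (fourierFlow N S t (𝓕 ψ) - 𝓕 ψ) - X (𝓕 ψ)) =
        t⁻¹ • (schrodingerFlow N S t ψ - ψ) + L ψ := by
      rw [h2, schrodingerFlow_apply]
      conv_rhs => rw [← FourierTransform.fourierInv_fourier_eq (F := 𝓢(E, ℂ)) ψ]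
      have h4 : ∀ χ : 𝓢(E, ℂ), 𝓕⁻ χ = FourierTransform.fourierInvₗ ℝ 𝓢(E, ℂ) χ := fun _ => rfl
      simp only [h4, map_sub, map_smul]
      simp only [← h4, FourierTransform.fourier_fourierInv_eq, sub_eq_add_neg]
    rw [h3]
    have h5 : ∀ χ : 𝓢(E, ℂ), χ.toLp 2 (volume : Measure E) =
      SchwartzMap.toLpCLM ℝ ℂ 2 volume χ := fun _ => rfl
    simp only [h5, map_add, map_sub, map_smul, sub_neg_eq_add]
  lipschitz ψ := by
    obtain ⟨C, hC0, hC⟩ := hX.exists_norm_sub_le (𝓕 ψ) (Module.finrank ℝ E + 1)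
    have hint : Integrable (fun ξ : E => ((1 + ‖ξ‖) ^ (Module.finrank ℝ E + 1))⁻¹) volume := by
      have := integrable_one_add_norm (E := E) (μ := volume)
        (r := (Module.finrank ℝ E + 1 : ℕ)) (by push_cast; linarith)
      refine this.congr (.of_forall fun ξ => ?_)
      dsimp only
      rw [Real.rpow_neg (by positivity), Real.rpow_natCast]
    refine ⟨C * ∫ ξ : E, ((1 + ‖ξ‖) ^ (Module.finrank ℝ E + 1))⁻¹, ?_⟩
    filter_upwards [Icc_mem_nhds (show (-1 : ℝ) < 0 by norm_num) zero_lt_one] with t ht x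
    have h1 : schrodingerFlow N S t ψ - ψ = 𝓕⁻ (fourierFlow N S t (𝓕 ψ) - 𝓕 ψ) := by
      have h4 : ∀ χ : 𝓢(E, ℂ), 𝓕⁻ χ = FourierTransform.fourierInvₗ ℝ 𝓢(E, ℂ) χ := fun _ => rfl
      rw [h4, map_sub, ← h4, ← h4, FourierTransform.fourierInv_fourier_eq]
      rfl
    change ‖(schrodingerFlow N S t ψ - ψ) x‖ ≤ _
    rw [h1]
    refine (norm_fourierInv_apply_le _ x).trans ?_
    calc ∫ ξ, ‖(fourierFlow N S t (𝓕 ψ) - 𝓕 ψ) ξ‖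
        ≤ ∫ ξ : E, C * |t| * ((1 + ‖ξ‖) ^ (Module.finrank ℝ E + 1))⁻¹ :=
          integral_mono_of_nonneg (.of_forall fun _ => norm_nonneg _) (hint.const_mul _)
            (.of_forall fun ξ => hC t ht ξ)
      _ = _ := by rw [integral_const_mul]; ring

end SchrodingerFlow

/-! ### The transposed operator on Schwartz functions -/

section TransposeOperator

variable {n : ℕ}

/-- The transposed operator, as a map on Schwartz functions. -/
noncomputable def schwartzTransposeOp (Q B : Matrix (Fin n) (Fin n) ℝ)
    (ψ : 𝓢(EuclideanSpace ℝ (Fin n), ℂ)) : 𝓢(EuclideanSpace ℝ (Fin n), ℂ) :=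
  Complex.I • (∑ i, ∑ j, (Q i j : ℂ) •
      ∂_{(EuclideanSpace.single i 1 : EuclideanSpace ℝ (Fin n))}
        (∂_{(EuclideanSpace.single j 1 : EuclideanSpace ℝ (Fin n))} ψ)) -
    ∑ i, ∑ j, (B i j : ℂ) • ∂_{(EuclideanSpace.single i 1 : EuclideanSpace ℝ (Fin n))}
      (SchwartzMap.smulLeftCLM ℂ
          (fun x : EuclideanSpace ℝ (Fin n) => inner ℝ x (EuclideanSpace.single j 1)) ψ)

lemma schwartz_sum_apply {ι E : Type*} [NormedAddCommGroup E] [NormedSpace ℝ E] (s : Finset ι)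
    (f : ι → 𝓢(E, ℂ)) (x : E) : (∑ i ∈ s, f i) x = ∑ i ∈ s, f i x := by
  classical
  induction s using Finset.induction_on with
  | empty => simp
  | insert a s ha ih => rw [Finset.sum_insert ha, Finset.sum_insert ha, ← ih]; rfl

lemma sum_sum_mul_apply_single (M : Matrix (Fin n) (Fin n) ℝ) (ℓ : EuclideanSpace ℝ (Fin n) →L[ℝ] ℂ)
    (x : EuclideanSpace ℝ (Fin n)) :
    ∑ i, ∑ j, (M i j : ℂ) * ((x j : ℂ) * ℓ (EuclideanSpace.single i 1)) =
      ℓ (M.toEuclideanLin x) := by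
  have h : M.toEuclideanLin x =
      ∑ i, (∑ j, M i j * x j) • (EuclideanSpace.single i 1 : EuclideanSpace ℝ (Fin n)) := by
    ext k
    simp [Matrix.toLpLin_apply, Matrix.mulVec, dotProduct, Finset.sum_apply, Pi.single_apply]
  rw [h, map_sum]
  refine Finset.sum_congr rfl fun i _ => ?_
  rw [map_smul, Finset.sum_smul]
  refine Finset.sum_congr rfl fun j _ => ?_
  rw [← Complex.coe_smul, smul_eq_mul]
  push_cast
  ring

lemma schwartzTransposeOp_apply (Q B : Matrix (Fin n) (Fin n) ℝ) (ψ : 𝓢(EuclideanSpace ℝ (Fin n), ℂ))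
    (x : EuclideanSpace ℝ (Fin n)) :
    schwartzTransposeOp Q B ψ x = DegenerateSchrodinger.transposeOp Q B ψ x := by
  rw [schwartzTransposeOp, DegenerateSchrodinger.transposeOp, sub_sub]
  rw [sub_apply, smul_apply, smul_eq_mul]
  congr 1
  · congr 1
    simp only [schwartz_sum_apply, smul_apply, smul_eq_mul]
    refine Finset.sum_congr rfl fun i _ => Finset.sum_congr rfl fun j _ => ?_
    congr 1
    rw [iteratedFDeriv_two_apply, SchwartzMap.lineDerivOp_apply_eq_fderiv]
    have h1 : ⇑(∂_{(EuclideanSpace.single j 1 : EuclideanSpace ℝ (Fin n))} ψ :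
        𝓢(EuclideanSpace ℝ (Fin n), ℂ)) =
        fun y => fderiv ℝ ψ y (EuclideanSpace.single j 1) := by
      ext y; exact SchwartzMap.lineDerivOp_apply_eq_fderiv _ _ _
    rw [h1]
    have h2 : DifferentiableAt ℝ (fderiv ℝ ψ) x :=
      (SchwartzMap.fderivCLM ℝ (EuclideanSpace ℝ (Fin n)) ℂ ψ).differentiable.differentiableAt
    rw [fderiv_clm_apply h2 (differentiableAt_const _)]
    simp
  · simp only [schwartz_sum_apply, smul_apply, smul_eq_mul]
    have h1 : ∀ i j : Fin n, ∂_{(EuclideanSpace.single i 1 : EuclideanSpace ℝ (Fin n))}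
        (SchwartzMap.smulLeftCLM ℂ
          (fun x : EuclideanSpace ℝ (Fin n) => inner ℝ x (EuclideanSpace.single j 1)) ψ) x =
        (x j : ℂ) * fderiv ℝ ψ x (EuclideanSpace.single i 1) +
          (if i = j then 1 else 0) * ψ x := by
      intro i j
      rw [SchwartzMap.lineDerivOp_apply_eq_fderiv, SchwartzMap.smulLeftCLM_apply (by fun_prop)]
      have h2 : HasFDerivAt (fun y : EuclideanSpace ℝ (Fin n) =>
          inner ℝ y (EuclideanSpace.single j (1 : ℝ)) • ψ y) _ x :=
        ((innerSL ℝ).flip (EuclideanSpace.single j (1 : ℝ) : EuclideanSpace ℝ (Fin n))).hasFDerivAt.smul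
          ψ.differentiable.differentiableAt.hasFDerivAt
      rw [h2.fderiv]
      simp [innerSL_apply_apply ℝ, EuclideanSpace.inner_single_left, PiLp.single_apply, eq_comm]
    simp only [h1, mul_add, Finset.sum_add_distrib]
    rw [sum_sum_mul_apply_single]
    congr 1
    simp [Matrix.trace, Finset.sum_mul]

lemma fourier_schwartzTransposeOp_apply (Q B : Matrix (Fin n) (Fin n) ℝ) (ψ : 𝓢(EuclideanSpace ℝ (Fin n), ℂ))
    (η : EuclideanSpace ℝ (Fin n)) :
    (𝓕 (schwartzTransposeOp Q B ψ) : 𝓢(EuclideanSpace ℝ (Fin n), ℂ)) η =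
      -(Complex.I * ((4 * Real.pi ^ 2 * inner ℝ η (Q.toEuclideanLin η) : ℝ) : ℂ) *
          (𝓕 ψ : 𝓢(EuclideanSpace ℝ (Fin n), ℂ)) η) +
        fderiv ℝ (𝓕 ψ : 𝓢(EuclideanSpace ℝ (Fin n), ℂ)) η (B.transpose.toEuclideanLin η) := by
  have hF : ∀ χ : 𝓢(EuclideanSpace ℝ (Fin n), ℂ),
      𝓕 χ = FourierTransform.fourierₗ ℂ 𝓢(EuclideanSpace ℝ (Fin n), ℂ) χ := fun _ => rfl
  have hd : ∀ (χ : 𝓢(EuclideanSpace ℝ (Fin n), ℂ)) (i : Fin n),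
      (𝓕 (∂_{(EuclideanSpace.single i 1 : EuclideanSpace ℝ (Fin n))} χ) :
        𝓢(EuclideanSpace ℝ (Fin n), ℂ)) η =
      2 * Real.pi * Complex.I * (η i * (𝓕 χ : 𝓢(EuclideanSpace ℝ (Fin n), ℂ)) η) := by
    intro χ i
    rw [SchwartzMap.fourier_lineDerivOp_eq, smul_apply,
      SchwartzMap.smulLeftCLM_apply_apply (by fun_prop)]
    simp [EuclideanSpace.inner_single_right]
  have hm : ∀ (χ : 𝓢(EuclideanSpace ℝ (Fin n), ℂ)) (j : Fin n),
      2 * Real.pi * Complex.I * (𝓕 (SchwartzMap.smulLeftCLM ℂ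
      (fun x : EuclideanSpace ℝ (Fin n) => inner ℝ x (EuclideanSpace.single j 1)) χ) :
        𝓢(EuclideanSpace ℝ (Fin n), ℂ)) η =
      -fderiv ℝ (𝓕 χ : 𝓢(EuclideanSpace ℝ (Fin n), ℂ)) η (EuclideanSpace.single j 1) := by
    intro χ j
    rw [← SchwartzMap.lineDerivOp_apply_eq_fderiv, SchwartzMap.lineDerivOp_fourier_eq]
    rw [hF, hF, map_smul, smul_apply, smul_eq_mul]
    ring
  have h0 : (𝓕 (schwartzTransposeOp Q B ψ) : 𝓢(EuclideanSpace ℝ (Fin n), ℂ)) =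
      Complex.I • (∑ i, ∑ j, (Q i j : ℂ) •
        𝓕 (∂_{(EuclideanSpace.single i 1 : EuclideanSpace ℝ (Fin n))}
        (∂_{(EuclideanSpace.single j 1 : EuclideanSpace ℝ (Fin n))} ψ))) -
      ∑ i, ∑ j, (B i j : ℂ) • 𝓕 (∂_{(EuclideanSpace.single i 1 : EuclideanSpace ℝ (Fin n))}
        (SchwartzMap.smulLeftCLM ℂ
          (fun x : EuclideanSpace ℝ (Fin n) => inner ℝ x (EuclideanSpace.single j 1)) ψ)) := by
    simp only [hF, schwartzTransposeOp, map_sub, map_smul, map_sum]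
  rw [h0, sub_apply, smul_apply, smul_eq_mul]
  simp only [schwartz_sum_apply, smul_apply, smul_eq_mul, hd]
  have h1 : ∀ i j, (B i j : ℂ) * (2 * Real.pi * Complex.I * (η i * (𝓕 (SchwartzMap.smulLeftCLM ℂ
      (fun x : EuclideanSpace ℝ (Fin n) => inner ℝ x (EuclideanSpace.single j 1)) ψ) :
        𝓢(EuclideanSpace ℝ (Fin n), ℂ)) η)) =
      -((B.transpose j i : ℂ) * ((η i : ℂ) *
        fderiv ℝ (𝓕 ψ : 𝓢(EuclideanSpace ℝ (Fin n), ℂ)) η (EuclideanSpace.single j 1))) := by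
    intro i j
    have := hm ψ j
    rw [Matrix.transpose_apply]
    linear_combination (B i j : ℂ) * η i * this
  simp only [h1, Finset.sum_neg_distrib]
  rw [Finset.sum_comm (f := fun i j => (B.transpose j i : ℂ) *
    ((η i : ℂ) *
        fderiv ℝ (𝓕 ψ : 𝓢(EuclideanSpace ℝ (Fin n), ℂ)) η (EuclideanSpace.single j 1))), sum_sum_mul_apply_single,
    sub_neg_eq_add]
  congr 1
  have h2 : inner ℝ η (Q.toEuclideanLin η) = ∑ i, ∑ j, Q i j * (η i * η j) := by
    simp [PiLp.inner_apply, Matrix.toLpLin_apply, Matrix.mulVec, dotProduct, Finset.sum_mul]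
    exact Finset.sum_congr rfl fun i _ => Finset.sum_congr rfl fun j _ => by ring
  rw [h2]
  push_cast
  rw [Finset.mul_sum, Finset.mul_sum, Finset.mul_sum, Finset.sum_mul, ← Finset.sum_neg_distrib]
  refine Finset.sum_congr rfl fun i _ => ?_
  rw [Finset.mul_sum, Finset.mul_sum, Finset.mul_sum, Finset.sum_mul, ← Finset.sum_neg_distrib]
  refine Finset.sum_congr rfl fun j _ => ?_
  linear_combination (4 * Real.pi ^ 2 * Complex.I * Q i j * η i * η j *
    (𝓕 ψ : 𝓢(EuclideanSpace ℝ (Fin n), ℂ)) η) * Complex.I_sq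

end TransposeOperator

/-! ### The dispersive estimate for Gaussian kernels -/

section Dispersive

variable {E : Type*} [NormedAddCommGroup E] [InnerProductSpace ℝ E] [FiniteDimensional ℝ E]
  [MeasurableSpace E] [BorelSpace E]

lemma integral_comp_continuousLinearEquiv (T : E ≃L[ℝ] E) (f : E → ℂ) :
    ∫ x, f (T x) = |((T : E →L[ℝ] E).det)⁻¹| • ∫ x, f x := by
  have hdet : LinearMap.det ((T : E →L[ℝ] E) : E →ₗ[ℝ] E) ≠ 0 :=
    (LinearEquiv.isUnit_det' T.toLinearEquiv).ne_zero
  have h := Measure.map_linearMap_addHaar_eq_smul_addHaar (volume : Measure E) hdet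
  have h2 : ∫ y, f y ∂(volume.map T) = ∫ x, f (T x) :=
    T.toHomeomorph.measurableEmbedding.integral_map f
  have h3 : (volume : Measure E).map T =
      ENNReal.ofReal |((T : E →L[ℝ] E).det)⁻¹| • volume := h
  rw [← h2, h3, integral_smul_measure, ENNReal.toReal_ofReal (abs_nonneg _)]

/-- Pairing of a Fourier transform with a complex Gaussian. -/
lemma norm_integral_fourier_mul_gaussian_le (ψ : 𝓢(E, ℂ)) (W : E →L[ℝ] E) {b : ℂ} (hb : 0 < b.re)
    (hb' : Real.pi ≤ ‖b‖) (x : E) :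
    ‖∫ η, 𝓕 (ψ : E → ℂ) (W η) *
      Complex.exp (-b * ‖η‖ ^ 2 + 2 * Real.pi * Complex.I * inner ℝ x η)‖ ≤ ∫ y, ‖ψ y‖ := by
  set g : E → ℂ := fun η =>
    Complex.exp (-b * ‖η‖ ^ 2 + 2 * Real.pi * Complex.I * inner ℝ x η) with hg
  have hgi : Integrable g volume :=
    GaussianFourier.integrable_cexp_neg_mul_sq_norm_add hb (2 * Real.pi * Complex.I) x
  let ℓ : E →ₗ[ℝ] E →ₗ[ℝ] ℝ := (innerₗ E).compl₂ (W : E →ₗ[ℝ] E)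
  have hℓ : ∀ y η, ℓ y η = inner ℝ y (W η) := fun _ _ => rfl
  have h1 := VectorFourier.integral_fourierIntegral_smul_eq_flip (μ := (volume : Measure E))
    (ν := (volume : Measure E)) (e := Real.fourierChar) (L := ℓ) (f := ψ) (g := g)
    Real.continuous_fourierChar
    (by simp only [hℓ]; exact continuous_fst.inner (W.continuous.comp continuous_snd))
    ψ.integrable hgi
  have h2 : ∀ η, VectorFourier.fourierIntegral Real.fourierChar volume ℓ ψ η =
      𝓕 (ψ : E → ℂ) (W η) := fun η => by
    rw [Real.fourier_eq]; rfl
  have h3 : ∀ y, VectorFourier.fourierIntegral Real.fourierChar volume ℓ.flip g y =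
      𝓕 g (W.adjoint y) := fun y => by
    rw [Real.fourier_eq]
    change ∫ η, Real.fourierChar (-inner ℝ y (W η)) • g η = _
    refine integral_congr_ae (.of_forall fun η => ?_)
    dsimp only
    rw [ContinuousLinearMap.adjoint_inner_right, real_inner_comm]
  simp only [h2, h3, smul_eq_mul] at h1
  rw [h1]
  refine norm_integral_le_of_norm_le ψ.integrable.norm (.of_forall fun y => ?_)
  rw [norm_mul]
  refine mul_le_of_le_one_right (norm_nonneg _) ?_
  rw [hg, fourier_gaussian_innerProductSpace' hb, norm_mul]
  have h4 : ‖((Real.pi : ℂ) / b) ^ ((Module.finrank ℝ E : ℂ) / 2)‖ ≤ 1 := by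
    have h5 : ((Module.finrank ℝ E : ℂ) / 2) = (((Module.finrank ℝ E : ℝ) / 2 : ℝ) : ℂ) := by
      push_cast; rfl
    rw [h5, Complex.norm_cpow_real, norm_div, Complex.norm_real, Real.norm_eq_abs,
      abs_of_pos Real.pi_pos]
    exact Real.rpow_le_one (by positivity) (div_le_one_of_le₀ hb' (norm_nonneg _)) (by positivity)
  have h6 : ‖Complex.exp (-(Real.pi : ℂ) ^ 2 * ‖x - W.adjoint y‖ ^ 2 / b)‖ ≤ 1 := by
    rw [Complex.norm_exp, Real.exp_le_one_iff]
    have h7 : (-(Real.pi : ℂ) ^ 2 * ‖x - W.adjoint y‖ ^ 2 / b) =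
        ((-(Real.pi ^ 2 * ‖x - W.adjoint y‖ ^ 2) : ℝ) : ℂ) * b⁻¹ := by
      push_cast; rw [div_eq_mul_inv]; ring
    rw [h7, Complex.re_ofReal_mul, Complex.inv_re]
    have : 0 ≤ b.re / Complex.normSq b := div_nonneg hb.le (Complex.normSq_nonneg _)
    nlinarith [mul_nonneg (sq_nonneg Real.pi) (sq_nonneg ‖x - W.adjoint y‖)]
  exact mul_le_one₀ h4 (norm_nonneg _) h6

variable {N S : E →L[ℝ] E}

/-- The dispersive estimate. -/
theorem norm_schrodingerFlow_le {t σ : ℝ} (hσ : |σ| = 1) (R : E ≃L[ℝ] E)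
    (hR : ∀ ξ, flowQuad N S t ξ = σ * ‖R ξ‖ ^ 2) (ψ : 𝓢(E, ℂ)) (x : E) :
    ‖schrodingerFlow N S t ψ x‖ ≤ |((R : E →L[ℝ] E).det)⁻¹| * ∫ y, ‖ψ y‖ := by
  set b : ℝ → ℂ := fun ε => ε - ((4 * Real.pi ^ 2 * σ : ℝ) : ℂ) * Complex.I with hb
  set I : ℝ → ℂ := fun ε => ∫ ξ, 𝓕 (ψ : E → ℂ) (linearFlow N t ξ) *
    Complex.exp (-b ε * ‖R ξ‖ ^ 2 + 2 * Real.pi * Complex.I * inner ℝ x ξ) with hI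
  have hbre : ∀ ε, (b ε).re = ε := fun ε => by
    simp only [hb, Complex.sub_re, Complex.ofReal_re, Complex.re_ofReal_mul, Complex.I_re]
    ring
  have hbim : ∀ ε, (b ε).im = -(4 * Real.pi ^ 2 * σ) := fun ε => by
    simp only [hb, Complex.sub_im, Complex.ofReal_im, Complex.im_ofReal_mul,
      Complex.I_im]
    ring
  have hbound : ∀ ε, 0 < ε → ‖I ε‖ ≤ |((R : E →L[ℝ] E).det)⁻¹| * ∫ y, ‖ψ y‖ := by
    intro ε hε
    have hn : Real.pi ≤ ‖b ε‖ := by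
      refine le_trans ?_ (Complex.abs_im_le_norm _)
      rw [hbim, abs_neg, abs_mul, hσ, mul_one, abs_of_pos (by positivity)]
      nlinarith [Real.pi_gt_three]
    have h1 := norm_integral_fourier_mul_gaussian_le ψ
      ((linearFlow N t).comp (R.symm : E →L[ℝ] E)) (b := b ε) (by rw [hbre]; exact hε) hn
      ((R.symm : E →L[ℝ] E).adjoint x)
    obtain ⟨f, hf⟩ : ∃ f : E → ℂ, f = fun η =>
        𝓕 (ψ : E → ℂ) (((linearFlow N t).comp (R.symm : E →L[ℝ] E)) η) *
        Complex.exp (-b ε * ‖η‖ ^ 2 + 2 * Real.pi * Complex.I *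
          inner ℝ ((R.symm : E →L[ℝ] E).adjoint x) η) := ⟨_, rfl⟩
    have h2 : I ε = ∫ ξ, f (R ξ) := by
      refine integral_congr_ae (.of_forall fun ξ => ?_)
      rw [hf]
      dsimp only
      rw [ContinuousLinearMap.adjoint_inner_left]
      simp
    rw [← hf] at h1
    rw [h2, integral_comp_continuousLinearEquiv, norm_smul, Real.norm_eq_abs, abs_abs]
    gcongr
  have hlim : Tendsto I (𝓝[>] 0) (𝓝 (I 0)) := by
    refine tendsto_integral_filter_of_dominated_convergence
      (fun ξ => ‖fourierFlow N S t (𝓕 ψ) ξ‖) ?_ ?_ (fourierFlow N S t (𝓕 ψ)).integrable.norm ?_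
    · refine .of_forall fun ε => Continuous.aestronglyMeasurable ?_
      have h1 : Continuous fun ξ => 𝓕 (ψ : E → ℂ) (linearFlow N t ξ) :=
        (𝓕 ψ : 𝓢(E, ℂ)).continuous.comp (linearFlow N t).continuous
      have h2 : Continuous fun ξ : E => (inner ℝ x ξ : ℂ) :=
        Complex.continuous_ofReal.comp (continuous_const.inner continuous_id)
      have h3 : Continuous fun ξ => ((‖R ξ‖ : ℝ) : ℂ) :=
        Complex.continuous_ofReal.comp R.continuous.norm
      exact h1.mul (Complex.continuous_exp.comp
        ((continuous_const.mul (h3.pow 2)).add (continuous_const.mul h2)))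
    · filter_upwards [self_mem_nhdsWithin] with ε hε
      refine .of_forall fun ξ => ?_
      rw [norm_fourierFlow_apply, norm_mul]
      refine mul_le_of_le_one_right (norm_nonneg _) ?_
      rw [Complex.norm_exp, Real.exp_le_one_iff]
      have h1 : (-b ε * (‖R ξ‖ : ℂ) ^ 2 + 2 * Real.pi * Complex.I * inner ℝ x ξ).re =
          -(ε * ‖R ξ‖ ^ 2) := by
        have h2 : -b ε * (‖R ξ‖ : ℂ) ^ 2 + 2 * Real.pi * Complex.I * inner ℝ x ξ =
            ((‖R ξ‖ ^ 2 : ℝ) : ℂ) * (-b ε) + ((2 * Real.pi * inner ℝ x ξ : ℝ) : ℂ) * Complex.I := by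
          push_cast; ring
        rw [h2, Complex.add_re, Complex.re_ofReal_mul, Complex.re_ofReal_mul, Complex.neg_re, hbre]
        simp; ring
      rw [h1]
      have : 0 < ε := hε
      have : 0 ≤ ε * ‖R ξ‖ ^ 2 := by positivity
      linarith
    · refine .of_forall fun ξ => ?_
      have h1 : Continuous fun ε : ℝ => 𝓕 (ψ : E → ℂ) (linearFlow N t ξ) *
          Complex.exp (-b ε * ‖R ξ‖ ^ 2 + 2 * Real.pi * Complex.I * inner ℝ x ξ) := by
        have h2 : Continuous b := Complex.continuous_ofReal.sub continuous_const
        exact continuous_const.mul (Complex.continuous_exp.comp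
          ((h2.neg.mul continuous_const).add continuous_const))
      exact (h1.tendsto 0).mono_left nhdsWithin_le_nhds
  have h0 : I 0 = schrodingerFlow N S t ψ x := by
    rw [schrodingerFlow_apply, SchwartzMap.fourierInv_coe, Real.fourierInv_eq']
    refine integral_congr_ae (.of_forall fun ξ => ?_)
    dsimp only
    rw [fourierFlow_apply, smul_eq_mul, ← mul_assoc, ← Complex.exp_add, mul_comm, hR, hb]
    rw [SchwartzMap.fourier_coe]
    congr 2
    rw [real_inner_comm]
    push_cast
    ring
  rw [← h0]
  refine le_of_tendsto hlim.norm ?_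
  filter_upwards [self_mem_nhdsWithin] with ε hε using hbound ε hε

/-- The dispersive estimate for the unitary group. -/
theorem enorm_inner_schrodingerPropagator_le {X L : 𝓢(E, ℂ) → 𝓢(E, ℂ)}
    (hX : IsFourierGenerator N S X) (hL : ∀ ψ, 𝓕 (L ψ) = -X (𝓕 ψ)) {t σ : ℝ} (hσ : |σ| = 1)
    (R : E ≃L[ℝ] E) (hR : ∀ ξ, flowQuad N S t ξ = σ * ‖R ξ‖ ^ 2) (ψ χ : 𝓢(E, ℂ)) :
    ‖inner ℂ (χ.toLp 2 volume) ((schrodingerPropagator hX hL).U t (ψ.toLp 2 volume))‖ₑ ≤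
      ENNReal.ofReal (Real.exp (LinearMap.trace ℝ E N / 2 * t) * |((R : E →L[ℝ] E).det)⁻¹|) *
        (eLpNorm ψ 1 volume * eLpNorm χ 1 volume) := by
  have h1 : ∀ η : 𝓢(E, ℂ), eLpNorm η 1 volume = ENNReal.ofReal (∫ y, ‖η y‖) := fun η => by
    rw [eLpNorm_one_eq_lintegral_enorm, ofReal_integral_norm_eq_lintegral_enorm η.integrable]
  rw [h1, h1, ← ENNReal.ofReal_mul (integral_nonneg fun _ => norm_nonneg _),
    ← ENNReal.ofReal_mul (by positivity), ← ofReal_norm]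
  refine ENNReal.ofReal_le_ofReal ?_
  rw [Propagator.U_toLp, inner_smul_right, norm_mul, Complex.norm_real, Real.norm_eq_abs,
    abs_of_pos (Real.exp_pos _), neg_mul, neg_neg, mul_assoc]
  gcongr
  rw [SchwartzMap.inner_toL2_toL2_eq χ ((schrodingerPropagator hX hL).G t ψ) volume]
  have h2 : ∀ x, ‖inner ℂ (χ x) (schrodingerFlow N S t ψ x)‖ ≤
      ‖χ x‖ * (|((R : E →L[ℝ] E).det)⁻¹| * ∫ y, ‖ψ y‖) := fun x =>
    (norm_inner_le_norm _ _).trans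
      (mul_le_mul_of_nonneg_left (norm_schrodingerFlow_le hσ R hR ψ x) (norm_nonneg _))
  refine (norm_integral_le_of_norm_le (χ.integrable.norm.mul_const _) (.of_forall h2)).trans ?_
  rw [integral_mul_const]
  exact le_of_eq (by ring)

end Dispersive

/-! ### The Gramian -/

section Gramian

/-- Comparison of determinants of linear maps with comparable norms. -/
lemma abs_det_le_of_norm_le {E : Type*} [NormedAddCommGroup E] [InnerProductSpace ℝ E]
    [FiniteDimensional ℝ E] (R : E ≃L[ℝ] E) (T : E →L[ℝ] E) (h : ∀ x, ‖T x‖ ≤ ‖R x‖) :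
    |T.det| ≤ |(R : E →L[ℝ] E).det| := by
  borelize E
  set M : E →L[ℝ] E := T.comp (R.symm : E →L[ℝ] E) with hM
  have h1 : M '' Metric.ball 0 1 ⊆ Metric.ball 0 1 := by
    rintro _ ⟨x, hx, rfl⟩
    rw [mem_ball_zero_iff] at hx ⊢
    have := h (R.symm x)
    rw [R.apply_symm_apply] at this
    exact this.trans_lt hx
  have h2 := measure_mono (μ := (volume : Measure E)) h1
  rw [Measure.addHaar_image_continuousLinearMap] at h2
  have hpos : 0 < volume (Metric.ball (0 : E) 1) := Metric.measure_ball_pos _ _ one_pos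
  have hfin : volume (Metric.ball (0 : E) 1) ≠ ∞ := measure_ball_lt_top.ne
  have h3 : ENNReal.ofReal |M.det| ≤ 1 := by
    by_contra hlt
    have := ENNReal.mul_lt_mul_left hpos.ne' hfin (not_le.1 hlt)
    rw [one_mul] at this
    exact absurd h2 (not_le.2 this)
  rw [ENNReal.ofReal_le_one] at h3
  have h4 : T = M.comp (R : E →L[ℝ] E) := by ext x; simp [hM]
  have h5 : T.det = M.det * (R : E →L[ℝ] E).det := by
    conv_lhs => rw [h4]
    exact LinearMap.det_comp _ _
  rw [h5, abs_mul]
  exact mul_le_of_le_one_left (abs_nonneg _) h3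

open scoped MatrixOrder in
lemma Matrix.PosSemidef.exists_eq_conjTranspose_mul_self {ι : Type*} [Fintype ι] [DecidableEq ι]
    {A : Matrix ι ι ℝ} (hA : A.PosSemidef) : ∃ R : Matrix ι ι ℝ, A = R.conjTranspose * R :=
  CStarAlgebra.nonneg_iff_eq_star_mul_self.mp hA.nonneg

variable {n : ℕ}

/-- The linear operator of a matrix on Euclidean space. -/
noncomputable abbrev matrixCLM (M : Matrix (Fin n) (Fin n) ℝ) :
    EuclideanSpace ℝ (Fin n) →L[ℝ] EuclideanSpace ℝ (Fin n) :=
  Matrix.toEuclideanCLM (n := Fin n) (𝕜 := ℝ) M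

lemma det_matrixCLM (M : Matrix (Fin n) (Fin n) ℝ) : (matrixCLM M).det = M.det := by
  change LinearMap.det ((matrixCLM M : EuclideanSpace ℝ (Fin n) →L[ℝ] EuclideanSpace ℝ (Fin n)) :
    EuclideanSpace ℝ (Fin n) →ₗ[ℝ] EuclideanSpace ℝ (Fin n)) = _
  rw [Matrix.coe_toEuclideanCLM_eq_toEuclideanLin]
  exact LinearMap.det_toLin (EuclideanSpace.basisFun (Fin n) ℝ).toBasis M

lemma trace_matrixCLM (M : Matrix (Fin n) (Fin n) ℝ) :
    LinearMap.trace ℝ (EuclideanSpace ℝ (Fin n)) (matrixCLM M) = M.trace := by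
  rw [Matrix.coe_toEuclideanCLM_eq_toEuclideanLin]
  exact Matrix.trace_toLin_eq M (EuclideanSpace.basisFun (Fin n) ℝ).toBasis

lemma matrixCLM_mul (A B : Matrix (Fin n) (Fin n) ℝ) :
    matrixCLM (A * B) = matrixCLM A * matrixCLM B :=
  map_mul _ _ _

lemma inner_single_matrixCLM (M : Matrix (Fin n) (Fin n) ℝ) (i j : Fin n) :
    inner ℝ (EuclideanSpace.single i 1) (matrixCLM M (EuclideanSpace.single j 1)) = M i j := by
  rw [Matrix.inner_toEuclideanCLM]
  simp

lemma matrixCLM_ext {T : EuclideanSpace ℝ (Fin n) →L[ℝ] EuclideanSpace ℝ (Fin n)}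
    {M : Matrix (Fin n) (Fin n) ℝ}
    (h : ∀ i j, inner ℝ (EuclideanSpace.single i 1) (T (EuclideanSpace.single j 1)) = M i j) :
    T = matrixCLM M := by
  have h1 : ∀ j, T (EuclideanSpace.single j 1) = matrixCLM M (EuclideanSpace.single j 1) := by
    intro j
    ext i
    have h2 := (h i j).trans (inner_single_matrixCLM M i j).symm
    simpa [EuclideanSpace.inner_single_left] using h2
  have h3 : (T : EuclideanSpace ℝ (Fin n) →ₗ[ℝ] EuclideanSpace ℝ (Fin n)) = matrixCLM M :=
    (EuclideanSpace.basisFun (Fin n) ℝ).toBasis.ext fun j => by simpa using h1 j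
  exact ContinuousLinearMap.coe_injective h3

lemma adjoint_matrixCLM (M : Matrix (Fin n) (Fin n) ℝ) :
    (matrixCLM M).adjoint = matrixCLM M.transpose := by
  rw [← ContinuousLinearMap.star_eq_adjoint, ← map_star]
  congr 1

open scoped Matrix.Norms.Operator in
lemma matrixCLM_exp (M : Matrix (Fin n) (Fin n) ℝ) :
    matrixCLM (NormedSpace.exp M) = NormedSpace.exp (matrixCLM M) := by
  let : NormedAlgebra ℚ (Matrix (Fin n) (Fin n) ℝ) := NormedAlgebra.restrictScalars ℚ ℝ _
  let : NormedAlgebra ℚ (EuclideanSpace ℝ (Fin n) →L[ℝ] EuclideanSpace ℝ (Fin n)) :=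
    NormedAlgebra.restrictScalars ℚ ℝ _
  refine NormedSpace.map_exp (Matrix.toEuclideanCLM (n := Fin n) (𝕜 := ℝ)) ?_ M
  exact LinearMap.continuous_of_finiteDimensional
    (Matrix.toEuclideanCLM (n := Fin n) (𝕜 := ℝ)).toAlgEquiv.toLinearMap

variable (Q B : Matrix (Fin n) (Fin n) ℝ)

lemma linearFlow_neg_transpose (t : ℝ) :
    linearFlow (-matrixCLM B.transpose) (-t) = matrixCLM (NormedSpace.exp (t • B.transpose)) := by
  have h : matrixCLM (t • B.transpose) = t • matrixCLM B.transpose := map_smul _ _ _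
  rw [matrixCLM_exp, linearFlow, h, neg_smul_neg]

lemma flowGram_eq_gramian (t : ℝ) :
    flowGram (-matrixCLM B.transpose) (matrixCLM Q) (-t) =
      -matrixCLM (DegenerateSchrodinger.gramian Q B t) := by
  have hneg : matrixCLM (-DegenerateSchrodinger.gramian Q B t) =
    -matrixCLM (DegenerateSchrodinger.gramian Q B t) := map_neg _ _
  rw [← hneg]
  refine matrixCLM_ext fun i j => ?_
  have hg : DegenerateSchrodinger.gramian Q B t i j = ∫ σ in (0 : ℝ)..t,
    (NormedSpace.exp (σ • B) * Q * NormedSpace.exp (σ • B.transpose)) i j := rfl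
  have h := intervalIntegral.integral_comp_neg (a := 0) (b := t) (fun σ =>
    inner ℝ (linearFlow (-matrixCLM B.transpose) σ (EuclideanSpace.single i 1))
      (matrixCLM Q (linearFlow (-matrixCLM B.transpose) σ (EuclideanSpace.single j 1))))
  rw [neg_zero, intervalIntegral.integral_symm 0 (-t)] at h
  rw [inner_flowGram, Matrix.neg_apply, hg, ← neg_eq_iff_eq_neg, ← h]
  refine intervalIntegral.integral_congr fun σ _ => ?_
  refine Eq.trans ?_ (inner_single_matrixCLM
    (NormedSpace.exp (σ • B) * Q * NormedSpace.exp (σ • B.transpose)) i j)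
  rw [linearFlow_neg_transpose, ← ContinuousLinearMap.adjoint_inner_right, adjoint_matrixCLM,
    ← Matrix.exp_transpose, Matrix.transpose_smul, Matrix.transpose_transpose, matrixCLM_mul,
    matrixCLM_mul]
  rfl

lemma flowQuad_neg_eq_gramian (t : ℝ) (x : EuclideanSpace ℝ (Fin n)) :
    flowQuad (-matrixCLM B.transpose) (matrixCLM Q) (-t) x =
      -inner ℝ x (matrixCLM (DegenerateSchrodinger.gramian Q B t) x) := by
  rw [flowQuad, flowGram_eq_gramian]
  simp

variable {Q}

lemma posSemidef_gramian (hQ : Q.PosSemidef) {t : ℝ} (ht : 0 ≤ t) :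
    (DegenerateSchrodinger.gramian Q B t).PosSemidef := by
  have hsymm : ∀ x y, inner ℝ (matrixCLM Q x) y = inner ℝ x (matrixCLM Q y) := fun x y =>
    (Matrix.isPositive_toEuclideanLin_iff.2 hQ).1 x y
  have hpos : ∀ x, 0 ≤ inner ℝ x (matrixCLM Q x) := fun x => by
    rw [real_inner_comm]
    exact (Matrix.isPositive_toEuclideanLin_iff.2 hQ).2 x
  have key : ∀ x y, inner ℝ x (matrixCLM (DegenerateSchrodinger.gramian Q B t) y) =
      -inner ℝ x (flowGram (-matrixCLM B.transpose) (matrixCLM Q) (-t) y) := fun x y => by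
    rw [flowGram_eq_gramian]; simp
  rw [← Matrix.isPositive_toEuclideanLin_iff]
  refine ⟨fun x y => ?_, fun x => ?_⟩
  · change inner ℝ (matrixCLM (DegenerateSchrodinger.gramian Q B t) x) y =
      inner ℝ x (matrixCLM (DegenerateSchrodinger.gramian Q B t) y)
    rw [← real_inner_comm, key, key, inner_flowGram, inner_flowGram]
    congr 1
    refine intervalIntegral.integral_congr fun σ _ => ?_
    rw [← hsymm, real_inner_comm]
  · change 0 ≤ inner ℝ (matrixCLM (DegenerateSchrodinger.gramian Q B t) x) x
    rw [← real_inner_comm, key, inner_flowGram, ← intervalIntegral.integral_symm]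
    exact intervalIntegral.integral_nonneg (by linarith) fun σ _ => hpos _

/-- A square root of the Gramian. -/
lemma exists_sqrt_gramian (hQ : Q.PosSemidef) {t : ℝ} (ht : 0 ≤ t)
    (hV : 0 < DegenerateSchrodinger.volumeFn Q B t) :
    ∃ R : EuclideanSpace ℝ (Fin n) ≃L[ℝ] EuclideanSpace ℝ (Fin n),
      (∀ x, flowQuad (-matrixCLM B.transpose) (matrixCLM Q) (-t) x = -1 * ‖R x‖ ^ 2) ∧
      |(R : EuclideanSpace ℝ (Fin n) →L[ℝ] EuclideanSpace ℝ (Fin n)).det| =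
        √(DegenerateSchrodinger.volumeFn Q B t) := by
  obtain ⟨R, hR⟩ := (posSemidef_gramian B hQ ht).exists_eq_conjTranspose_mul_self
  have hdet : DegenerateSchrodinger.volumeFn Q B t = R.det ^ 2 := by
    rw [DegenerateSchrodinger.volumeFn, hR, Matrix.det_mul, Matrix.det_conjTranspose]
    simp; ring
  have hdet0 : (matrixCLM R).det ≠ 0 := by
    rw [det_matrixCLM]; intro h; rw [hdet, h] at hV; simp at hV
  refine ⟨(matrixCLM R).toContinuousLinearEquivOfDetNeZero hdet0, fun x => ?_, ?_⟩
  · rw [flowQuad_neg_eq_gramian, hR, matrixCLM_mul]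
    have h1 : matrixCLM R.conjTranspose = (matrixCLM R).adjoint := by
      rw [adjoint_matrixCLM, Matrix.conjTranspose_eq_transpose_of_trivial]
    have h2 : ((matrixCLM R).adjoint * matrixCLM R) x = (matrixCLM R).adjoint (matrixCLM R x) := rfl
    rw [h1, h2, ContinuousLinearMap.adjoint_inner_right, real_inner_self_eq_norm_sq, neg_one_mul]
    rfl
  · rw [ContinuousLinearMap.coe_toContinuousLinearEquivOfDetNeZero, det_matrixCLM, hdet,
      Real.sqrt_sq_eq_abs]

end Gramian

/-! ### The dispersive estimate for the degenerate Schrödinger group -/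

section Dispersive

variable {n : ℕ} {Q B : Matrix (Fin n) (Fin n) ℝ}

lemma DegenerateSchrodinger.IsCanonicalForm.posSemidef {m : ℕ} {p : Fin (m + 1) → ℕ}
    (h : IsCanonicalForm p Q B) : Q.PosSemidef := by
  set e : (Σ j : Fin (m + 1), Fin (p j)) ≃ Fin n :=
    finSigmaFinEquiv.trans (finCongr h.sum_eq) with he
  have hblock : ∀ j l a b, block h.sum_eq Q j l a b = Q (e ⟨j, a⟩) (e ⟨l, b⟩) :=
    fun _ _ _ _ => rfl
  set M : Matrix (Fin n) (Fin (p 0)) ℝ := Matrix.of fun i a => if i = e ⟨0, a⟩ then 1 else 0 with hM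
  have key : Q = M * block h.sum_eq Q 0 0 * M.conjTranspose := by
    ext i j
    obtain ⟨⟨k, a⟩, rfl⟩ := e.surjective i
    obtain ⟨⟨l, b⟩, rfl⟩ := e.surjective j
    have hMk : ∀ (k : Fin (m + 1)) (a : Fin (p k)) (c : Fin (p 0)),
        M (e ⟨k, a⟩) c = if (⟨k, a⟩ : Σ j : Fin (m + 1), Fin (p j)) = ⟨0, c⟩ then 1 else 0 := by
      intro k a c
      rw [hM, Matrix.of_apply]
      exact if_congr e.injective.eq_iff rfl rfl
    have expand : (M * block h.sum_eq Q 0 0 * M.conjTranspose) (e ⟨k, a⟩) (e ⟨l, b⟩) =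
        ∑ d, (∑ c, M (e ⟨k, a⟩) c * block h.sum_eq Q 0 0 c d) * M (e ⟨l, b⟩) d := by
      simp [Matrix.mul_apply]
    rw [expand]
    by_cases hkl : k = 0 ∧ l = 0
    · obtain ⟨rfl, rfl⟩ := hkl
      simp [hMk, hblock, Sigma.mk.injEq]
    · rw [← hblock, h.zero_Q k l hkl]
      symm
      rcases not_and_or.1 hkl with hk | hl
      · refine Finset.sum_eq_zero fun d _ => ?_
        rw [Finset.sum_eq_zero fun c _ => by rw [hMk, if_neg (by simp [hk]), zero_mul], zero_mul]
      · refine Finset.sum_eq_zero fun d _ => ?_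
        rw [hMk l, if_neg (by simp [hl]), mul_zero]
  rw [key]
  exact h.posDef.posSemidef.mul_mul_conjTranspose_same M

/-- The Fourier transform of the transposed operator. -/
noncomputable def fourierTransposeOp (Q B : Matrix (Fin n) (Fin n) ℝ)
    (χ : 𝓢(EuclideanSpace ℝ (Fin n), ℂ)) : 𝓢(EuclideanSpace ℝ (Fin n), ℂ) :=
  -𝓕 (schwartzTransposeOp Q B (𝓕⁻ χ))

lemma isFourierGenerator_fourierTransposeOp (Q B : Matrix (Fin n) (Fin n) ℝ) :
    IsFourierGenerator (-matrixCLM B.transpose) (matrixCLM Q) (fourierTransposeOp Q B) := by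
  intro χ η
  have h := fourier_schwartzTransposeOp_apply Q B (𝓕⁻ χ) η
  rw [FourierTransform.fourier_fourierInv_eq] at h
  rw [fourierTransposeOp, neg_apply, h, neg_add, neg_neg, neg_apply, map_neg]
  rfl

lemma fourier_schwartzTransposeOp (Q B : Matrix (Fin n) (Fin n) ℝ)
    (ψ : 𝓢(EuclideanSpace ℝ (Fin n), ℂ)) :
    𝓕 (schwartzTransposeOp Q B ψ) = -fourierTransposeOp Q B (𝓕 ψ) := by
  rw [fourierTransposeOp, neg_neg, FourierTransform.fourierInv_fourier_eq]

/-- The propagator of the degenerate Schrödinger equation. -/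
noncomputable def degeneratePropagator (Q B : Matrix (Fin n) (Fin n) ℝ) :
    Propagator (EuclideanSpace ℝ (Fin n))
      (-(LinearMap.trace ℝ (EuclideanSpace ℝ (Fin n))
        ((-matrixCLM B.transpose : EuclideanSpace ℝ (Fin n) →L[ℝ] EuclideanSpace ℝ (Fin n)) :
          EuclideanSpace ℝ (Fin n) →ₗ[ℝ] EuclideanSpace ℝ (Fin n)) / 2))
      (schwartzTransposeOp Q B) :=
  schrodingerPropagator (isFourierGenerator_fourierTransposeOp Q B)
    (fourier_schwartzTransposeOp Q B)

lemma trace_neg_matrixCLM_transpose :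
    LinearMap.trace ℝ (EuclideanSpace ℝ (Fin n))
      ((-matrixCLM B.transpose : EuclideanSpace ℝ (Fin n) →L[ℝ] EuclideanSpace ℝ (Fin n)) :
        EuclideanSpace ℝ (Fin n) →ₗ[ℝ] EuclideanSpace ℝ (Fin n)) = -B.trace := by
  have : ((-matrixCLM B.transpose : EuclideanSpace ℝ (Fin n) →L[ℝ] EuclideanSpace ℝ (Fin n)) :
      EuclideanSpace ℝ (Fin n) →ₗ[ℝ] EuclideanSpace ℝ (Fin n)) =
      -(matrixCLM B.transpose : EuclideanSpace ℝ (Fin n) →ₗ[ℝ] EuclideanSpace ℝ (Fin n)) := rfl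
  rw [this, map_neg, trace_matrixCLM, Matrix.trace_transpose]

/-- The `L¹ → L^∞` estimate of the propagator at any nonzero time. -/
lemma enorm_inner_degeneratePropagator_le_one (hQ : Q.PosSemidef)
    (hV : ∀ t, 0 < t → 0 < DegenerateSchrodinger.volumeFn Q B t) {h : ℝ} (hh : h ≠ 0)
    (ψ χ : 𝓢(EuclideanSpace ℝ (Fin n), ℂ)) :
    ‖inner ℂ (χ.toLp 2 volume) ((degeneratePropagator Q B).U h (ψ.toLp 2 volume))‖ₑ ≤
      ENNReal.ofReal (√(DegenerateSchrodinger.volumeFn Q B (|h| / 2)))⁻¹ *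
        (eLpNorm ψ 1 volume * eLpNorm χ 1 volume) := by
  set N := -matrixCLM B.transpose with hN
  set S := matrixCLM Q with hS
  have hτ : 0 < |h| := abs_pos.2 hh
  set τ := |h| with hτdef
  obtain ⟨R, hR, hRdet⟩ := exists_sqrt_gramian B hQ hτ.le (hV τ hτ)
  obtain ⟨R', hR', hRdet'⟩ := exists_sqrt_gramian B hQ (half_pos hτ).le (hV _ (half_pos hτ))
  set T : EuclideanSpace ℝ (Fin n) →L[ℝ] EuclideanSpace ℝ (Fin n) :=
    (R' : EuclideanSpace ℝ (Fin n) →L[ℝ] EuclideanSpace ℝ (Fin n)).comp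
      (linearFlow N (-(τ / 2))) with hT
  have hle : ∀ x, ‖T x‖ ≤ ‖R x‖ := by
    intro x
    have h1 := flowQuad_add N S (-(τ / 2)) (-(τ / 2)) x
    rw [show -(τ / 2) + -(τ / 2) = -τ by ring, hR, hR', hR'] at h1
    have h2 : ‖T x‖ = ‖R' (linearFlow N (-(τ / 2)) x)‖ := rfl
    rw [h2]
    refine (sq_le_sq₀ (norm_nonneg _) (norm_nonneg _)).1 ?_
    nlinarith [sq_nonneg ‖R' x‖]
  have hdet := abs_det_le_of_norm_le R T hle
  have hTdet : |T.det| = √(DegenerateSchrodinger.volumeFn Q B (τ / 2)) *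
      Real.exp (τ / 2 * B.trace) := by
    have : T.det = (R' : EuclideanSpace ℝ (Fin n) →L[ℝ] EuclideanSpace ℝ (Fin n)).det *
        (linearFlow N (-(τ / 2))).det := LinearMap.det_comp _ _
    rw [this, abs_mul, hRdet', det_linearFlow, trace_neg_matrixCLM_transpose,
      abs_of_pos (Real.exp_pos _)]
    congr 2
    ring
  rw [hTdet] at hdet
  have hV2 : 0 < √(DegenerateSchrodinger.volumeFn Q B (τ / 2)) :=
    Real.sqrt_pos.2 (hV _ (half_pos hτ))
  have hRpos : 0 < |(R : EuclideanSpace ℝ (Fin n) →L[ℝ] EuclideanSpace ℝ (Fin n)).det| :=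
    lt_of_lt_of_le (by positivity) hdet
  have hfin : Real.exp (τ / 2 * B.trace) *
      |(R : EuclideanSpace ℝ (Fin n) →L[ℝ] EuclideanSpace ℝ (Fin n)).det|⁻¹ ≤
        (√(DegenerateSchrodinger.volumeFn Q B (τ / 2)))⁻¹ := by
    rw [← div_eq_mul_inv, div_le_iff₀ hRpos, inv_mul_eq_div, le_div_iff₀ hV2, mul_comm]
    exact hdet
  rcases le_or_gt h 0 with hneg | hpos
  · have hhτ : h = -τ := by rw [hτdef, abs_of_nonpos hneg, neg_neg]
    refine (enorm_inner_schrodingerPropagator_le (σ := -1) _ _ (by simp) R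
      (fun ξ => by rw [hhτ]; exact hR ξ) ψ χ).trans ?_
    gcongr
    rw [trace_neg_matrixCLM_transpose, abs_inv]
    refine le_trans (le_of_eq ?_) hfin
    rw [hhτ]
    congr 2
    ring
  · have hhτ : h = τ := by rw [hτdef, abs_of_pos hpos]
    have hflow : ∀ ξ, flowQuad N S h ξ = 1 * ‖((linearFlowEquiv N h).trans R) ξ‖ ^ 2 := by
      intro ξ
      have h1 := flowQuad_add N S τ (-τ) ξ
      rw [add_neg_cancel, flowQuad_zero, hR] at h1
      have h2 : ((linearFlowEquiv N h).trans R) ξ = R (linearFlow N τ ξ) := by rw [hhτ]; rfl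
      rw [h2, hhτ]
      linarith
    refine (enorm_inner_schrodingerPropagator_le (σ := 1) _ _ (by simp) _ hflow ψ χ).trans ?_
    gcongr
    have hd : (((linearFlowEquiv N h).trans R :
        EuclideanSpace ℝ (Fin n) ≃L[ℝ] EuclideanSpace ℝ (Fin n)) :
        EuclideanSpace ℝ (Fin n) →L[ℝ] EuclideanSpace ℝ (Fin n)).det =
        (R : EuclideanSpace ℝ (Fin n) →L[ℝ] EuclideanSpace ℝ (Fin n)).det *
          (linearFlow N h).det := LinearMap.det_comp _ _
    rw [hd, det_linearFlow, trace_neg_matrixCLM_transpose, abs_inv, abs_mul,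
      abs_of_pos (Real.exp_pos _), mul_inv, ← Real.exp_neg]
    refine le_trans (le_of_eq ?_) hfin
    rw [mul_comm |_|⁻¹, ← mul_assoc, ← Real.exp_add, hhτ]
    congr 2
    ring

end Dispersive

/-! ### The Strichartz estimate -/

section KernelBound

lemma half_rpow_neg_le {x l : ℝ} (hx : 0 < x) (hl : l ≤ 1) :
    (x / 2) ^ (-l) ≤ 2 * x ^ (-l) := by
  rw [Real.div_rpow hx.le zero_le_two, Real.rpow_neg zero_le_two, div_inv_eq_mul, mul_comm]
  gcongr
  simpa using Real.rpow_le_rpow_of_exponent_le one_le_two hl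

lemma min_rpow_neg_le {D δ k l d x : ℝ} (hd : d ≤ D) (hk : k = D * δ) (hl : l ≤ d * δ)
    (hk1 : k ≤ 1) (hl1 : l ≤ 1) (hx : 0 < x) :
    min ((x / 2) ^ D) ((x / 2) ^ d) ^ (-δ) ≤ 2 * (x ^ (-k) + x ^ (-l)) := by
  have ha : 0 < x / 2 := half_pos hx
  have hk0 : 0 ≤ x ^ (-k) := Real.rpow_nonneg hx.le _
  have hl0 : 0 ≤ x ^ (-l) := Real.rpow_nonneg hx.le _
  rcases le_total (x / 2) 1 with h1 | h1
  · rw [min_eq_left (Real.rpow_le_rpow_of_exponent_ge ha h1 hd), ← Real.rpow_mul ha.le,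
      mul_neg, ← hk]
    linarith [half_rpow_neg_le hx hk1]
  · rw [min_eq_right (Real.rpow_le_rpow_of_exponent_le h1 hd), ← Real.rpow_mul ha.le, mul_neg]
    have := Real.rpow_le_rpow_of_exponent_le h1 (neg_le_neg hl)
    linarith [half_rpow_neg_le hx hl1]

end KernelBound

section MainEstimate

variable {n : ℕ} {Q B : Matrix (Fin n) (Fin n) ℝ} {D : ℕ} {γ d r q q' : ℝ}

lemma DegenerateSchrodinger.VolumeLowerBound.volumeFn_pos (h : VolumeLowerBound Q B γ D d)
    (hγ : 0 < γ) {t : ℝ} (ht : 0 < t) : 0 < volumeFn Q B t :=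
  lt_of_lt_of_le (by positivity) (h t ht)

lemma DegenerateSchrodinger.VolumeLowerBound.inv_sqrt_rpow_le (h : VolumeLowerBound Q B γ D d)
    (hγ : 0 < γ) (hd : d ≤ D) {δ k l : ℝ} (hδ : 0 ≤ δ) (hk : k = D * δ) (hl : l ≤ d * δ)
    (hk1 : k ≤ 1) (hl1 : l ≤ 1) {x : ℝ} (hx : 0 < x) :
    (√(volumeFn Q B (x / 2)))⁻¹ ^ (2 * δ) ≤ 2 * γ ^ (-δ) * (x ^ (-k) + x ^ (-l)) := by
  have hV := h.volumeFn_pos hγ (half_pos hx)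
  have h1 : (√(volumeFn Q B (x / 2)))⁻¹ ^ (2 * δ) = volumeFn Q B (x / 2) ^ (-δ) := by
    rw [Real.sqrt_eq_rpow, ← Real.rpow_neg hV.le, ← Real.rpow_mul hV.le]
    congr 1
    ring
  have hmin : 0 < min ((x / 2) ^ D) ((x / 2) ^ d) := by positivity
  have h2 := Real.rpow_le_rpow_of_nonpos (mul_pos hγ hmin) (h _ (half_pos hx)) (neg_nonpos.2 hδ)
  have h3 := min_rpow_neg_le hd hk hl hk1 hl1 hx
  rw [Real.rpow_natCast] at h3
  rw [h1]
  refine h2.trans ?_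
  rw [Real.mul_rpow hγ.le hmin.le]
  nlinarith [Real.rpow_nonneg hγ.le (-δ)]

lemma isDispersive_degeneratePropagator (hQ : Q.PosSemidef)
    (hV : DegenerateSchrodinger.VolumeLowerBound Q B γ D d) (hγ : 0 < γ) (hd : d < D)
    (hr : 2 < r) (hq : 2 < q) (hqq' : q < q') (hqr : 2 / q = D * (1 / 2 - 1 / r))
    (hq'r : 2 / q' ≤ d * (1 / 2 - 1 / r)) {A : ℝ≥0∞} (hA : A ≠ ∞)
    (hbil : ∀ f g : ℝ → ℝ≥0∞, AEMeasurable f → AEMeasurable g →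
      ∫⁻ x, ∫⁻ y, f x * g y * (rieszKernel (2 / q) (x - y) + rieszKernel (2 / q') (x - y)) ≤
        A * (dualNorm q q' f * dualNorm q q' g)) :
    (degeneratePropagator Q B).IsDispersive r r.conjExponent q q'
      (fun t => ENNReal.ofReal (2 * γ ^ (-(1 / 2 - 1 / r))) *
        (rieszKernel (2 / q) t + rieszKernel (2 / q') t))
      (ENNReal.ofReal (2 * γ ^ (-(1 / 2 - 1 / r))) * A) where
  conj := .conjExponent (by linarith)
  two_lt := hr
  two_lt_left := hq
  lt := hqq'
  even t := by simp only [rieszKernel_neg]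
  ne_top := ENNReal.mul_ne_top ENNReal.ofReal_ne_top hA
  bilinear f g hf hg := by
    simp only [mul_left_comm _ (ENNReal.ofReal (2 * γ ^ (-(1 / 2 - 1 / r))))]
    have h1 : ∀ x, ∫⁻ y, ENNReal.ofReal (2 * γ ^ (-(1 / 2 - 1 / r))) *
        (f x * g y * (rieszKernel (2 / q) (x - y) + rieszKernel (2 / q') (x - y))) =
        ENNReal.ofReal (2 * γ ^ (-(1 / 2 - 1 / r))) * ∫⁻ y, f x * g y *
          (rieszKernel (2 / q) (x - y) + rieszKernel (2 / q') (x - y)) := fun x =>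
      lintegral_const_mul' _ _ ENNReal.ofReal_ne_top
    simp only [h1]
    rw [lintegral_const_mul' _ _ ENNReal.ofReal_ne_top, mul_assoc]
    gcongr
    exact hbil f g hf hg
  disp t ht ψ χ := by
    have hrinv : 1 / r < 1 / 2 := one_div_lt_one_div_of_lt two_pos hr
    have hrpos : 0 < 1 / r := by positivity
    have hpos : 0 < |t| := abs_pos.2 ht
    refine (enorm_inner_schwartz_le ((degeneratePropagator Q B).U t).toContinuousLinearMap
      (fun f => (LinearIsometry.norm_map _ f).le) (p := r.conjExponent)
      (θ := 2 * (1 / 2 - 1 / r)) (by positivity) (by linarith) (by linarith) ?_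
      (fun ψ χ => enorm_inner_degeneratePropagator_le_one hQ
        (fun t ht => hV.volumeFn_pos hγ ht) ht ψ χ) ψ χ).trans ?_
    · have h1 : r - 1 ≠ 0 := by linarith
      have h2 : r ≠ 0 := by linarith
      rw [Real.conjExponent]
      field_simp
      ring
    · gcongr
      rw [rieszKernel, rieszKernel, ← ENNReal.ofReal_add (by positivity) (by positivity),
        ← ENNReal.ofReal_mul (by positivity)]
      refine ENNReal.ofReal_le_ofReal ?_
      exact hV.inv_sqrt_rpow_le hγ hd.le (by linarith) hqr hq'r
        ((div_le_one (by linarith)).2 hq.le) ((div_le_one (by linarith)).2 (by linarith)) hpos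

end MainEstimate

theorem theoremB (n : ℕ) (hn : 2 ≤ n) (D : ℕ) (γ Dinf r q qinf : ℝ)
    (hγ : 0 < γ) (hDinf : 2 ≤ Dinf) (hDinf_lt : Dinf < D)
    (hr : 2 < r) (hr_lt : 2 < D → r < 2 * D / (D - 2))
    (hq : 2 / q = D * (1 / 2 - 1 / r))
    (hqinf : 1 < qinf) (hqinf_le : 2 / qinf ≤ Dinf * (1 / 2 - 1 / r)) :
    ∃ C : ℝ, 0 < C ∧
      ∀ (m : ℕ) (p : Fin (m + 1) → ℕ) (Q B : Matrix (Fin n) (Fin n) ℝ),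
        DegenerateSchrodinger.IsCanonicalForm p Q B →
        D = DegenerateSchrodinger.homDim p →
        DegenerateSchrodinger.VolumeLowerBound Q B γ D Dinf →
        ∀ (φ : Lp ℂ 2 (volume : Measure (EuclideanSpace ℝ (Fin n))))
          (F : ℝ → EuclideanSpace ℝ (Fin n) → ℂ),
          AEStronglyMeasurable (Function.uncurry F) (volume.prod volume) →
          DegenerateSchrodinger.interNorm
              (ENNReal.ofReal q.conjExponent) (ENNReal.ofReal qinf.conjExponent)
              (DegenerateSchrodinger.weightedNorm B (ENNReal.ofReal r.conjExponent) F) < ∞ →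
          (∃ u : ℝ → Lp ℂ 2 (volume : Measure (EuclideanSpace ℝ (Fin n))),
            DegenerateSchrodinger.IsSolution Q B φ F u) ∧
          ∀ u : ℝ → Lp ℂ 2 (volume : Measure (EuclideanSpace ℝ (Fin n))),
            DegenerateSchrodinger.IsSolution Q B φ F u →
            DegenerateSchrodinger.sumNorm (ENNReal.ofReal q) (ENNReal.ofReal qinf)
                (DegenerateSchrodinger.weightedNorm B (ENNReal.ofReal r) (fun t x => u t x)) ≤
              ENNReal.ofReal C *
                (eLpNorm φ 2 volume +
                  DegenerateSchrodinger.interNorm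
                    (ENNReal.ofReal q.conjExponent) (ENNReal.ofReal qinf.conjExponent)
                    (DegenerateSchrodinger.weightedNorm B
                      (ENNReal.ofReal r.conjExponent) F)) := by
  have hD2 : (2 : ℝ) < D := by linarith
  have hδ : 0 < 1 / 2 - 1 / r := sub_pos.2 (one_div_lt_one_div_of_lt two_pos hr)
  have hDδ : (D : ℝ) * (1 / 2 - 1 / r) < 1 := by
    have h1 := hr_lt (by exact_mod_cast hD2)
    rw [lt_div_iff₀ (by linarith)] at h1
    have h2 : (D : ℝ) * (1 / 2 - 1 / r) = D * (r - 2) / (2 * r) := by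
      field_simp
    rw [h2, div_lt_one (by linarith)]
    linarith
  have hqpos : 0 < q := by
    have : 0 < 2 / q := by rw [hq]; positivity
    by_contra hneg
    exact absurd this (not_lt.2 (div_nonpos_of_nonneg_of_nonpos zero_le_two (not_lt.1 hneg)))
  have hq2 : 2 < q := by
    rw [← hq, div_lt_one hqpos] at hDδ
    exact hDδ
  have hqq : q < qinf := by
    have : 2 / qinf < 2 / q := by
      rw [hq]
      exact hqinf_le.trans_lt (mul_lt_mul_of_pos_right hDinf_lt hδ)
    rwa [div_lt_div_iff_of_pos_left two_pos (by linarith) hqpos] at this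
  obtain ⟨A, hA, hbil⟩ := exists_rieszKernel_add_pairing_le hq2 (hq2.trans hqq)
  set A' := ENNReal.ofReal (2 * γ ^ (-(1 / 2 - 1 / r))) * A with hA'
  have hA'top : A' ≠ ∞ := ENNReal.mul_ne_top ENNReal.ofReal_ne_top hA
  set M : ℝ≥0∞ := 2 * (A' ^ (1 / 2 : ℝ) + A') with hM
  have hMtop : M ≠ ∞ := ENNReal.mul_ne_top (by simp)
    (ENNReal.add_ne_top.2 ⟨ENNReal.rpow_ne_top_of_nonneg (by norm_num) hA'top, hA'top⟩)
  refine ⟨M.toReal + 1, by positivity, fun m p Q B hcan _ hV φ F hF hN => ?_⟩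
  have hP := isDispersive_degeneratePropagator hcan.posSemidef hV hγ hDinf_lt hr hq2 hqq hq
    hqinf_le hA hbil
  have hβ : -(LinearMap.trace ℝ (EuclideanSpace ℝ (Fin n))
      ((-matrixCLM B.transpose : EuclideanSpace ℝ (Fin n) →L[ℝ] EuclideanSpace ℝ (Fin n)) :
        EuclideanSpace ℝ (Fin n) →ₗ[ℝ] EuclideanSpace ℝ (Fin n)) / 2) = B.trace / 2 := by
    rw [trace_neg_matrixCLM_transpose, neg_div, neg_neg]
  have hw : ∀ (s : ℝ) (G : ℝ → EuclideanSpace ℝ (Fin n) → ℂ),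
      weightedSlice (-(LinearMap.trace ℝ (EuclideanSpace ℝ (Fin n))
        ((-matrixCLM B.transpose : EuclideanSpace ℝ (Fin n) →L[ℝ] EuclideanSpace ℝ (Fin n)) :
          EuclideanSpace ℝ (Fin n) →ₗ[ℝ] EuclideanSpace ℝ (Fin n)) / 2)) s G =
      DegenerateSchrodinger.weightedNorm B (ENNReal.ofReal s) G := by
    intro s G
    rw [hβ]
    rfl
  have hN' := hN.ne
  rw [← hw] at hN'
  have hop : ∀ ψ : 𝓢(EuclideanSpace ℝ (Fin n), ℂ),
      DegenerateSchrodinger.transposeOp Q B ψ = schwartzTransposeOp Q B ψ := fun ψ =>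
    funext fun x => (schwartzTransposeOp_apply Q B ψ x).symm
  constructor
  · obtain ⟨u, hu, hu0, hweak⟩ := hP.exists_solution
      (isForcing_of_dualNorm (by linarith) hF hN') hN' φ
    refine ⟨u, hu, hu0, fun ψ t => ?_⟩
    rw [hop]
    exact hweak ψ t
  · intro u hu
    have hweak := hu.weak_eq
    simp only [hop] at hweak
    have h := hP.sumNorm_le hF hN' hu.continuous hweak
    rw [hw, hw, ← hA'] at h
    refine h.trans ?_
    have hφ : ‖φ‖ₑ = eLpNorm φ 2 volume := Lp.enorm_def φ
    have hMC : M ≤ ENNReal.ofReal (M.toReal + 1) :=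
      (ENNReal.ofReal_toReal hMtop).symm.le.trans (ENNReal.ofReal_le_ofReal (by linarith))
    rw [hφ]
    refine le_trans ?_ (mul_le_mul' hMC le_rfl)
    rw [hM, mul_assoc 2 (A' ^ (1 / 2 : ℝ) + A')]
    refine mul_le_mul' le_rfl ?_
    rw [mul_add, mul_comm (eLpNorm φ 2 volume)]
    exact add_le_add (mul_le_mul' le_self_add le_rfl) (mul_le_mul' le_add_self le_rfl)
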